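/- Let $k$ be a perfect field and let $\mathrm{Sm}_k$ be the category of smooth quasi-compact quasi-separated $k$-schemes. Presheaves, maps and colimits below are taken in the homotopical ($\infty$-categorical) sense, with values in spaces. For a presheaf of spaces $F$ on $\mathrm{Sm}_k$ put $$(\hat C_1F)(Y)=\operatorname{colim}_{Y\times\{0,1\}\subset U\subset Y\times\mathbb A^1}F(U),$$ the colimit being over the open subschemes $U$ of $Y\times\mathbb A^1$ that contain $Y\times\{0,1\}$, and let $i_0^*,i_1^*:\hat C_1F\to F$ be the pullbacks to $Y\times\{0\}$ and $Y\times\{1\}$. Call $F$ *rationally contractible* if there is a map $s:F\to\hat C_1F$ of presheaves of spaces such that $i_0^*s\simeq\mathrm{id}_F$ and $i_1^*s$ is constant, i.e. factors, up to homotopy, through the terminal presheaf. For $X,Y\in\mathrm{Sm}_k$ let $h^{\mathrm{flf}}(X_+)(Y)$ be the groupoid of spans of $k$-schemes $Y\xleftarrow{p}Z\xrightarrow{q}X$ with $p$ finite locally free, and of isomorphisms of such spans; this is the mapping space from $Y$ to $X$ in the category $\mathrm{Cor}^{\mathrm{flf}}(k)$ of finite locally free correspondences. Via disjoint union of spans,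 $h^{\mathrm{flf}}(X_+)$ is a presheaf of $E_\infty$-monoids on $\mathrm{Sm}_k$, contravariant in $Y$ by base change. The functor $X_+\mapsto h^{\mathrm{flf}}(X_+)$ is functorial for pointed maps and is extended, commuting with geometric realizations, to pointed presheaves that are realizations of simplicial diagrams of smooth schemes with a disjoint base point; so $h^{\mathrm{flf}}(X,x_0)$ is the quotient of $h^{\mathrm{flf}}(X_+)$ by $h^{\mathrm{flf}}((x_0)_+)$ in presheaves of $E_\infty$-monoids. Let $\mathbb G_m=\mathbb A^1\setminus 0$ be pointed at $1$, let $\mathbb G_m^{\wedge n}$ be its $n$-fold smash power, and let $(-)^{\mathrm{gp}}$ denote the (sectionwise) group completion of $E_\infty$-monoids. Then $\mathrm{Cor}^{\mathrm{flf}}(k)$ satisfies rational contractibility: for every integer $n>0$ the presheaf of spaces $h^{\mathrm{flf}}(\mathbb G_m^{\wedge n})^{\mathrm{gp}}$ on $\mathrm{Sm}_k$ is rationally contractible. -/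

import Mathlib

open CategoryTheory Limits Opposite Simplicial MonoidalCategory AlgebraicGeometry

universe w u

noncomputable section

namespace SSet

/-- Weak homotopy equivalences of simplicial sets: the maps `f : X ⟶ Y` such that precomposition
with `f` is a bijection `[Y, K] → [X, K]` on homotopy classes of maps, for every Kan complex `K`. -/
def weakEq : MorphismProperty SSet.{w} := fun X Y f =>
  ∀ K : SSet.{w}, K.KanComplex →
    (∀ g : X ⟶ K, ∃ h : Y ⟶ K, Nonempty (Homotopy (f ≫ h) g)) ∧
    (∀ h h' : Y ⟶ K, Nonempty (Homotopy (f ≫ h) (f ≫ h')) → Nonempty (Homotopy h h'))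

/-- The last vertex of a nonempty chain in `{0, …, n}`. -/
def lastVertex (n : SimplexCategory) :
    PartialOrder.NonemptyFiniteChains (ULift.{w} (Fin (n.len + 1))) →o Fin (n.len + 1) where
  toFun s := (s.finset.max' s.nonempty).down
  monotone' _ _ h := Finset.max'_subset _ h

lemma lastVertex_map {n m : SimplexCategory} (f : n ⟶ m)
    (s : PartialOrder.NonemptyFiniteChains (ULift.{w} (Fin (n.len + 1)))) :
    lastVertex m (s.map (SimplexCategory.toPartOrd.{w}.map f).hom) =
      f (lastVertex n s) := by
  apply ULift.up_injective
  apply le_antisymm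
  · refine Finset.max'_le _ (s.map _).nonempty _ fun y hy => ?_
    obtain ⟨x, hx, rfl⟩ := (PartialOrder.NonemptyFiniteChains.mem_map_iff _ _ _).1 hy
    exact (SimplexCategory.toPartOrd.{w}.map f).hom.monotone (Finset.le_max' _ _ hx)
  · apply Finset.le_max'
    exact (PartialOrder.NonemptyFiniteChains.mem_map_iff _ _ _).2
      ⟨_, Finset.max'_mem _ s.nonempty, rfl⟩

/-- The last vertex map `sd Δ[n] ⟶ Δ[n]`. -/
def lastVertexMap : SimplexCategory.sd.{w} ⟶ stdSimplex.{w} where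
  app n :=
    { app m := ↾fun (s : ComposableArrows (PartialOrder.NonemptyFiniteChains
          (ULift.{w} (Fin (n.len + 1)))) m.unop.len) =>
        stdSimplex.objEquiv.symm (SimplexCategory.mkHom
          { toFun i := lastVertex n (s.obj i)
            monotone' i j h := (lastVertex n).monotone (s.map h.hom).le })
      naturality _ _ _ := rfl }
  naturality n m f := by
    ext k (s : ComposableArrows (PartialOrder.NonemptyFiniteChains
          (ULift.{w} (Fin (n.len + 1)))) k.unop.len)
    apply stdSimplex.objEquiv.injective
    ext i
    exact congrArg Fin.val (lastVertex_map f (s.obj i))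

/-- The natural map `X ⟶ Ex X` given by the last vertex maps. -/
def toEx : 𝟭 SSet.{w} ⟶ ex where
  app X :=
    { app n := ↾fun x => ULift.up (lastVertexMap.app n.unop ≫ yonedaEquiv.symm x)
      naturality n m f := by
        ext x
        apply ULift.ext
        change lastVertexMap.app m.unop ≫ yonedaEquiv.symm (X.map f x) =
          SimplexCategory.sd.map f.unop ≫ lastVertexMap.app n.unop ≫ yonedaEquiv.symm x
        rw [lastVertexMap.naturality_assoc]
        congr 1
        exact (yonedaEquiv_symm_naturality_left (X := X) f.unop x).symm }
  naturality X Y f := by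
    ext n x
    apply ULift.ext
    change lastVertexMap.app n.unop ≫ yonedaEquiv.symm (f.app n x) =
      (lastVertexMap.app n.unop ≫ yonedaEquiv.symm x) ≫ f
    rw [Category.assoc]
    exact congrArg (lastVertexMap.app n.unop ≫ ·) (yonedaEquiv_symm_comp x f).symm

/-- The iterates of Kan's functor `Ex`. -/
def exIter (i : ℕ) : SSet.{w} ⥤ SSet.{w} :=
  Nat.rec (𝟭 _) (fun _ F => F ⋙ ex) i

/-- Kan's fibrant replacement functor `Ex^∞`, the colimit of `X ⟶ Ex X ⟶ Ex² X ⟶ ⋯`. -/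
def exInf : SSet.{w} ⥤ SSet.{w} :=
  colimit (Functor.ofSequence (X := exIter.{w}) fun i => (exIter i).whiskerLeft toEx)

/-- The natural map `X ⟶ Ex^∞ X`. -/
def toExInf : 𝟭 SSet.{w} ⟶ exInf :=
  colimit.ι (Functor.ofSequence (X := exIter.{w}) fun i => (exIter i).whiskerLeft toEx) 0

end SSet

/-- Pointed simplicial sets. -/
abbrev PSSet := SimplicialObject Pointed.{w}

namespace PSSet

/-- The underlying simplicial set. -/
def forget : PSSet.{w} ⥤ SSet.{w} :=
  (SimplicialObject.whiskering _ _).obj (CategoryTheory.forget Pointed)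

/-- The constant map to the base point. -/
def basept (X : PSSet.{w}) (T : SSet.{w}) : T ⟶ forget.obj X where
  app m := ↾fun _ => (X.obj m).point
  naturality m m' f := by
    ext x
    exact (X.map f).map_point.symm

/-- The constant map to the base point of `Ex^∞ X`. -/
def exBasept (X : PSSet.{w}) (T : SSet.{w}) : T ⟶ SSet.exInf.obj (forget.obj X) :=
  basept X T ≫ SSet.toExInf.app (forget.obj X)

lemma comp_exBasept (X : PSSet.{w}) {T T' : SSet.{w}} (f : T ⟶ T') :
    f ≫ exBasept X T' = exBasept X T := rfl

lemma exBasept_comp {X Y : PSSet.{w}} (f : X ⟶ Y) (T : SSet.{w}) :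
    exBasept X T ≫ SSet.exInf.map (forget.map f) = exBasept Y T := by
  have h : basept X T ≫ forget.map f = basept Y T := by
    ext m x
    exact (f.app m).map_point
  have h' : SSet.toExInf.app (forget.obj X) ≫ SSet.exInf.map (forget.map f) =
      forget.map f ≫ SSet.toExInf.app (forget.obj Y) :=
    (SSet.toExInf.naturality (forget.map f)).symm
  calc _ = basept X T ≫ (SSet.toExInf.app (forget.obj X) ≫ SSet.exInf.map (forget.map f)) :=
        Category.assoc _ _ _
    _ = basept X T ≫ (forget.map f ≫ SSet.toExInf.app (forget.obj Y)) := by rw [h']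
    _ = (basept X T ≫ forget.map f) ≫ SSet.toExInf.app (forget.obj Y) :=
        (Category.assoc _ _ _).symm
    _ = _ := by rw [h]; rfl

/-- A homotopy `T ⊗ Δ[1] ⟶ Ex^∞ X` that is constant at the base point on both ends. -/
def IsLoop (X : PSSet.{w}) {T : SSet.{w}} (γ : T ⊗ Δ[1] ⟶ SSet.exInf.obj (forget.obj X)) :
    Prop :=
  SSet.ι₀ ≫ γ = exBasept X T ∧ SSet.ι₁ ≫ γ = exBasept X T

lemma IsLoop.precomp {X : PSSet.{w}} {T T' : SSet.{w}}
    {γ : T ⊗ Δ[1] ⟶ SSet.exInf.obj (forget.obj X)} (h : X.IsLoop γ) (f : T' ⟶ T) :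
    X.IsLoop (f ▷ Δ[1] ≫ γ) := by
  constructor
  · rw [SSet.ι₀_comp_assoc, h.1, comp_exBasept]
  · rw [SSet.ι₁_comp_assoc, h.2, comp_exBasept]

lemma IsLoop.postcomp {X Y : PSSet.{w}} {T : SSet.{w}}
    {γ : T ⊗ Δ[1] ⟶ SSet.exInf.obj (forget.obj X)} (h : X.IsLoop γ) (f : X ⟶ Y) :
    Y.IsLoop (γ ≫ SSet.exInf.map (forget.map f)) := by
  constructor
  · rw [← Category.assoc, h.1, exBasept_comp]
  · rw [← Category.assoc, h.2, exBasept_comp]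

/-- The (derived) loop space `Ω X`: the loops in the Kan complex `Ex^∞ X`. -/
def loopSpace : PSSet.{w} ⥤ SSet.{w} where
  obj X :=
    { obj m := { γ : SSet.stdSimplex.obj m.unop ⊗ Δ[1] ⟶ SSet.exInf.obj (forget.obj X) //
        X.IsLoop γ }
      map f := ↾fun γ => ⟨SSet.stdSimplex.map f.unop ▷ Δ[1] ≫ γ.1, γ.2.precomp _⟩
      map_id m := ConcreteCategory.hom_ext _ _ fun γ => Subtype.ext (by
        have h : SSet.stdSimplex.{w}.map (𝟙 m.unop) = 𝟙 _ := CategoryTheory.Functor.map_id _ _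
        change SSet.stdSimplex.map (𝟙 m.unop) ▷ Δ[1] ≫ γ.1 = γ.1
        rw [h, id_whiskerRight, Category.id_comp])
      map_comp f g := ConcreteCategory.hom_ext _ _ fun γ => Subtype.ext (by
        have h : SSet.stdSimplex.{w}.map (g.unop ≫ f.unop) =
          SSet.stdSimplex.map g.unop ≫ SSet.stdSimplex.map f.unop :=
            CategoryTheory.Functor.map_comp _ _ _
        change SSet.stdSimplex.map (g.unop ≫ f.unop) ▷ Δ[1] ≫ γ.1 =
          SSet.stdSimplex.map g.unop ▷ Δ[1] ≫ SSet.stdSimplex.map f.unop ▷ Δ[1] ≫ γ.1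
        rw [h, comp_whiskerRight, Category.assoc]) }
  map {X Y} f :=
    { app m := ↾fun γ => ⟨γ.1 ≫ SSet.exInf.map (forget.map f), γ.2.postcomp f⟩
      naturality m m' g := by refine ConcreteCategory.hom_ext _ _ fun γ => Subtype.ext ?_; simp }
  map_id X := by
    apply NatTrans.ext
    funext m
    refine ConcreteCategory.hom_ext _ _ fun γ => Subtype.ext ?_
    simp
  map_comp f g := by
    apply NatTrans.ext
    funext m
    refine ConcreteCategory.hom_ext _ _ fun γ => Subtype.ext ?_
    simp

/-- The diagonal of a simplicial pointed simplicial set, a model of its homotopy colimit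
(geometric realization). -/
def diag : SimplicialObject PSSet.{w} ⥤ PSSet.{w} where
  obj X :=
    { obj m := (X.obj m).obj m
      map {m m'} f := (X.map f).app m ≫ (X.obj m').map f
      map_id m := by simp
      map_comp f g := by simp }
  map φ := { app m := (φ.app m).app m
             naturality m m' f := by
               have := congr_app (φ.naturality f) m
               simp only [NatTrans.comp_app] at this
               simp only [Category.assoc, (φ.app m').naturality]
               rw [reassoc_of% this] }
  map_id X := rfl
  map_comp f g := rfl
end PSSet

namespace FlfCor

lemma smooth_affineLine (S : Scheme.{u}) : Smooth (𝔸(PUnit.{u + 1}; S) ↘ S) := by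
  have := isIso_of_isTerminal specULiftZIsTerminal.{u} terminalIsTerminal (terminal.from _)
  have h : Smooth (terminal.from
      (Spec (CommRingCat.of (MvPolynomial PUnit.{u + 1} (ULift.{u} ℤ))))) := by
    rw [← terminal.comp_from (Spec.map (CommRingCat.ofHom MvPolynomial.C))]
    have : Smooth (Spec.map (CommRingCat.ofHom
        (MvPolynomial.C : ULift.{u} ℤ →+* MvPolynomial PUnit.{u + 1} (ULift.{u} ℤ)))) := by
      rw [HasRingHomProperty.Spec_iff (P := @Smooth)]
      exact RingHom.smooth_algebraMap.2 ⟨inferInstance, inferInstance⟩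
    infer_instance
  exact inferInstanceAs (Smooth (pullback.fst (terminal.from S) (terminal.from
      (Spec (CommRingCat.of (MvPolynomial PUnit.{u + 1} (ULift.{u} ℤ)))))))

variable (k : Type u) [Field k]

/-- The spectrum of `k`. -/
abbrev SpecK : Scheme.{u} := Spec (CommRingCat.of k)

/-- Smooth, quasi-compact and quasi-separated `k`-schemes. -/
def isSm : ObjectProperty (Over (SpecK k)) := fun X =>
  Smooth X.hom ∧ QuasiCompact X.hom ∧ QuasiSeparated X.hom

/-- The category of smooth quasi-compact quasi-separated `k`-schemes. -/
abbrev Sm := (isSm k).FullSubcategory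

/-- The inclusion of smooth `k`-schemes into all `k`-schemes. -/
abbrev Sm.toOver : Sm k ⥤ Over (SpecK k) := (isSm k).ι

variable {k}
namespace Sm
/-- The affine line `Y × 𝔸¹` over `Y`. -/
abbrev A1 (Y : Sm k) : Scheme.{u} := 𝔸(PUnit.{u+1}; Y.obj.left)

/-- The projection `Y × 𝔸¹ ⟶ Y`. -/
abbrev A1.proj (Y : Sm k) : Y.A1 ⟶ Y.obj.left := Y.A1 ↘ Y.obj.left

/-- The zero section of `Y × 𝔸¹`. -/
def zero (Y : Sm k) : Y.obj.left ⟶ Y.A1 := AffineSpace.homOfVector (𝟙 _) 0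

/-- The unit section of `Y × 𝔸¹`. -/
def one (Y : Sm k) : Y.obj.left ⟶ Y.A1 := AffineSpace.homOfVector (𝟙 _) 1

/-- The map `Y' × 𝔸¹ ⟶ Y × 𝔸¹` induced by `g : Y' ⟶ Y`. -/
def A1map {Y' Y : Sm k} (g : Y' ⟶ Y) : Y'.A1 ⟶ Y.A1 := AffineSpace.map _ g.hom.left

lemma A1map_proj {Y' Y : Sm k} (g : Y' ⟶ Y) :
    A1map g ≫ A1.proj Y = A1.proj Y' ≫ g.hom.left :=
  AffineSpace.map_over _

lemma zero_A1map {Y' Y : Sm k} (g : Y' ⟶ Y) : Y'.zero ≫ A1map g = g.hom.left ≫ Y.zero := by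
  apply AffineSpace.hom_ext
  · simp [zero, A1map]
  · intro i
    simp only [zero, A1map, Scheme.Hom.comp_appTop, CommRingCat.comp_apply,
      AffineSpace.map_appTop_coord, AffineSpace.homOfVector_appTop_coord]
    simp

lemma one_A1map {Y' Y : Sm k} (g : Y' ⟶ Y) : Y'.one ≫ A1map g = g.hom.left ≫ Y.one := by
  apply AffineSpace.hom_ext
  · simp [one, A1map]
  · intro i
    simp only [one, A1map, Scheme.Hom.comp_appTop, CommRingCat.comp_apply,
      AffineSpace.map_appTop_coord, AffineSpace.homOfVector_appTop_coord]
    simp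

/-- The open subschemes `U` with `Y × {0, 1} ⊆ U ⊆ Y × 𝔸¹`, ordered by inclusion. -/
@[ext]
structure Nbhd (Y : Sm k) where
  U : Y.A1.Opens
  zero_mem : ∀ y, Y.zero y ∈ U
  one_mem : ∀ y, Y.one y ∈ U

instance (Y : Sm k) : PartialOrder (Nbhd Y) := PartialOrder.lift Nbhd.U (fun _ _ h => Nbhd.ext h)

lemma isSm_open (Y : Sm k) (U : Y.A1.Opens) : isSm k (Over.mk (U.ι ≫ A1.proj Y ≫ Y.obj.hom)) := by
  obtain ⟨_, _, _⟩ := Y.property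
  have := smooth_affineLine Y.obj.left
  have : IsLocallyNoetherian Y.A1 :=
    LocallyOfFiniteType.isLocallyNoetherian (A1.proj Y ≫ Y.obj.hom)
  have h1 : Smooth (U.ι ≫ A1.proj Y ≫ Y.obj.hom) := inferInstance
  have h2 : QuasiCompact (U.ι ≫ A1.proj Y ≫ Y.obj.hom) := inferInstance
  have h3 : QuasiSeparated (U.ι ≫ A1.proj Y ≫ Y.obj.hom) := inferInstance
  exact ⟨h1, h2, h3⟩

namespace Nbhd

/-- The open subscheme `U` as a smooth `k`-scheme. -/
def toSm {Y : Sm k} (U : Nbhd Y) : Sm k :=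
  ⟨Over.mk (U.U.ι ≫ A1.proj Y ≫ Y.obj.hom), Y.isSm_open U.U⟩

/-- The inclusion `U ⟶ Y × 𝔸¹`. -/
def ι {Y : Sm k} (U : Nbhd Y) : U.toSm.obj.left ⟶ Y.A1 := U.U.ι

instance {Y : Sm k} (U : Nbhd Y) : IsOpenImmersion U.ι := inferInstanceAs (IsOpenImmersion U.U.ι)

lemma ι_mem {Y : Sm k} (U : Nbhd Y) (x : U.toSm.obj.left) : U.ι x ∈ U.U := x.2

/-- Maps into `U` are maps into `Y × 𝔸¹` with image in `U`. -/
def lift {Y T : Sm k} (U : Nbhd Y) (f : T.obj.left ⟶ Y.A1)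
    (hf : f ≫ A1.proj Y ≫ Y.obj.hom = T.obj.hom) (h : ∀ t, f t ∈ U.U) : T ⟶ U.toSm :=
  ObjectProperty.homMk (Over.homMk (U := T.obj) (V := U.toSm.obj)
    (IsOpenImmersion.lift U.ι f (by
      rintro _ ⟨t, rfl⟩
      exact ⟨⟨_, h t⟩, rfl⟩))
    ((IsOpenImmersion.lift_fac_assoc U.ι f _ _).trans hf))

@[simp]
lemma lift_ι {Y T : Sm k} (U : Nbhd Y) (f : T.obj.left ⟶ Y.A1)
    (hf : f ≫ A1.proj Y ≫ Y.obj.hom = T.obj.hom) (h : ∀ t, f t ∈ U.U) :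
    (U.lift f hf h).hom.left ≫ U.ι = f :=
  IsOpenImmersion.lift_fac U.ι f _

@[simp]
lemma lift_ι_assoc {Y T : Sm k} (U : Nbhd Y) (f : T.obj.left ⟶ Y.A1)
    (hf : f ≫ A1.proj Y ≫ Y.obj.hom = T.obj.hom) (h : ∀ t, f t ∈ U.U) {X : Scheme.{u}}
    (g : Y.A1 ⟶ X) : (U.lift f hf h).hom.left ≫ U.ι ≫ g = f ≫ g := by
  rw [← Category.assoc, lift_ι]

lemma hom_ext {Y T : Sm k} {U : Nbhd Y} {a b : T ⟶ U.toSm}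
    (h : a.hom.left ≫ U.ι = b.hom.left ≫ U.ι) : a = b := by
  ext : 2
  exact (cancel_mono U.ι).1 h

lemma comp_ι {Y T T' : Sm k} {U : Nbhd Y} (a : T' ⟶ T) (b : T ⟶ U.toSm) (c : T.obj.left ⟶ Y.A1)
    (h : b.hom.left ≫ U.ι = c) : (a ≫ b).hom.left ≫ U.ι = a.hom.left ≫ c := by
  subst h
  exact Category.assoc _ _ _

lemma ι_proj {Y : Sm k} (U : Nbhd Y) : U.ι ≫ A1.proj Y ≫ Y.obj.hom = U.toSm.obj.hom := rfl

/-- The inclusion `V ⟶ U`. -/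
def incl {Y : Sm k} {V U : Nbhd Y} (h : V ≤ U) : V.toSm ⟶ U.toSm :=
  U.lift V.ι V.ι_proj fun t => h (V.ι_mem t)

@[simp]
lemma incl_ι {Y : Sm k} {V U : Nbhd Y} (h : V ≤ U) : (incl h).hom.left ≫ U.ι = V.ι :=
  U.lift_ι _ _ _

/-- The functor sending `U` to the smooth `k`-scheme `U`. -/
def toSmFunctor (Y : Sm k) : Nbhd Y ⥤ Sm k where
  obj U := U.toSm
  map {U V} h := incl h.le
  map_id U := hom_ext (by simp [incl])
  map_comp f g := hom_ext (by simp [incl])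

/-- The section `Y = Y × {0} ⟶ U`. -/
def zeroLift {Y : Sm k} (U : Nbhd Y) : Y ⟶ U.toSm :=
  U.lift Y.zero (by simp [zero]) U.zero_mem

/-- The section `Y = Y × {1} ⟶ U`. -/
def oneLift {Y : Sm k} (U : Nbhd Y) : Y ⟶ U.toSm :=
  U.lift Y.one (by simp [one]) U.one_mem

@[simp]
lemma zeroLift_ι {Y : Sm k} (U : Nbhd Y) : U.zeroLift.hom.left ≫ U.ι = Y.zero := U.lift_ι _ _ _

@[simp]
lemma oneLift_ι {Y : Sm k} (U : Nbhd Y) : U.oneLift.hom.left ≫ U.ι = Y.one := U.lift_ι _ _ _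

/-- The preimage of `U ⊆ Y × 𝔸¹` in `Y' × 𝔸¹`. -/
def preimage {Y' Y : Sm k} (g : Y' ⟶ Y) (U : Nbhd Y) : Nbhd Y' where
  U := A1map g ⁻¹ᵁ U.U
  zero_mem y := by
    change A1map g (Y'.zero y) ∈ U.U
    rw [← Scheme.Hom.comp_apply, zero_A1map, Scheme.Hom.comp_apply]
    exact U.zero_mem _
  one_mem y := by
    change A1map g (Y'.one y) ∈ U.U
    rw [← Scheme.Hom.comp_apply, one_A1map, Scheme.Hom.comp_apply]
    exact U.one_mem _

lemma preimage_mono {Y' Y : Sm k} (g : Y' ⟶ Y) {U V : Nbhd Y} (h : U ≤ V) :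
    U.preimage g ≤ V.preimage g :=
  fun _ hx => h hx

/-- The projection from the preimage of `U` to `U`. -/
def preimageHom {Y' Y : Sm k} (g : Y' ⟶ Y) (U : Nbhd Y) : (U.preimage g).toSm ⟶ U.toSm :=
  U.lift ((U.preimage g).ι ≫ A1map g) (by
      have h := Over.w g.hom
      rw [Category.assoc, reassoc_of% (A1map_proj g), h]
      rfl) fun t => (U.preimage g).ι_mem t

@[simp]
lemma preimageHom_ι {Y' Y : Sm k} (g : Y' ⟶ Y) (U : Nbhd Y) :
    (U.preimageHom g).hom.left ≫ U.ι = (U.preimage g).ι ≫ A1map g := U.lift_ι _ _ _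

end Nbhd


/-- The structure map `F(U) ⟶ colim_U F(U)`. -/
def C1ι (F : (Sm k)ᵒᵖ ⥤ SSet.{u + 1}) {Y : Sm k} (U : Nbhd Y) :
    F.obj (op U.toSm) ⟶ colimit ((Nbhd.toSmFunctor Y).op ⋙ F) :=
  colimit.ι ((Nbhd.toSmFunctor Y).op ⋙ F) (op U)

lemma map_C1ι (F : (Sm k)ᵒᵖ ⥤ SSet.{u + 1}) {Y W : Sm k} {U V : Nbhd Y} (h : V ≤ U)
    (a : U.toSm ⟶ W) (b : V.toSm ⟶ W) (hab : Nbhd.incl h ≫ a = b) :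
    F.map a.op ≫ C1ι F U = F.map b.op ≫ C1ι F V := by
  have := colimit.w ((Nbhd.toSmFunctor Y).op ⋙ F) (homOfLE h).op
  subst hab
  rw [op_comp, F.map_comp, Category.assoc]
  exact congrArg (F.map a.op ≫ ·) this.symm

lemma C1_hom_ext (F : (Sm k)ᵒᵖ ⥤ SSet.{u + 1}) {Y : Sm k} {X : SSet.{u + 1}}
    {a b : colimit ((Nbhd.toSmFunctor Y).op ⋙ F) ⟶ X}
    (h : ∀ U : Nbhd Y, C1ι F U ≫ a = C1ι F U ≫ b) : a = b :=
  colimit.hom_ext fun U => h U.unop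

/-- Maps out of `colim_U F(U)`. -/
def C1desc (F : (Sm k)ᵒᵖ ⥤ SSet.{u + 1}) {Y : Sm k} {X : SSet.{u + 1}}
    (a : ∀ U : Nbhd Y, F.obj (op U.toSm) ⟶ X)
    (ha : ∀ {U V : Nbhd Y} (h : V ≤ U),
      F.map (Nbhd.incl h).op ≫ a V = a U) :
    colimit ((Nbhd.toSmFunctor Y).op ⋙ F) ⟶ X :=
  colimit.desc ((Nbhd.toSmFunctor Y).op ⋙ F)
    { pt := X
      ι := { app U := a U.unop
             naturality U V f := (ha f.unop.le).trans (Category.comp_id _).symm } }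

lemma C1ι_desc (F : (Sm k)ᵒᵖ ⥤ SSet.{u + 1}) {Y : Sm k} {X : SSet.{u + 1}}
    (a : ∀ U : Nbhd Y, F.obj (op U.toSm) ⟶ X) (ha) (U : Nbhd Y) :
    C1ι F U ≫ C1desc F a ha = a U :=
  colimit.ι_desc _ _

lemma C1ι_desc_assoc (F : (Sm k)ᵒᵖ ⥤ SSet.{u + 1}) {Y : Sm k} {X : SSet.{u + 1}}
    (a : ∀ U : Nbhd Y, F.obj (op U.toSm) ⟶ X) (ha) (U : Nbhd Y) {X' : SSet.{u + 1}} (b : X ⟶ X') :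
    C1ι F U ≫ C1desc F a ha ≫ b = a U ≫ b := by
  rw [← Category.assoc, C1ι_desc]

/-- The presheaf `Ĉ₁ F` with `(Ĉ₁ F)(Y) = colim_U F(U)`, the filtered colimit over the open
subschemes `Y × {0, 1} ⊆ U ⊆ Y × 𝔸¹`. As filtered colimits of simplicial sets are homotopy
colimits, this is also the colimit of spaces. -/
def C1 (F : (Sm k)ᵒᵖ ⥤ SSet.{u + 1}) : (Sm k)ᵒᵖ ⥤ SSet.{u + 1} where
  obj Y := colimit ((Nbhd.toSmFunctor Y.unop).op ⋙ F)
  map {Y Y'} g := C1desc F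
    (fun U => F.map (Nbhd.preimageHom g.unop U).op ≫ C1ι F (U.preimage g.unop)) (by
      intro U V h
      rw [← Category.assoc, ← F.map_comp, ← op_comp]
      refine (map_C1ι F (Nbhd.preimage_mono g.unop h) _ _ ?_).symm
      apply Nbhd.hom_ext
      rw [Nbhd.comp_ι _ _ _ (Nbhd.preimageHom_ι _ _), Nbhd.comp_ι _ _ _ (Nbhd.incl_ι _),
        ← Category.assoc, Nbhd.incl_ι, Nbhd.preimageHom_ι])
  map_id Y := C1_hom_ext F fun U => by
    rw [C1ι_desc, Category.comp_id]
    have h : Nbhd.preimage (𝟙 Y.unop) U = U := by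
      ext1
      simp [Nbhd.preimage, A1map]
    have := map_C1ι F h.le (𝟙 U.toSm) (Nbhd.preimageHom (𝟙 Y.unop) U)
      (Nbhd.hom_ext (by simp [Nbhd.incl, Nbhd.preimageHom, A1map]))
    rw [op_id, F.map_id, Category.id_comp] at this
    exact this.symm
  map_comp f g := C1_hom_ext F fun U => by
    rw [C1ι_desc, C1ι_desc_assoc, Category.assoc, C1ι_desc, ← Category.assoc, ← F.map_comp,
      ← op_comp]
    refine (map_C1ι F (le_of_eq ?_) _ _ (Nbhd.hom_ext ?_)).symm
    · ext1
      simp [Nbhd.preimage, A1map]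
    · simp [Nbhd.incl, Nbhd.preimageHom, A1map]

/-- The restriction `i₀^* : Ĉ₁ F ⟶ F` to `Y × {0}`. -/
def evalZero (F : (Sm k)ᵒᵖ ⥤ SSet.{u + 1}) : C1 F ⟶ F where
  app Y := C1desc F (fun U => F.map U.zeroLift.op) (by
    intro U V h
    rw [← F.map_comp, ← op_comp]
    congr 2
    exact Nbhd.hom_ext (by simp [Nbhd.incl, Nbhd.zeroLift]))
  naturality Y Y' g := C1_hom_ext F fun U => by
    simp only [C1]
    rw [C1ι_desc_assoc, Category.assoc, C1ι_desc, C1ι_desc_assoc, ← F.map_comp, ← F.map_comp]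
    congr 1
    apply Quiver.Hom.unop_inj
    apply Nbhd.hom_ext
    change (Nbhd.zeroLift _ ≫ Nbhd.preimageHom _ _).hom.left ≫ _ =
      (g.unop ≫ U.zeroLift).hom.left ≫ _
    rw [Nbhd.comp_ι _ _ _ (Nbhd.preimageHom_ι _ _), Nbhd.comp_ι _ _ _ (Nbhd.zeroLift_ι _),
      ← zero_A1map, ← Category.assoc, Nbhd.zeroLift_ι]

/-- The restriction `i₁^* : Ĉ₁ F ⟶ F` to `Y × {1}`. -/
def evalOne (F : (Sm k)ᵒᵖ ⥤ SSet.{u + 1}) : C1 F ⟶ F where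
  app Y := C1desc F (fun U => F.map U.oneLift.op) (by
    intro U V h
    rw [← F.map_comp, ← op_comp]
    congr 2
    exact Nbhd.hom_ext (by simp [Nbhd.incl, Nbhd.oneLift]))
  naturality Y Y' g := C1_hom_ext F fun U => by
    simp only [C1]
    rw [C1ι_desc_assoc, Category.assoc, C1ι_desc, C1ι_desc_assoc, ← F.map_comp, ← F.map_comp]
    congr 1
    apply Quiver.Hom.unop_inj
    apply Nbhd.hom_ext
    change (Nbhd.oneLift _ ≫ Nbhd.preimageHom _ _).hom.left ≫ _ =
      (g.unop ≫ U.oneLift).hom.left ≫ _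
    rw [Nbhd.comp_ι _ _ _ (Nbhd.preimageHom_ι _ _), Nbhd.comp_ι _ _ _ (Nbhd.oneLift_ι _),
      ← one_A1map, ← Category.assoc, Nbhd.oneLift_ι]

end Sm

variable (k)
/-- A pointed `k`-scheme `P = P° ⊔ Spec k` whose base point is open and closed, that is,
a `k`-scheme `P°` with a disjoint base point added. -/
structure PtdSch where
  X : Over (SpecK k)
  pt : Over.mk (𝟙 (SpecK k)) ⟶ X
  isOpenImmersion : IsOpenImmersion pt.left
  isClosed : IsClosed (Set.range pt.left)

variable {k}

namespace PtdSch

/-- Base point preserving morphisms of `k`-schemes. -/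
@[ext]
structure Hom (P Q : PtdSch k) where
  hom : P.X ⟶ Q.X
  w : P.pt ≫ hom = Q.pt

instance : Category (PtdSch k) where
  Hom := Hom
  id P := ⟨𝟙 _, Category.comp_id _⟩
  comp f g := ⟨f.hom ≫ g.hom, by rw [← Category.assoc, f.w, g.w]⟩
  id_comp _ := Hom.ext (Category.id_comp _)
  comp_id _ := Hom.ext (Category.comp_id _)
  assoc _ _ _ := Hom.ext (Category.assoc _ _ _)

@[simp] lemma id_hom (P : PtdSch k) : Hom.hom (𝟙 P) = 𝟙 P.X := rfl
@[simp] lemma comp_hom {P Q R : PtdSch k} (f : P ⟶ Q) (g : Q ⟶ R) :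
    (f ≫ g).hom = f.hom ≫ g.hom := rfl

@[ext] lemma hom_ext {P Q : PtdSch k} {f g : P ⟶ Q} (h : f.hom = g.hom) : f = g := Hom.ext h

/-- The complement `P°` of the base point. -/
def away (P : PtdSch k) : P.X.left.Opens := ⟨(Set.range P.pt.left)ᶜ, P.isClosed.isOpen_compl⟩

lemma mem_away_of_map {P Q : PtdSch k} (f : P ⟶ Q) {x : P.X.left} (h : f.hom.left x ∈ Q.away) :
    x ∈ P.away := by
  rintro ⟨y, rfl⟩
  refine h ⟨y, ?_⟩
  rw [← f.w, Over.comp_left, Scheme.Hom.comp_apply]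

end PtdSch

/-- Spans `Y ⟵ Z ⟶ ⋀ᵢ Pᵢ` with finite locally free left leg, together with chosen base changes.

For `D = (Sm k)/Y` and `j` the functor `T ↦ T` (see `FlfSpan.base`), the datum `(Z, p)` is a
`k`-scheme `Z_T` with a finite locally free (finite, flat and locally of finite presentation) map
`p_T : Z_T ⟶ T` for every smooth `T ⟶ Y`, functorial and cartesian in `T`. So `Z_T = Z_Y ×_Y T`, and
`(Z, p)` is the finite locally free `Y`-scheme `Z_Y` with a functorial choice of its base changes.
Likewise the maps `q i` amount to maps `Z_Y ⟶ P i`. The choices make base change strictly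
functorial and do not change the groupoid of spans up to equivalence.

The tuple `q` stands for the map of `Z_Y` to the smash product of the pointed schemes `P i`; what
lies over the base point of the smash product is disregarded, see `FlfSpan.support` and
`FlfSpan.Hom`. -/
structure FlfSpan {D : Type (u + 1)} [Category.{u} D] (j : D ⥤ Over (SpecK k)) {ι : Type}
    (P : ι → PtdSch k) where
  Z : D ⥤ Over (SpecK k)
  p : Z ⟶ j
  equifibered : NatTrans.Equifibered p
  isFinite (T : D) : IsFinite (p.app T).left
  flat (T : D) : Flat (p.app T).left
  locallyOfFinitePresentation (T : D) : LocallyOfFinitePresentation (p.app T).left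
  q (i : ι) : Z ⟶ (Functor.const D).obj (P i).X

namespace FlfSpan

variable {D : Type (u + 1)} [Category.{u} D] {j : D ⥤ Over (SpecK k)} {ι : Type} [Finite ι]
  {P P' P'' : ι → PtdSch k}

/-- The part of `Z_T` that does not lie over the base point of the smash product `⋀ᵢ Pᵢ`, i.e. where
no `q i` takes the base point as its value. It is open and closed. -/
def support (α : FlfSpan j P) (T : D) : (α.Z.obj T).left.Opens where
  carrier := {z | ∀ i, ((α.q i).app T).left z ∈ (P i).away}
  is_open' := by
    simp only [Set.ofPred_forall]
    exact isOpen_iInter_of_finite fun i =>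
      (P i).away.isOpen.preimage ((α.q i).app T).left.continuous

lemma q_map (α : FlfSpan j P) {T T' : D} (f : T ⟶ T') (i : ι) (z : (α.Z.obj T).left) :
    ((α.q i).app T').left ((α.Z.map f).left z) = ((α.q i).app T).left z := by
  have h := (α.q i).naturality f
  have h' : α.Z.map f ≫ (α.q i).app T' = (α.q i).app T := h.trans (Category.comp_id _)
  rw [← h', Over.comp_left, Scheme.Hom.comp_apply]

lemma map_mem_support (α : FlfSpan j P) {T T' : D} (f : T ⟶ T') (z : (α.Z.obj T).left)
    (hz : z ∈ α.support T) : (α.Z.map f).left z ∈ α.support T' := fun i => by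
  rw [q_map]; exact hz i

lemma support_le (α : FlfSpan j P) {T T' : D} (f : T ⟶ T') :
    α.support T ≤ (α.Z.map f).left ⁻¹ᵁ α.support T' := α.map_mem_support f

/-- The subfunctor `T ↦ support T` of `Z`. It is a span from `Y` to `∏ᵢ Pᵢ°`. -/
def N (α : FlfSpan j P) : D ⥤ Over (SpecK k) where
  obj T := Over.mk ((α.support T).ι ≫ (α.Z.obj T).hom)
  map {T T'} f := Over.homMk ((α.Z.map f).left.resLE (α.support T') (α.support T)
    (α.support_le f)) (by
      change (α.Z.map f).left.resLE _ _ _ ≫ (α.support T').ι ≫ (α.Z.obj T').hom =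
        (α.support T).ι ≫ (α.Z.obj T).hom
      rw [Scheme.Hom.resLE_comp_ι_assoc, Over.w])
  map_id T := by
    ext1
    refine (cancel_mono (α.support T).ι).1 ?_
    change (α.Z.map (𝟙 T)).left.resLE _ _ _ ≫ (α.support T).ι = 𝟙 _ ≫ (α.support T).ι
    rw [Scheme.Hom.resLE_comp_ι, CategoryTheory.Functor.map_id, Category.id_comp]
    exact Category.comp_id _
  map_comp {T T' T''} f g := by
    ext1
    refine (cancel_mono (α.support T'').ι).1 ?_
    change (α.Z.map (f ≫ g)).left.resLE _ _ _ ≫ (α.support T'').ι =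
      ((α.Z.map f).left.resLE _ _ _ ≫ (α.Z.map g).left.resLE _ _ _) ≫ (α.support T'').ι
    rw [Scheme.Hom.resLE_comp_ι, Category.assoc, Scheme.Hom.resLE_comp_ι,
      Scheme.Hom.resLE_comp_ι_assoc, CategoryTheory.Functor.map_comp, Over.comp_left]

/-- The inclusion of the support into `Z`. -/
def ιN (α : FlfSpan j P) : α.N ⟶ α.Z where
  app T := Over.homMk (α.support T).ι rfl
  naturality T T' f := by
    ext1
    exact Scheme.Hom.resLE_comp_ι _ _

instance (α : FlfSpan j P) (T : D) : IsOpenImmersion (α.ιN.app T).left :=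
  inferInstanceAs (IsOpenImmersion (α.support T).ι)

instance (α : FlfSpan j P) (T : D) : Mono (α.ιN.app T) :=
  (Over.forget _).mono_of_mono_map (inferInstanceAs (Mono (α.ιN.app T).left))

instance (α : FlfSpan j P) : Mono α.ιN := NatTrans.mono_of_mono_app _

lemma ιN_mem (α : FlfSpan j P) (T : D) (x : (α.N.obj T).left) :
    (α.ιN.app T).left x ∈ α.support T := x.2

lemma range_subset (α : FlfSpan j P) (T : D) {M : Over (SpecK k)} (g : M ⟶ α.Z.obj T)
    (h : ∀ x, g.left x ∈ α.support T) : Set.range g.left ⊆ Set.range (α.ιN.app T).left :=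
  Set.range_subset_iff.2 fun x => Set.mem_range.2 ⟨⟨_, h x⟩, rfl⟩

/-- Maps into `Z_T` with image in the support factor through the support. -/
def liftApp (α : FlfSpan j P) (T : D) {M : Over (SpecK k)} (g : M ⟶ α.Z.obj T)
    (h : ∀ x, g.left x ∈ α.support T) : M ⟶ α.N.obj T :=
  Over.homMk (IsOpenImmersion.lift (α.ιN.app T).left g.left (α.range_subset T g h))
    ((IsOpenImmersion.lift_fac_assoc (α.ιN.app T).left _ _ _).trans (Over.w g))

lemma liftApp_ιN (α : FlfSpan j P) (T : D) {M : Over (SpecK k)} (g : M ⟶ α.Z.obj T)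
    (h : ∀ x, g.left x ∈ α.support T) : α.liftApp T g h ≫ α.ιN.app T = g := by
  ext1
  exact IsOpenImmersion.lift_fac (α.ιN.app T).left _ _

/-- Maps into `Z` with image in the support factor through the support. -/
def liftN (α : FlfSpan j P) {M : D ⥤ Over (SpecK k)} (g : M ⟶ α.Z)
    (h : ∀ T x, (g.app T).left x ∈ α.support T) : M ⟶ α.N where
  app T := α.liftApp T (g.app T) (h T)
  naturality T T' f := by
    rw [← cancel_mono (α.ιN.app T'), Category.assoc, Category.assoc, α.ιN.naturality,
      liftApp_ιN, ← Category.assoc, liftApp_ιN, g.naturality]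

lemma liftN_ιN (α : FlfSpan j P) {M : D ⥤ Over (SpecK k)} (g : M ⟶ α.Z)
    (h : ∀ T x, (g.app T).left x ∈ α.support T) : α.liftN g h ≫ α.ιN = g := by
  ext T : 2
  exact α.liftApp_ιN T _ (h T)

lemma liftN_ιN_assoc (α : FlfSpan j P) {M M' : D ⥤ Over (SpecK k)} (g : M ⟶ α.Z)
    (h : ∀ T x, (g.app T).left x ∈ α.support T) (a : α.Z ⟶ M') :
    α.liftN g h ≫ α.ιN ≫ a = g ≫ a := by
  rw [← Category.assoc, liftN_ιN]

/-- Morphisms of spans: isomorphisms of the supports over `Y` and over `∏ᵢ Pᵢ°`. So the category of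
these spans is equivalent to the groupoid of all spans `Y ⟵ Z ⟶ ∏ᵢ Pᵢ°` with finite locally free
left leg and their isomorphisms, that is, to the mapping groupoid from `Y` to `∏ᵢ Pᵢ°` in the
category of finite locally free correspondences. -/
@[ext]
structure Hom (α β : FlfSpan j P) where
  iso : α.N ≅ β.N
  w_p : iso.hom ≫ β.ιN ≫ β.p = α.ιN ≫ α.p
  w_q (i : ι) : iso.hom ≫ β.ιN ≫ β.q i = α.ιN ≫ α.q i

instance : Category (FlfSpan j P) where
  Hom := Hom
  id α := ⟨Iso.refl _, Category.id_comp _, fun _ => Category.id_comp _⟩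
  comp f g := ⟨f.iso ≪≫ g.iso, by simp [g.w_p, f.w_p], fun i => by simp [g.w_q, f.w_q]⟩
  id_comp _ := Hom.ext (Iso.refl_trans _)
  comp_id _ := Hom.ext (Iso.trans_refl _)
  assoc _ _ _ := Hom.ext (Iso.trans_assoc _ _ _)


@[simp] lemma id_iso (α : FlfSpan j P) : Hom.iso (𝟙 α) = Iso.refl _ := rfl
@[simp] lemma comp_iso {α β γ : FlfSpan j P} (f : α ⟶ β) (g : β ⟶ γ) :
    (f ≫ g).iso = f.iso ≪≫ g.iso := rfl

lemma hom_ext {α β : FlfSpan j P} {f g : α ⟶ β} (h : f.iso.hom ≫ β.ιN = g.iso.hom ≫ β.ιN) :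
    f = g :=
  Hom.ext (Iso.ext ((cancel_mono β.ιN).1 h))

lemma eqToHom_ιN {α β : FlfSpan j P} (h : α = β) :
    (eqToHom h).iso.hom ≫ β.ιN = α.ιN ≫ eqToHom (congrArg Z h) := by
  subst h
  simp

lemma mk_congr {Z : D ⥤ Over (SpecK k)} {p p' : Z ⟶ j} {h₁ h₂ h₃ h₄ h₁' h₂' h₃' h₄'}
    {q q' : ∀ i, Z ⟶ (Functor.const D).obj (P i).X} (hp : p = p') (hq : q = q') :
    FlfSpan.mk Z p h₁ h₂ h₃ h₄ q = FlfSpan.mk Z p' h₁' h₂' h₃' h₄' q' := by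
  subst hp hq
  rfl

lemma mem_support {α γ : FlfSpan j P} (g : α.N ⟶ γ.Z) (h : ∀ i, g ≫ γ.q i = α.ιN ≫ α.q i)
    (T : D) (x : (α.N.obj T).left) : (g.app T).left x ∈ γ.support T := fun i => by
  have h₁ : ((g ≫ γ.q i).app T).left x = ((α.ιN ≫ α.q i).app T).left x := by rw [h]
  have h₂ : ((γ.q i).app T).left ((g.app T).left x) =
      ((α.q i).app T).left ((α.ιN.app T).left x) := h₁
  rw [h₂]
  exact α.ιN_mem T x i

/-- The inverse of a morphism of spans. -/
def Hom.symm {α β : FlfSpan j P} (φ : α ⟶ β) : β ⟶ α :=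
  ⟨φ.iso.symm, by rw [← φ.w_p]; simp, fun i => by rw [← φ.w_q]; simp⟩

/-- Composition of a span with pointed maps `P i ⟶ P' i`. -/
abbrev pushObj (f : P ⟶ P') (α : FlfSpan j P) : FlfSpan j P' :=
  { α with q := fun i => α.q i ≫ (Functor.const D).map (f i).hom }

lemma support_pushObj_le (f : P ⟶ P') (α : FlfSpan j P) (T : D) :
    (pushObj f α).support T ≤ α.support T := fun z hz i =>
  PtdSch.mem_away_of_map (f i) (by
    have := hz i
    exact this)

/-- The inclusion of the support of the composed span. -/
def inclN (f : P ⟶ P') (α : FlfSpan j P) : (pushObj f α).N ⟶ α.N :=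
  α.liftN (pushObj f α).ιN fun T x => support_pushObj_le f α T ((pushObj f α).ιN_mem T x)

lemma inclN_ιN (f : P ⟶ P') (α : FlfSpan j P) : inclN f α ≫ α.ιN = (pushObj f α).ιN :=
  α.liftN_ιN _ _

lemma inclN_ιN_assoc (f : P ⟶ P') (α : FlfSpan j P) {M : D ⥤ Over (SpecK k)} (a : α.Z ⟶ M) :
    inclN f α ≫ α.ιN ≫ a = (pushObj f α).ιN ≫ a :=
  α.liftN_ιN_assoc _ _ _

instance (f : P ⟶ P') (α : FlfSpan j P) : Mono (inclN f α) :=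
  have : Mono (inclN f α ≫ α.ιN) := by
    rw [inclN_ιN]
    exact inferInstanceAs (Mono (pushObj f α).ιN)
  mono_of_mono _ α.ιN

/-- The restriction of a morphism of spans to the supports of the composed spans. -/
def pushN (f : P ⟶ P') {α β : FlfSpan j P} (φ : α ⟶ β) : (pushObj f α).N ⟶ (pushObj f β).N :=
  (pushObj f β).liftN (inclN f α ≫ φ.iso.hom ≫ β.ιN) (mem_support _ fun i => by
    have h := φ.w_q i
    change (inclN f α ≫ φ.iso.hom ≫ β.ιN) ≫ β.q i ≫ (Functor.const D).map (f i).hom =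
      (pushObj f α).ιN ≫ α.q i ≫ (Functor.const D).map (f i).hom
    rw [Category.assoc, Category.assoc, reassoc_of% h, inclN_ιN_assoc])

lemma pushN_ιN (f : P ⟶ P') {α β : FlfSpan j P} (φ : α ⟶ β) :
    pushN f φ ≫ (pushObj f β).ιN = inclN f α ≫ φ.iso.hom ≫ β.ιN :=
  (pushObj f β).liftN_ιN _ _

lemma pushN_inclN (f : P ⟶ P') {α β : FlfSpan j P} (φ : α ⟶ β) :
    pushN f φ ≫ inclN f β = inclN f α ≫ φ.iso.hom := by
  rw [← cancel_mono β.ιN, Category.assoc, Category.assoc, inclN_ιN]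
  exact pushN_ιN f φ

lemma pushN_id (f : P ⟶ P') (α : FlfSpan j P) : pushN f (𝟙 α) = 𝟙 _ := by
  rw [← cancel_mono (inclN f α), pushN_inclN, id_iso, Iso.refl_hom, Category.comp_id,
    Category.id_comp]

lemma pushN_comp (f : P ⟶ P') {α β γ : FlfSpan j P} (φ : α ⟶ β) (ψ : β ⟶ γ) :
    pushN f (φ ≫ ψ) = pushN f φ ≫ pushN f ψ := by
  rw [← cancel_mono (inclN f γ), pushN_inclN, Category.assoc, pushN_inclN, ← Category.assoc,
    pushN_inclN, comp_iso, Iso.trans_hom, Category.assoc]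

/-- Functoriality of the composition with pointed maps. -/
def pushHom (f : P ⟶ P') {α β : FlfSpan j P} (φ : α ⟶ β) : pushObj f α ⟶ pushObj f β where
  iso :=
    { hom := pushN f φ
      inv := pushN f φ.symm
      hom_inv_id := by
        rw [← pushN_comp, show φ ≫ φ.symm = 𝟙 α from Hom.ext φ.iso.self_symm_id, pushN_id]
      inv_hom_id := by
        rw [← pushN_comp, show φ.symm ≫ φ = 𝟙 β from Hom.ext φ.iso.symm_self_id, pushN_id] }
  w_p := by
    have h := φ.w_p
    have h₁ := pushN_ιN f φ
    change pushN f φ ≫ (pushObj f β).ιN ≫ β.p = (pushObj f α).ιN ≫ α.p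
    rw [reassoc_of% h₁, h, inclN_ιN_assoc]
  w_q i := by
    have h := φ.w_q i
    have h₁ := pushN_ιN f φ
    change pushN f φ ≫ (pushObj f β).ιN ≫ β.q i ≫ (Functor.const D).map (f i).hom =
      (pushObj f α).ιN ≫ α.q i ≫ (Functor.const D).map (f i).hom
    rw [reassoc_of% h₁, reassoc_of% h, inclN_ιN_assoc]

/-- The functor of composition with pointed maps `P i ⟶ P' i`. -/
def push (f : P ⟶ P') : FlfSpan j P ⥤ FlfSpan j P' where
  obj α := pushObj f α
  map φ := pushHom f φ
  map_id α := Hom.ext (Iso.ext (pushN_id f α))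
  map_comp φ ψ := Hom.ext (Iso.ext (pushN_comp f φ ψ))

lemma pushObj_id (α : FlfSpan j P) : pushObj (𝟙 P) α = α :=
  mk_congr rfl (funext fun i => (congrArg (α.q i ≫ ·) ((Functor.const D).map_id _)).trans
    (Category.comp_id _))

lemma pushObj_comp (f : P ⟶ P') (g : P' ⟶ P'') (α : FlfSpan j P) :
    pushObj (f ≫ g) α = pushObj g (pushObj f α) :=
  mk_congr rfl (funext fun i => (congrArg (α.q i ≫ ·) ((Functor.const D).map_comp _ _)).trans
    (Category.assoc _ _ _).symm)

lemma conj_ιN {α α' β β' : FlfSpan j P} (h : α = α') (h' : β' = β) (φ : α' ⟶ β') :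
    (eqToHom h ≫ φ ≫ eqToHom h').iso.hom ≫ β.ιN =
      (eqToHom h).iso.hom ≫ φ.iso.hom ≫ β'.ιN ≫ eqToHom (congrArg Z h') := by
  subst h h'
  simp

lemma push_id : push (j := j) (𝟙 P) = 𝟭 _ := by
  refine CategoryTheory.Functor.ext pushObj_id fun α β φ => hom_ext ?_
  have h₁ : (eqToHom (pushObj_id α)).iso.hom = inclN (𝟙 P) α := by
    rw [← cancel_mono α.ιN, eqToHom_ιN, inclN_ιN]
    exact Category.comp_id _
  refine Eq.trans ?_ (conj_ιN (pushObj_id α) (pushObj_id β).symm φ).symm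
  rw [h₁]
  refine (pushN_ιN (𝟙 P) φ).trans ?_
  exact congrArg (fun t => inclN (𝟙 P) α ≫ φ.iso.hom ≫ t) (Category.comp_id β.ιN).symm

lemma push_comp (f : P ⟶ P') (g : P' ⟶ P'') : push (j := j) (f ≫ g) = push f ⋙ push g := by
  refine CategoryTheory.Functor.ext (pushObj_comp f g) fun α β φ => hom_ext ?_
  have h₁ : (eqToHom (pushObj_comp f g α)).iso.hom ≫ inclN g (pushObj f α) ≫ inclN f α =
      inclN (f ≫ g) α := by
    rw [← cancel_mono α.ιN, Category.assoc, Category.assoc, inclN_ιN, inclN_ιN, inclN_ιN,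
      eqToHom_ιN]
    exact Category.comp_id _
  refine Eq.trans ?_
    (conj_ιN (pushObj_comp f g α) (pushObj_comp f g β).symm (pushHom g (pushHom f φ))).symm
  refine (pushN_ιN (f ≫ g) φ).trans ?_
  have h₂ : pushN g (pushHom f φ) ≫ (pushObj g (pushObj f β)).ιN =
      inclN g (pushObj f α) ≫ inclN f α ≫ φ.iso.hom ≫ β.ιN :=
    (pushN_ιN g (pushHom f φ)).trans (congrArg (inclN g (pushObj f α) ≫ ·) (pushN_ιN f φ))
  have h₃ : pushN g (pushHom f φ) ≫ (pushObj g (pushObj f β)).ιN ≫ 𝟙 β.Z =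
      inclN g (pushObj f α) ≫ inclN f α ≫ φ.iso.hom ≫ β.ιN :=
    (congrArg (pushN g (pushHom f φ) ≫ ·) (Category.comp_id _)).trans h₂
  refine Eq.trans ?_ (congrArg ((eqToHom (pushObj_comp f g α)).iso.hom ≫ ·) h₃.symm)
  rw [← h₁, Category.assoc, Category.assoc]

variable {D' D'' : Type (u + 1)} [Category.{u} D'] [Category.{u} D'']

/-- Restriction of a span along a functor. -/
abbrev preObj (H : D' ⥤ D) (α : FlfSpan j P) : FlfSpan (H ⋙ j) P where
  Z := H ⋙ α.Z
  p := H.whiskerLeft α.p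
  equifibered := α.equifibered.whiskerLeft H
  isFinite T := α.isFinite (H.obj T)
  flat T := α.flat (H.obj T)
  locallyOfFinitePresentation T := α.locallyOfFinitePresentation (H.obj T)
  q i := H.whiskerLeft (α.q i)

/-- Restriction of spans along a functor. -/
def preAux (H : D' ⥤ D) : FlfSpan j P ⥤ FlfSpan (H ⋙ j) P where
  obj α := preObj H α
  map {α β} φ :=
    { iso := Functor.isoWhiskerLeft H φ.iso
      w_p := congrArg H.whiskerLeft φ.w_p
      w_q i := congrArg H.whiskerLeft (φ.w_q i) }
  map_id _ := rfl
  map_comp _ _ := rfl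

/-- Restriction of spans along a functor `H`, with `j'` equal to `H ⋙ j`. -/
def pre (H : D' ⥤ D) {j' : D' ⥤ Over (SpecK k)} (h : H ⋙ j = j') :
    FlfSpan j P ⥤ FlfSpan j' P :=
  h ▸ preAux H

lemma pre_id (H : D ⥤ D) (hH : H = 𝟭 D) (h : H ⋙ j = j) : pre (P := P) H h = 𝟭 _ := by
  subst hH
  rfl

lemma pre_comp (H : D' ⥤ D) (H' : D'' ⥤ D') (H'' : D'' ⥤ D) (hH : H'' = H' ⋙ H)
    {j' : D' ⥤ Over (SpecK k)} {j'' : D'' ⥤ Over (SpecK k)} (h : H ⋙ j = j') (h' : H' ⋙ j' = j'')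
    (h'' : H'' ⋙ j = j'') : pre (P := P) H'' h'' = pre H h ⋙ pre H' h' := by
  subst hH h h'
  rfl

lemma pre_push (H : D' ⥤ D) {j' : D' ⥤ Over (SpecK k)} (h : H ⋙ j = j') (f : P ⟶ P') :
    pre H h ⋙ push f = push f ⋙ pre H h := by
  subst h
  rfl

variable (k) in
/-- The empty scheme over `Spec k`. -/
abbrev emptyOver : Over (SpecK k) := Over.mk (initial.to (SpecK k))

lemma over_hom_ext_of_isEmpty {W X : Over (SpecK k)} [IsEmpty W.left] (f g : W ⟶ X) : f = g := by
  ext1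
  exact isInitialOfIsEmpty.hom_ext _ _

instance : IsEmpty (emptyOver k).left := inferInstanceAs (IsEmpty ↥(⊥_ Scheme.{u}))

lemma const_empty_hom_ext {F : D ⥤ Over (SpecK k)}
    (f g : (Functor.const D).obj (emptyOver k) ⟶ F) : f = g := by
  apply NatTrans.ext
  funext T
  exact over_hom_ext_of_isEmpty (W := emptyOver k) _ _

/-- The map from the constant functor at the empty scheme. -/
def fromEmpty (F : D ⥤ Over (SpecK k)) : (Functor.const D).obj (emptyOver k) ⟶ F where
  app T := Over.homMk (U := emptyOver k) (initial.to _) (initial.hom_ext _ _)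
  naturality _ _ _ := over_hom_ext_of_isEmpty (W := emptyOver k) _ _

lemma fromEmpty_equifibered (F : D ⥤ Over (SpecK k)) :
    NatTrans.Equifibered (fromEmpty F) := fun T T' f =>
  ⟨⟨(fromEmpty F).naturality f⟩, ⟨PullbackCone.IsLimit.mk _ (fun s => s.fst)
    (fun s => Category.comp_id _)
    (fun s => by
      have : IsEmpty s.pt.left := (Function.isEmpty (β := (emptyOver k).left) s.fst.left)
      exact over_hom_ext_of_isEmpty _ _)
    (fun s m h _ => (Category.comp_id m).symm.trans h)⟩⟩

/-- The empty span, the zero for the disjoint union of spans. -/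
def zero (j : D ⥤ Over (SpecK k)) (P : ι → PtdSch k) : FlfSpan j P where
  Z := (Functor.const D).obj (emptyOver k)
  p := fromEmpty j
  equifibered := fromEmpty_equifibered j
  isFinite T := inferInstanceAs (IsFinite (initial.to (j.obj T).left))
  flat T := inferInstanceAs (Flat (initial.to (j.obj T).left))
  locallyOfFinitePresentation T :=
    inferInstanceAs (LocallyOfFinitePresentation (initial.to (j.obj T).left))
  q _ := fromEmpty _

lemma push_zero (f : P ⟶ P') : (push f).obj (zero j P) = zero j P' :=
  mk_congr rfl (funext fun _ => const_empty_hom_ext _ _)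

lemma pre_zero (H : D' ⥤ D) {j' : D' ⥤ Over (SpecK k)} (h : H ⋙ j = j') :
    (pre H h).obj (zero j P) = zero j' P := by
  subst h
  exact mk_congr (const_empty_hom_ext _ _) (funext fun _ => const_empty_hom_ext _ _)

end FlfSpan

/-- Categories with a distinguished object. -/
structure PCat where
  C : Type w
  [cat : Category.{w} C]
  pt : C

attribute [instance] PCat.cat

namespace PCat

/-- Functors that preserve the distinguished object strictly. -/
@[ext]
structure Hom (A B : PCat.{w}) where
  F : A.C ⥤ B.C
  w : F.obj A.pt = B.pt

instance : Category PCat.{w} where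
  Hom := Hom
  id A := ⟨𝟭 _, rfl⟩
  comp f g := ⟨f.F ⋙ g.F, (congrArg g.F.obj f.w).trans g.w⟩

/-- The nerve of a category, pointed by the distinguished object. -/
def nerve : PCat.{w} ⥤ PSSet.{w} where
  obj A :=
    { obj m := ⟨ComposableArrows A.C m.unop.len, (Functor.const _).obj A.pt⟩
      map f := ⟨fun x => (CategoryTheory.nerve A.C).map f x, rfl⟩ }
  map {A B} f :=
    { app m := ⟨fun x => x ⋙ f.F, by
        change (Functor.const _).obj A.pt ⋙ f.F = (Functor.const _).obj B.pt
        exact CategoryTheory.Functor.ext (fun _ => f.w) (by simp)⟩ }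

end PCat

namespace FlfSpan

variable {ι : Type} [Finite ι]

/-- The functor sending a smooth `k`-scheme `T` over `Y` to `T`. -/
abbrev base (Y : Sm k) : Over Y ⥤ Over (SpecK k) := Over.forget Y ⋙ Sm.toOver k

lemma map_base {Y' Y : Sm k} (g : Y' ⟶ Y) : Over.map g ⋙ base Y = base Y' :=
  congrArg (· ⋙ Sm.toOver k) (Over.mapForget_eq g)

/-- The groupoid of finite locally free spans from `Y` to `⋀ᵢ Pᵢ`, pointed by the empty span. -/
def category (P : ι → PtdSch k) (Y : Sm k) : PCat.{u + 1} := ⟨FlfSpan (base Y) P, zero _ _⟩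

/-- Base change of spans along `g : Y' ⟶ Y`. -/
def restrict (P : ι → PtdSch k) {Y' Y : Sm k} (g : Y' ⟶ Y) : category P Y ⟶ category P Y' :=
  ⟨pre (P := P) (Over.map g) (map_base g), pre_zero (P := P) (Over.map g) (map_base g)⟩

/-- Composition of spans with pointed maps. -/
def pushforward {P P' : ι → PtdSch k} (f : P ⟶ P') (Y : Sm k) : category P Y ⟶ category P' Y :=
  ⟨push f, push_zero f⟩

/-- The groupoid of finite locally free spans from `Y` to `⋀ᵢ Pᵢ`, as a functor of `Y` and of the
pointed schemes `Pᵢ`. -/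
def presheaf : (ι → PtdSch k) ⥤ (Sm k)ᵒᵖ ⥤ PCat.{u + 1} where
  obj P :=
    { obj Y := category P Y.unop
      map g := restrict P g.unop
      map_id Y := PCat.Hom.ext (pre_id (P := P) (j := base Y.unop) (Over.map (𝟙 Y.unop))
        (Over.mapId_eq Y.unop)
        (map_base (𝟙 Y.unop)))
      map_comp g g' := PCat.Hom.ext (pre_comp (P := P) (Over.map g.unop)
        (Over.map g'.unop) (Over.map (g'.unop ≫ g.unop)) (Over.mapComp_eq _ _)
        (map_base g.unop) (map_base g'.unop) (map_base (g'.unop ≫ g.unop))) }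
  map f :=
    { app Y := pushforward f Y.unop
      naturality Y Y' g := PCat.Hom.ext (pre_push (Over.map g.unop) (map_base g.unop) f) }
  map_id P := by
    apply NatTrans.ext
    funext Y
    exact PCat.Hom.ext push_id
  map_comp f g := by
    apply NatTrans.ext
    funext Y
    exact PCat.Hom.ext (push_comp f g)

end FlfSpan
section Coproducts

variable {I : Type} (X : I → Over (SpecK k))

/-- The coproduct of a family of `k`-schemes. -/
abbrev sigmaOver : Over (SpecK k) := Over.mk (Sigma.desc fun i => (X i).hom)

/-- The inclusion of a summand. -/
abbrev sigmaOverι (i : I) : X i ⟶ sigmaOver X :=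
  Over.homMk (Sigma.ι (fun i => (X i).left) i) (Sigma.ι_desc _ _)

variable {X} in
/-- Maps out of a coproduct. -/
abbrev sigmaOverDesc {W : Over (SpecK k)} (f : ∀ i, X i ⟶ W) : sigmaOver X ⟶ W :=
  Over.homMk (U := sigmaOver X) (Sigma.desc fun i => (f i).left) (by
    apply Sigma.hom_ext
    intro i
    refine (Sigma.ι_desc_assoc _ _ _).trans ((Over.w (f i)).trans ?_)
    exact (Sigma.ι_desc (fun i => (X i).hom) i).symm)

lemma sigmaOverι_desc {W : Over (SpecK k)} (f : ∀ i, X i ⟶ W) (i : I) :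
    sigmaOverι X i ≫ sigmaOverDesc f = f i := by
  ext1
  exact Sigma.ι_desc _ _

lemma sigmaOverι_desc_assoc {W W' : Over (SpecK k)} (f : ∀ i, X i ⟶ W) (i : I) (g : W ⟶ W') :
    sigmaOverι X i ≫ sigmaOverDesc f ≫ g = f i ≫ g := by
  rw [← Category.assoc, sigmaOverι_desc]

variable {X} in
lemma sigmaOver_hom_ext {W : Over (SpecK k)} {f g : sigmaOver X ⟶ W}
    (h : ∀ i, sigmaOverι X i ≫ f = sigmaOverι X i ≫ g) : f = g := by
  ext1
  refine Sigma.hom_ext _ _ fun i => ?_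
  exact congrArg (fun r => Over.Hom.left r) (h i)

instance (i : I) : IsOpenImmersion (sigmaOverι X i).left :=
  inferInstanceAs (IsOpenImmersion (Sigma.ι (fun i => (X i).left) i))

lemma isClosed_range_sigmaι (X : I → Scheme.{u}) (i : I) :
    IsClosed (Set.range (Sigma.ι X i)) := by
  have h : (Set.range (Sigma.ι X i))ᶜ = ⋃ j : {j // j ≠ i}, Set.range (Sigma.ι X j) := by
    ext x
    obtain ⟨j, y, rfl⟩ := (sigmaOpenCover X).exists_eq x
    change Sigma.ι X j y ∈ _ ↔ Sigma.ι X j y ∈ _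
    simp only [Set.mem_compl_iff, Set.mem_range, Set.mem_iUnion]
    constructor
    · intro h
      exact ⟨⟨j, fun hj => by subst hj; exact h ⟨y, rfl⟩⟩, y, rfl⟩
    · rintro ⟨⟨j', hj'⟩, y', hy⟩ ⟨z, hz⟩
      have h₁ : j' = j := congrArg Sigma.fst ((sigmaι_eq_iff X _ _ _ _).1 hy)
      have h₂ : i = j := congrArg Sigma.fst ((sigmaι_eq_iff X _ _ _ _).1 hz)
      exact hj' (h₁.trans h₂.symm)
  rw [← isOpen_compl_iff, h]
  exact isOpen_iUnion fun j => (Sigma.ι X j).opensRange.isOpen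

/-- A coproduct of `k`-schemes, pointed by a summand that is a copy of `Spec k`. -/
def PtdSch.ofSigma (i : I) (e : Over.mk (𝟙 (SpecK k)) ≅ X i) : PtdSch k where
  X := sigmaOver X
  pt := e.hom ≫ sigmaOverι X i
  isOpenImmersion :=
    have : IsIso e.hom.left := inferInstanceAs (IsIso ((Over.forget _).map e.hom))
    inferInstanceAs (IsOpenImmersion (e.hom.left ≫ Sigma.ι (fun i => (X i).left) i))
  isClosed := by
    have : IsIso e.hom.left := inferInstanceAs (IsIso ((Over.forget _).map e.hom))
    have h : Function.Surjective e.hom.left := Scheme.Hom.surjective _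
    have h' : Set.range (e.hom.left ≫ Sigma.ι (fun i => (X i).left) i) =
        Set.range (Sigma.ι (fun i => (X i).left) i) := h.range_comp _
    change IsClosed (Set.range (e.hom.left ≫ Sigma.ι (fun i => (X i).left) i))
    rw [h']
    exact isClosed_range_sigmaι _ i

end Coproducts

section ConstantSchemes

variable (k) in
/-- The map `∐_A Spec k ⟶ ∐_B Spec k` induced by a map `A → B`. -/
def constMap {A B : Type} (f : A → B) :
    sigmaOver (fun _ : A => Over.mk (𝟙 (SpecK k))) ⟶
      sigmaOver (fun _ : B => Over.mk (𝟙 (SpecK k))) :=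
  sigmaOverDesc fun a => sigmaOverι (fun _ : B => Over.mk (𝟙 (SpecK k))) (f a)

lemma sigmaOverι_constMap {A B : Type} (f : A → B) (a : A) :
    sigmaOverι (fun _ : A => Over.mk (𝟙 (SpecK k))) a ≫ constMap k f =
      sigmaOverι (fun _ : B => Over.mk (𝟙 (SpecK k))) (f a) :=
  sigmaOverι_desc _ _ _

lemma constMap_id (A : Type) : constMap k (id : A → A) = 𝟙 _ :=
  sigmaOver_hom_ext fun a => (sigmaOverι_constMap _ a).trans (Category.comp_id _).symm

lemma constMap_comp {A B B' : Type} (f : A → B) (g : B → B') :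
    constMap k (g ∘ f) = constMap k f ≫ constMap k g :=
  sigmaOver_hom_ext fun a => by
    rw [sigmaOverι_constMap, ← Category.assoc, sigmaOverι_constMap, sigmaOverι_constMap]
    rfl

variable (k) in
/-- The constant pointed scheme `∐_A Spec k` on a pointed set `A`. -/
def constSch : Pointed.{0} ⥤ PtdSch k where
  obj A := PtdSch.ofSigma (fun _ : A.X => Over.mk (𝟙 (SpecK k))) A.point (Iso.refl _)
  map {A B} f :=
    { hom := constMap k f.toFun
      w := by
        refine (Category.assoc _ _ _).trans ((Category.id_comp _).trans ?_)
        refine (sigmaOverι_constMap _ _).trans (Eq.trans ?_ (Category.id_comp _).symm)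
        rw [f.map_point] }
  map_id A := PtdSch.hom_ext (constMap_id A.X)
  map_comp f g := PtdSch.hom_ext (constMap_comp f.toFun g.toFun)

end ConstantSchemes

section Gm

open LaurentPolynomial

variable (k)

/-- The multiplicative group `Spec k[T, T⁻¹]`. -/
def Gm : Over (SpecK k) :=
  Over.mk (Spec.map (CommRingCat.ofHom (LaurentPolynomial.C : k →+* k[T;T⁻¹])))

/-- The point `1` of the multiplicative group. -/
def Gm.one : Over.mk (𝟙 (SpecK k)) ⟶ Gm k :=
  Over.homMk (V := Gm k)
    (Spec.map (CommRingCat.ofHom (LaurentPolynomial.eval₂ (RingHom.id k) 1))) (by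
    change Spec.map _ ≫ Spec.map _ = 𝟙 _
    rw [← Spec.map_comp, ← CommRingCat.ofHom_comp, ← Spec.map_id]
    congr 2
    ext r
    exact LaurentPolynomial.eval₂_C _ _ r)

/-- The index set of the summands in degree `m` of the whiskered multiplicative group: `none` for
`𝔾_m`, and an `m`-simplex of `Δ[1]` other than the one at the vertex `0`. -/
abbrev WhiskerIndex (m : SimplexCategory) : Type :=
  Option { σ : m ⟶ ⦋1⦌ // σ ≠ SimplexCategory.const m ⦋1⦌ 0 }

/-- The summands in degree `m` of the whiskered multiplicative group. -/
abbrev whiskerSummand (m : SimplexCategory) (i : WhiskerIndex m) : Over (SpecK k) :=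
  match i with
  | none => Gm k
  | some _ => Over.mk (𝟙 (SpecK k))

lemma const_one_ne (m : SimplexCategory) :
    SimplexCategory.const m ⦋1⦌ 1 ≠ SimplexCategory.const m ⦋1⦌ 0 := fun h =>
  absurd (congrArg (fun f : m ⟶ ⦋1⦌ => f.toOrderHom 0) h) (by simp)

open Classical in
/-- The `m`-simplex `σ` of the whisker `Δ[1]`, where the vertex `0` is glued to `1 ∈ 𝔾_m`. -/
def whiskerCell (m : SimplexCategory) (σ : m ⟶ ⦋1⦌) :
    Over.mk (𝟙 (SpecK k)) ⟶ sigmaOver (whiskerSummand k m) :=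
  if h : σ = SimplexCategory.const m ⦋1⦌ 0 then
    Gm.one k ≫ sigmaOverι (whiskerSummand k m) none
  else sigmaOverι (whiskerSummand k m) (some ⟨σ, h⟩)

/-- The simplicial structure maps of the whiskered multiplicative group. -/
def whiskerMap {m m' : SimplexCategory} (φ : m' ⟶ m) :
    sigmaOver (whiskerSummand k m) ⟶ sigmaOver (whiskerSummand k m') :=
  sigmaOverDesc fun i => match i with
    | none => sigmaOverι (whiskerSummand k m') none
    | some σ => whiskerCell k m' (φ ≫ σ.1)

lemma whiskerι_none_map {m m' : SimplexCategory} (φ : m' ⟶ m) :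
    sigmaOverι (whiskerSummand k m) none ≫ whiskerMap k φ =
      sigmaOverι (whiskerSummand k m') none :=
  sigmaOverι_desc _ _ _

lemma whiskerCell_map {m m' : SimplexCategory} (φ : m' ⟶ m) (σ : m ⟶ ⦋1⦌) :
    whiskerCell k m σ ≫ whiskerMap k φ = whiskerCell k m' (φ ≫ σ) := by
  by_cases h : σ = SimplexCategory.const m ⦋1⦌ 0
  · subst h
    have h : φ ≫ SimplexCategory.const m ⦋1⦌ 0 = SimplexCategory.const m' ⦋1⦌ 0 := rfl
    rw [h, whiskerCell, whiskerCell, dif_pos rfl, dif_pos rfl, Category.assoc, whiskerι_none_map]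
  · rw [whiskerCell, dif_neg h]
    exact sigmaOverι_desc _ _ _

lemma whiskerCell_of_ne {m : SimplexCategory} (σ : m ⟶ ⦋1⦌)
    (h : σ ≠ SimplexCategory.const m ⦋1⦌ 0) :
    whiskerCell k m σ = sigmaOverι (whiskerSummand k m) (some ⟨σ, h⟩) :=
  dif_neg h

lemma whiskerι_some_map {m m' : SimplexCategory} (φ : m' ⟶ m)
    (σ : { σ : m ⟶ ⦋1⦌ // σ ≠ SimplexCategory.const m ⦋1⦌ 0 }) :
    sigmaOverι (whiskerSummand k m) (some σ) ≫ whiskerMap k φ = whiskerCell k m' (φ ≫ σ.1) :=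
  sigmaOverι_desc _ _ _

lemma whiskerMap_id (m : SimplexCategory) : whiskerMap k (𝟙 m) = 𝟙 _ := by
  refine sigmaOver_hom_ext fun i => ?_
  rw [Category.comp_id]
  obtain _ | σ := i
  · exact whiskerι_none_map k _
  · rw [whiskerι_some_map, Category.id_comp, whiskerCell_of_ne k σ.1 σ.2]

lemma whiskerMap_comp {m m' m'' : SimplexCategory} (φ : m' ⟶ m) (ψ : m'' ⟶ m') :
    whiskerMap k (ψ ≫ φ) = whiskerMap k φ ≫ whiskerMap k ψ := by
  refine sigmaOver_hom_ext fun i => ?_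
  rw [← Category.assoc]
  obtain _ | σ := i
  · rw [whiskerι_none_map, whiskerι_none_map, whiskerι_none_map]
  · rw [whiskerι_some_map, whiskerι_some_map, whiskerCell_map, Category.assoc]

/-- The whiskered multiplicative group: the simplicial scheme `𝔾_m ⊔_{1} Δ[1]` obtained by gluing
the vertex `0` of the interval to the point `1`, pointed at the free vertex `1` of the interval.
It is a simplicial resolution of the pointed presheaf `(𝔾_m, 1)` by smooth `k`-schemes with a
disjoint base point: contracting the interval is a weak equivalence of pointed simplicial
presheaves onto `(𝔾_m, 1)`. -/
def whiskeredGm : SimplicialObject (PtdSch k) where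
  obj m := PtdSch.ofSigma (whiskerSummand k m.unop)
    (some ⟨SimplexCategory.const m.unop ⦋1⦌ 1, const_one_ne _⟩) (Iso.refl _)
  map {m m'} φ :=
    { hom := whiskerMap k φ.unop
      w := by
        refine (Category.assoc _ _ _).trans ((Category.id_comp _).trans ?_)
        refine Eq.trans ?_ (Category.id_comp _).symm
        refine (whiskerι_some_map k φ.unop _).trans ?_
        exact whiskerCell_of_ne k _ (const_one_ne m'.unop) }
  map_id m := PtdSch.hom_ext (whiskerMap_id k m.unop)
  map_comp φ ψ := PtdSch.hom_ext (whiskerMap_comp k φ.unop ψ.unop)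

end Gm

/-- The relation identifying the two (constant) `m`-simplices of `∂Δ[1]`. -/
def CircleRel (m : SimplexCategory) (σ τ : m ⟶ ⦋1⦌) : Prop :=
  (∃ a, σ = SimplexCategory.const m ⦋1⦌ a) ∧ (∃ b, τ = SimplexCategory.const m ⦋1⦌ b)

/-- The simplicial circle `Δ[1] / ∂Δ[1]`. -/
def circle : SimplicialObject Pointed.{0} where
  obj m := ⟨Quot (CircleRel m.unop), Quot.mk _ (SimplexCategory.const m.unop ⦋1⦌ 0)⟩
  map φ := ⟨Quot.map (φ.unop ≫ ·) (by
    rintro _ _ ⟨⟨a, rfl⟩, ⟨b, rfl⟩⟩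
    exact ⟨⟨a, rfl⟩, ⟨b, rfl⟩⟩), rfl⟩
  map_id m := Pointed.Hom.ext (funext fun x => by
    induction x using Quot.ind with
    | _ σ => exact congrArg (Quot.mk _) (Category.id_comp σ))
  map_comp φ ψ := Pointed.Hom.ext (funext fun x => by
    induction x using Quot.ind with
    | _ σ => exact congrArg (Quot.mk _) (Category.assoc ψ.unop φ.unop σ))

section Flf

/-- The smash products `K ∧ A` of a (termwise iterated smash product) simplicial pointed scheme
`K = ⋀ᵢ Kᵢ` with the constant pointed schemes on pointed sets `A`. -/
def smashWith {ι : Type} (K : SimplicialObject (ι → PtdSch k)) :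
    Pointed.{0} ⥤ SimplicialObject (Option ι → PtdSch k) :=
  Functor.curry.obj (Functor.pi' fun i : Option ι => match i with
    | none => CategoryTheory.Prod.fst _ _ ⋙ constSch k
    | some i => CategoryTheory.Prod.snd _ _ ⋙ K ⋙ Pi.eval (fun _ : ι => PtdSch k) i)

/-- The sectionwise geometric realization of a simplicial presheaf of pointed spaces. -/
def diagPresheaf {C : Type*} [Category* C] : SimplicialObject (C ⥤ PSSet.{w}) ⥤ (C ⥤ PSSet.{w}) :=
  flipFunctor _ _ _ ⋙ (Functor.whiskeringRight _ _ _).obj PSSet.diag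

/-- The space (nerve of the groupoid) of finite locally free spans from `Y` to `⋀ᵢ Pᵢ`, that is, the
presheaf of spaces on `Sm k` represented by `∏ᵢ Pᵢ°` in finite locally free correspondences. -/
def spanNerve {ι : Type} [Finite ι] : (ι → PtdSch k) ⥤ (Sm k)ᵒᵖ ⥤ PSSet.{u + 1} :=
  FlfSpan.presheaf ⋙ (Functor.whiskeringRight _ _ _).obj PCat.nerve

/-- The presheaf of `E_∞`-monoids `h^flf(K)` on `Sm k`, for a simplicial pointed scheme `K = ⋀ᵢ Kᵢ`
with disjoint base points in each degree. On such a scheme `X` with a disjoint base point, `h^flf` is the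
presheaf represented by `X` in finite locally free correspondences, and `h^flf` commutes with
geometric realizations.

The monoid structure (disjoint union of spans) is recorded as a special `Γ`-space: the functor
sending a pointed set `A` to `h^flf(K ∧ A)`. Its value at `{0, …, r}` is equivalent to `h^flf(K)^r`, and
the fold map `{0, 1, 2} → {0, 1}` induces the disjoint union. -/
def hflf {ι : Type} [Finite ι] (K : SimplicialObject (ι → PtdSch k)) :
    Pointed.{0} ⥤ (Sm k)ᵒᵖ ⥤ PSSet.{u + 1} :=
  smashWith K ⋙ (SimplicialObject.whiskering _ _).obj spanNerve ⋙ diagPresheaf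

/-- The group completion of a presheaf of `E_∞`-monoids given as a special `Γ`-space: the
presheaf of spaces `Ω B M`, where `B M` is the geometric realization of `M` on the simplicial circle. -/
def gp (M : Pointed.{0} ⥤ (Sm k)ᵒᵖ ⥤ PSSet.{u + 1}) : (Sm k)ᵒᵖ ⥤ SSet.{u + 1} :=
  diagPresheaf.obj (circle ⋙ M) ⋙ PSSet.loopSpace

variable (k) in
/-- The `n`-fold smash power `𝔾_m^{∧ n}` of the pointed presheaf `(𝔾_m, 1)`, as a simplicial
pointed scheme with disjoint base points: the termwise smash power of the whiskered multiplicative group. -/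
def GmSmash (n : ℕ) : SimplicialObject (Fin n → PtdSch k) :=
  Functor.pi' fun _ => whiskeredGm k

variable (k) in
/-- The sectionwise weak equivalences of simplicial presheaves. -/
abbrev presheafWeakEq : MorphismProperty ((Sm k)ᵒᵖ ⥤ SSet.{u + 1}) :=
  SSet.weakEq.functorCategory (Sm k)ᵒᵖ

variable (k) in
/-- The homotopy category of presheaves of spaces on `Sm k`. -/
abbrev HoPSh := (presheafWeakEq k).Localization

variable (k) in
/-- The localization functor. -/
abbrev HoPSh.of : ((Sm k)ᵒᵖ ⥤ SSet.{u + 1}) ⥤ HoPSh k := (presheafWeakEq k).Q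

/-- A presheaf of spaces `F` is rationally contractible if there is a map `s : F ⟶ Ĉ₁ F` of
presheaves of spaces such that `i₀^* s` is homotopic to the identity and `i₁^* s` factors, up to homotopy,
through the terminal presheaf. -/
def RationallyContractible (F : (Sm k)ᵒᵖ ⥤ SSet.{u + 1}) : Prop :=
  ∃ s : (HoPSh.of k).obj F ⟶ (HoPSh.of k).obj (Sm.C1 F),
    s ≫ (HoPSh.of k).map (Sm.evalZero F) = 𝟙 _ ∧
    ∃ (a : (HoPSh.of k).obj F ⟶ (HoPSh.of k).obj (⊤_ _))
      (b : (HoPSh.of k).obj (⊤_ _) ⟶ (HoPSh.of k).obj F),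
      s ≫ (HoPSh.of k).map (Sm.evalOne F) = a ≫ b

end Flf

end FlfCor

end

/-!
The presheaf `h^flf(𝔾_m^{∧ n})^gp` is the loop space of `B h^flf(𝔾_m^{∧ n})`, so it suffices to
deform the bar construction. On the apex `Z` of a span with right leg `x : Z ⟶ 𝔾_m^n`, the
functions `(1 - t) x_i + t` are invertible outside a closed subset of `Z × 𝔸¹` which misses
`Z × {0, 1}`; as `Z` is finite over `Y`, the image of this subset in `Y × 𝔸¹` is closed, and its
complement is a neighbourhood of `Y × {0, 1}`. A simplex of the bar construction consists of
finitely many spans, hence it is deformed over a common neighbourhood. At `t = 0` the deformation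
is the identity, and at `t = 1` it is the end of a homotopy which pushes the spans along the
whiskers to the base point of `𝔾_m`, that is, to spans with empty support. Each simplex is deformed
only over a neighbourhood that depends on it; passing to loop spaces is harmless because these
commute with filtered colimits.
-/

noncomputable section

/-! ### Loop spaces and filtered colimits -/

namespace FlfCor

open CartesianMonoidalCategory

lemma preservesColimitsOfShape_colimit {C D J K : Type*} [Category* C] [Category* D] [Category* J]
    [Category* K] [HasColimitsOfShape K D] [HasColimitsOfShape J D] (F : K ⥤ C ⥤ D)
    [∀ i, PreservesColimitsOfShape J (F.obj i)] : PreservesColimitsOfShape J (colimit F) := by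
  have : PreservesColimitsOfShape J F.flip :=
    preservesColimitsOfShape_of_evaluation _ _ fun i =>
      inferInstanceAs (PreservesColimitsOfShape J (F.obj i))
  exact preservesColimitsOfShape_of_natIso (colimitIsoFlipCompColim F).symm

instance preservesFiniteLimits_exIter (i : ℕ) : PreservesFiniteLimits (SSet.exIter.{w} i) := by
  induction i with
  | zero => exact inferInstanceAs (PreservesFiniteLimits (𝟭 SSet.{w}))
  | succ i ih => exact comp_preservesFiniteLimits (SSet.exIter i) SSet.ex

instance preservesFiniteLimits_exInf : PreservesFiniteLimits SSet.exInf.{w} :=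
  have : HasExactColimitsOfShape ℕ (Type w) := ⟨filtered_colim_preservesFiniteLimits_of_types⟩
  have : HasExactColimitsOfShape ℕ SSet.{w} :=
    inferInstanceAs (HasExactColimitsOfShape ℕ (SimplexCategoryᵒᵖ ⥤ Type w))
  ObjectProperty.prop_colimit (P := ObjectProperty.preservesFiniteLimits)
    (Functor.ofSequence (X := SSet.exIter.{w}) fun i => (SSet.exIter i).whiskerLeft SSet.toEx)
    preservesFiniteLimits_exIter

lemma finite_nerve (P : Type w) [PartialOrder P] [Finite P] : (nerve P).Finite := by
  have := Fintype.ofFinite P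
  have : (nerve P).HasDimensionLT (Fintype.card P) := ⟨fun n hn => by
    ext s
    have hs : ¬ Function.Injective s.obj := fun hs => by
      have hcard := Fintype.card_le_of_injective (α := Fin (n + 1)) s.obj hs
      rw [Fintype.card_fin] at hcard
      omega
    simpa only [SSet.mem_degenerate_iff_notMem_nonDegenerate,
      PartialOrder.mem_nerve_nonDegenerate_iff_injective, Set.top_eq_univ, Set.mem_univ,
      iff_true] using hs⟩
  refine SSet.finite_of_hasDimensionLT _ (Fintype.card P) fun i _ => ?_
  have : Finite ((nerve P) _⦋i⦌) :=
    Finite.of_injective (fun s => (s.obj : Fin (i + 1) → P)) fun s t hst =>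
      CategoryTheory.Functor.ext (congrFun hst) fun _ _ _ => Subsingleton.elim _ _
  infer_instance

instance finite_sd (n : SimplexCategory) : (SimplexCategory.sd.{w}.obj n).Finite := by
  have : Finite (PartialOrder.NonemptyFiniteChains (ULift.{w} (Fin (n.len + 1)))) :=
    Finite.of_injective PartialOrder.NonemptyFiniteChains.finset
      fun _ _ => PartialOrder.NonemptyFiniteChains.ext
  exact finite_nerve (PartialOrder.NonemptyFiniteChains (ULift.{w} (Fin (n.len + 1))))

section FilteredColimits

variable {J : Type*} [Category* J] [IsFiltered J] [EssentiallySmall.{w} J]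

lemma preservesFilteredColimits_coyoneda (K : SSet.{w}) [K.Finite] :
    PreservesColimitsOfShape J (coyoneda.obj (op K)) :=
  have := Cardinal.fact_isRegular_aleph0.{w}
  have := (isCardinalFiltered_aleph0_iff.{w} J).2 inferInstance
  preservesColimitsOfShape_of_isCardinalPresentable_of_essentiallySmall K Cardinal.aleph0.{w} J

instance preservesFilteredColimits_ex : PreservesColimitsOfShape J SSet.ex.{w} :=
  preservesColimitsOfShape_of_evaluation _ _ fun n =>
    have := preservesFilteredColimits_coyoneda (J := J) (SimplexCategory.sd.{w}.obj n.unop)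
    inferInstanceAs (PreservesColimitsOfShape J
      (coyoneda.obj (op (SimplexCategory.sd.{w}.obj n.unop)) ⋙ uliftFunctor.{0}))

instance preservesFilteredColimits_exIter (i : ℕ) :
    PreservesColimitsOfShape J (SSet.exIter.{w} i) := by
  induction i with
  | zero => exact inferInstanceAs (PreservesColimitsOfShape J (𝟭 SSet.{w}))
  | succ i ih => exact comp_preservesColimitsOfShape (SSet.exIter i) SSet.ex

instance preservesFilteredColimits_exInf : PreservesColimitsOfShape J SSet.exInf.{w} :=
  have : HasColimitsOfShape J SSet.{w} := hasColimitsOfShape_of_essentiallySmall J _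
  have (i : ℕ) : PreservesColimitsOfShape J ((Functor.ofSequence (X := SSet.exIter.{w})
      fun i => (SSet.exIter i).whiskerLeft SSet.toEx).obj i) := preservesFilteredColimits_exIter i
  preservesColimitsOfShape_colimit _

section LoopSpace

variable {F : J ⥤ PSSet.{w}} {c : Cocone F}

lemma exists_comp_eq_exBasept (hc : IsColimit (PSSet.forget.mapCocone c)) {T : SSet.{w}} [T.Finite]
    {i : J} (δ : T ⟶ SSet.exInf.obj (PSSet.forget.obj (F.obj i)))
    (hδ : δ ≫ SSet.exInf.map (PSSet.forget.map (c.ι.app i)) = c.pt.exBasept T) :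
    ∃ (j : J) (a : i ⟶ j),
      δ ≫ SSet.exInf.map (PSSet.forget.map (F.map a)) = (F.obj j).exBasept T := by
  have := preservesFilteredColimits_coyoneda (J := J) T
  obtain ⟨j, a, ha⟩ := exists_eq_of_preservesColimit_coyoneda_self
    (isColimitOfPreserves SSet.exInf hc) δ ((F.obj i).exBasept T)
    (hδ.trans (PSSet.exBasept_comp (c.ι.app i) T).symm)
  exact ⟨j, a, ha.trans (PSSet.exBasept_comp (F.map a) T)⟩

lemma exists_isLoop_comp (hc : IsColimit (PSSet.forget.mapCocone c)) {T : SSet.{w}} [T.Finite]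
    {i : J} (γ : T ⊗ Δ[1] ⟶ SSet.exInf.obj (PSSet.forget.obj (F.obj i)))
    (hγ : c.pt.IsLoop (γ ≫ SSet.exInf.map (PSSet.forget.map (c.ι.app i)))) :
    ∃ (j : J) (a : i ⟶ j),
      (F.obj j).IsLoop (γ ≫ SSet.exInf.map (PSSet.forget.map (F.map a))) := by
  obtain ⟨j₀, a₀, h₀⟩ := exists_comp_eq_exBasept hc (SSet.ι₀ ≫ γ)
    ((Category.assoc _ _ _).trans hγ.1)
  obtain ⟨j₁, a₁, h₁⟩ := exists_comp_eq_exBasept hc (SSet.ι₁ ≫ γ)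
    ((Category.assoc _ _ _).trans hγ.2)
  obtain ⟨j, b₀, b₁, hb⟩ := IsFiltered.span a₀ a₁
  refine ⟨j, a₀ ≫ b₀, ?_, ?_⟩
  · rw [Functor.map_comp, Functor.map_comp, Functor.map_comp, ← Category.assoc, ← Category.assoc,
      h₀, PSSet.exBasept_comp]
  · rw [hb, Functor.map_comp, Functor.map_comp, Functor.map_comp, ← Category.assoc,
      ← Category.assoc, h₁, PSSet.exBasept_comp]

/-- Loop spaces commute with filtered colimits, because `Δ[m]` and `Δ[m] ⊗ Δ[1]` are finite. -/
def isColimitLoopSpace (hc : IsColimit (PSSet.forget.mapCocone c)) :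
    IsColimit (PSSet.loopSpace.mapCocone c) :=
  evaluationJointlyReflectsColimits _ fun m => by
    have hex := isColimitOfPreserves SSet.exInf hc
    have := preservesFilteredColimits_coyoneda (J := J) (SSet.stdSimplex.{w}.obj m.unop ⊗ Δ[1])
    refine Types.FilteredColimit.isColimitOf _ _ (fun γ => ?_) fun i j γ δ h => ?_
    · obtain ⟨i, γ', hγ'⟩ := exists_hom_of_preservesColimit_coyoneda hex γ.1
      obtain ⟨j, a, ha⟩ := exists_isLoop_comp hc γ' (hγ' ▸ γ.2)
      refine ⟨j, ⟨_, ha⟩, Subtype.ext (hγ'.symm.trans ?_)⟩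
      exact (congrArg (γ' ≫ ·) ((PSSet.forget ⋙ SSet.exInf).mapCocone c |>.w a).symm).trans
        (Category.assoc _ _ _).symm
    · obtain ⟨l, a, b, hab⟩ := exists_eq_of_preservesColimit_coyoneda hex γ.1 δ.1
        (congrArg Subtype.val h)
      exact ⟨l, a, b, Subtype.ext hab⟩

end LoopSpace

end FilteredColimits

end FlfCor

namespace PSSet

lemma hom_ext {X Y : PSSet.{w}} {f g : X ⟶ Y}
    (h : ∀ m x, (f.app m).toFun x = (g.app m).toFun x) : f = g :=
  NatTrans.ext (funext fun m => Pointed.Hom.ext (funext (h m)))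

/-- The pointed simplicial subsets of a pointed simplicial set. -/
@[ext]
structure Subcomplex (X : PSSet.{w}) where
  carrier (m : SimplexCategoryᵒᵖ) : Set (X.obj m).X
  point_mem (m : SimplexCategoryᵒᵖ) : (X.obj m).point ∈ carrier m
  map_mem {m m' : SimplexCategoryᵒᵖ} (φ : m ⟶ m') {x : (X.obj m).X} (hx : x ∈ carrier m) :
    (X.map φ).toFun x ∈ carrier m'

namespace Subcomplex

variable {X X' : PSSet.{w}}

instance : PartialOrder X.Subcomplex := PartialOrder.lift carrier fun _ _ => Subcomplex.ext

/-- A subcomplex as a pointed simplicial set. -/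
def toPSSet (A : X.Subcomplex) : PSSet.{w} where
  obj m := ⟨A.carrier m, ⟨_, A.point_mem m⟩⟩
  map φ := ⟨fun x => ⟨_, A.map_mem φ x.2⟩, Subtype.ext (X.map φ).map_point⟩
  map_id m := Pointed.Hom.ext (funext fun x =>
    Subtype.ext (congrFun (congrArg Pointed.Hom.toFun (X.map_id m)) x.1))
  map_comp φ ψ := Pointed.Hom.ext (funext fun x =>
    Subtype.ext (congrFun (congrArg Pointed.Hom.toFun (X.map_comp φ ψ)) x.1))

/-- The map between subcomplexes induced by a map that sends the first into the second. -/
def mapOfMapsTo {A : X.Subcomplex} {A' : X'.Subcomplex} (f : X ⟶ X')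
    (h : ∀ m, Set.MapsTo (f.app m).toFun (A.carrier m) (A'.carrier m)) :
    A.toPSSet ⟶ A'.toPSSet where
  app m := ⟨(h m).restrict, Subtype.ext (f.app m).map_point⟩
  naturality _ _ φ := Pointed.Hom.ext (funext fun x =>
    Subtype.ext (congrFun (congrArg Pointed.Hom.toFun (f.naturality φ)) x.1))

/-- The subcomplexes as a diagram of pointed simplicial sets. -/
def functor (X : PSSet.{w}) : X.Subcomplex ⥤ PSSet.{w} where
  obj := toPSSet
  map f := mapOfMapsTo (𝟙 X) fun m => leOfHom f m

/-- The inclusion of a subcomplex. -/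
def ι (A : X.Subcomplex) : A.toPSSet ⟶ X where
  app _ := ⟨Subtype.val, rfl⟩

lemma functor_map_ι {A A' : X.Subcomplex} (f : A ⟶ A') : (functor X).map f ≫ A'.ι = A.ι := rfl

/-- The inclusions of a diagram of subcomplexes, as a cocone. -/
def cocone {J : Type*} [Category* J] (F : J ⥤ X.Subcomplex) : Cocone (F ⋙ functor X) where
  pt := X
  ι := { app j := (F.obj j).ι }

def isColimitCocone {J : Type*} [Category* J] [IsFiltered J] (F : J ⥤ X.Subcomplex)
    (h : ∀ m x, ∃ j, x ∈ (F.obj j).carrier m) : IsColimit (PSSet.forget.mapCocone (cocone F)) :=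
  evaluationJointlyReflectsColimits _ fun m => Types.FilteredColimit.isColimitOf _ _
    (fun x => let ⟨j, hj⟩ := h m x; ⟨j, ⟨x, hj⟩, rfl⟩)
    fun i j _ _ hxy => ⟨_, IsFiltered.leftToMax i j, IsFiltered.rightToMax i j, Subtype.ext hxy⟩

end Subcomplex

end PSSet

/-! ### Homotopies and loop spaces -/

namespace FlfCor

open CartesianMonoidalCategory

section LiftProd

variable {C D : Type*} [Category* C] [Category* D] [CartesianMonoidalCategory C]
  [CartesianMonoidalCategory D] (G : C ⥤ D) [PreservesFiniteProducts G] {T T' : D} {X X' A : C}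

lemma map_prod_hom_ext {a b : T ⟶ G.obj (X ⊗ A)}
    (h₁ : a ≫ G.map (fst X A) = b ≫ G.map (fst X A))
    (h₂ : a ≫ G.map (snd X A) = b ≫ G.map (snd X A)) : a = b := by
  rw [← cancel_mono (CartesianMonoidalCategory.prodComparison G X A)]
  ext
  · simpa only [Category.assoc, CartesianMonoidalCategory.prodComparison_fst] using h₁
  · simpa only [Category.assoc, CartesianMonoidalCategory.prodComparison_snd] using h₂

/-- The map with given components into the image of a product under a functor that preserves
finite products. -/
def liftProd (a : T ⟶ G.obj X) (b : T ⟶ G.obj A) : T ⟶ G.obj (X ⊗ A) :=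
  lift a b ≫ inv (CartesianMonoidalCategory.prodComparison G X A)

lemma liftProd_map_fst (a : T ⟶ G.obj X) (b : T ⟶ G.obj A) :
    liftProd G a b ≫ G.map (fst X A) = a := by
  rw [liftProd, Category.assoc, CartesianMonoidalCategory.inv_prodComparison_map_fst, lift_fst]

lemma liftProd_map_snd (a : T ⟶ G.obj X) (b : T ⟶ G.obj A) :
    liftProd G a b ≫ G.map (snd X A) = b := by
  rw [liftProd, Category.assoc, CartesianMonoidalCategory.inv_prodComparison_map_snd, lift_snd]

lemma eq_liftProd {a : T ⟶ G.obj X} {b : T ⟶ G.obj A} {c : T ⟶ G.obj (X ⊗ A)}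
    (h₁ : c ≫ G.map (fst X A) = a) (h₂ : c ≫ G.map (snd X A) = b) : liftProd G a b = c :=
  map_prod_hom_ext G ((liftProd_map_fst G a b).trans h₁.symm)
    ((liftProd_map_snd G a b).trans h₂.symm)

lemma comp_liftProd (f : T' ⟶ T) (a : T ⟶ G.obj X) (b : T ⟶ G.obj A) :
    f ≫ liftProd G a b = liftProd G (f ≫ a) (f ≫ b) :=
  (eq_liftProd G (by rw [Category.assoc, liftProd_map_fst])
    (by rw [Category.assoc, liftProd_map_snd])).symm

lemma liftProd_map_whiskerRight (a : T ⟶ G.obj X) (b : T ⟶ G.obj A) (f : X ⟶ X') :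
    liftProd G a b ≫ G.map (f ▷ A) = liftProd G (a ≫ G.map f) b := by
  refine (eq_liftProd G ?_ ?_).symm
  · rw [Category.assoc, ← G.map_comp, whiskerRight_fst, G.map_comp, ← Category.assoc,
      liftProd_map_fst]
  · rw [Category.assoc, ← G.map_comp, whiskerRight_snd, liftProd_map_snd]

lemma comp_map_toUnit {G : C ⥤ C} [PreservesFiniteProducts G] (η : 𝟭 C ⟶ G) {T : C}
    (γ : T ⟶ G.obj X) (p : 𝟙_ C ⟶ A) :
    γ ≫ G.map (toUnit X ≫ p) = toUnit T ≫ p ≫ η.app A := by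
  have h : γ ≫ G.map (toUnit X) = toUnit T ≫ η.app (𝟙_ C) :=
    (isTerminalTensorUnit.isTerminalObj G _).hom_ext _ _
  rw [G.map_comp, ← Category.assoc, h, Category.assoc]
  exact congrArg (toUnit T ≫ ·) (η.naturality p).symm

end LiftProd

end FlfCor

namespace PSSet

open CartesianMonoidalCategory FlfCor

variable {X Y X' Y' : PSSet.{w}}

/-- A homotopy between pointed maps that is constant on the base point. -/
structure Homotopy (f g : X ⟶ Y) where
  h : forget.obj X ⊗ Δ[1] ⟶ forget.obj Y
  h₀ : SSet.ι₀ ≫ h = forget.map f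
  h₁ : SSet.ι₁ ≫ h = forget.map g
  basept_comp : lift (basept X Δ[1]) (𝟙 _) ≫ h = basept Y Δ[1]

/-- The homotopy of loops `γ` along `h`, at the time given by `τ`. -/
def loopHomotopyApp (h : forget.obj X ⊗ Δ[1] ⟶ forget.obj Y) {T : SSet.{w}}
    (γ : T ⊗ Δ[1] ⟶ SSet.exInf.obj (forget.obj X)) (τ : T ⟶ Δ[1]) :
    T ⊗ Δ[1] ⟶ SSet.exInf.obj (forget.obj Y) :=
  liftProd SSet.exInf γ (fst T Δ[1] ≫ τ ≫ SSet.toExInf.app Δ[1]) ≫ SSet.exInf.map h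

lemma loopHomotopyApp_precomp (h : forget.obj X ⊗ Δ[1] ⟶ forget.obj Y)
    {T T' : SSet.{w}} (γ : T ⊗ Δ[1] ⟶ SSet.exInf.obj (forget.obj X)) (τ : T ⟶ Δ[1]) (f : T' ⟶ T) :
    f ▷ Δ[1] ≫ loopHomotopyApp h γ τ = loopHomotopyApp h (f ▷ Δ[1] ≫ γ) (f ≫ τ) := by
  rw [loopHomotopyApp, loopHomotopyApp, ← Category.assoc, comp_liftProd, whiskerRight_fst_assoc,
    Category.assoc]

lemma loopHomotopyApp_naturality {h : forget.obj X ⊗ Δ[1] ⟶ forget.obj Y}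
    {h' : forget.obj X' ⊗ Δ[1] ⟶ forget.obj Y'} (a : X ⟶ X') (b : Y ⟶ Y')
    (hab : forget.map a ▷ Δ[1] ≫ h' = h ≫ forget.map b) {T : SSet.{w}}
    (γ : T ⊗ Δ[1] ⟶ SSet.exInf.obj (forget.obj X)) (τ : T ⟶ Δ[1]) :
    loopHomotopyApp h' (γ ≫ SSet.exInf.map (forget.map a)) τ =
      loopHomotopyApp h γ τ ≫ SSet.exInf.map (forget.map b) := by
  rw [loopHomotopyApp, loopHomotopyApp, ← liftProd_map_whiskerRight, Category.assoc,
    ← Functor.map_comp, hab, Functor.map_comp, Category.assoc]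

lemma Homotopy.liftProd_exBasept {f g : X ⟶ Y} (H : Homotopy f g) {T : SSet.{w}} (τ : T ⟶ Δ[1]) :
    liftProd SSet.exInf (exBasept X T) (τ ≫ SSet.toExInf.app Δ[1]) ≫ SSet.exInf.map H.h =
      exBasept Y T := by
  have hlift : liftProd SSet.exInf (exBasept X T) (τ ≫ SSet.toExInf.app Δ[1]) =
      lift (basept X T) τ ≫ SSet.toExInf.app (forget.obj X ⊗ Δ[1]) := by
    refine eq_liftProd _ ?_ ?_
    · rw [Category.assoc, ← SSet.toExInf.naturality, Functor.id_map, lift_fst_assoc]; rfl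
    · rw [Category.assoc, ← SSet.toExInf.naturality, Functor.id_map, lift_snd_assoc]
  have hbase : lift (basept X T) τ ≫ H.h = basept Y T := by
    have : lift (basept X T) τ = τ ≫ lift (basept X Δ[1]) (𝟙 _) := by
      rw [comp_lift, Category.comp_id]; rfl
    rw [this, Category.assoc, H.basept_comp]; rfl
  rw [hlift, Category.assoc, ← SSet.toExInf.naturality, Functor.id_map, reassoc_of% hbase]; rfl

lemma Homotopy.isLoop_loopHomotopyApp {f g : X ⟶ Y} (H : Homotopy f g) {T : SSet.{w}}
    {γ : T ⊗ Δ[1] ⟶ SSet.exInf.obj (forget.obj X)} (hγ : X.IsLoop γ) (τ : T ⟶ Δ[1]) :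
    Y.IsLoop (loopHomotopyApp H.h γ τ) := by
  constructor
  · rw [loopHomotopyApp, ← Category.assoc, comp_liftProd, hγ.1, SSet.ι₀_fst_assoc,
      H.liftProd_exBasept]
  · rw [loopHomotopyApp, ← Category.assoc, comp_liftProd, hγ.2, SSet.ι₁_fst_assoc,
      H.liftProd_exBasept]

/-- The homotopy of loop spaces induced by a pointed homotopy. -/
def Homotopy.loopHomotopy {f g : X ⟶ Y} (H : Homotopy f g) :
    loopSpace.obj X ⊗ Δ[1] ⟶ loopSpace.obj Y where
  app m := ↾fun z => ⟨loopHomotopyApp H.h z.1.1 (SSet.yonedaEquiv.symm z.2),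
    H.isLoop_loopHomotopyApp z.1.2 _⟩
  naturality n m a := by
    refine ConcreteCategory.hom_ext _ _ fun z => Subtype.ext ?_
    change loopHomotopyApp H.h (SSet.stdSimplex.map a.unop ▷ Δ[1] ≫ z.1.1)
      (SSet.yonedaEquiv.symm (Δ[1].map a z.2)) =
        SSet.stdSimplex.map a.unop ▷ Δ[1] ≫ loopHomotopyApp H.h z.1.1 (SSet.yonedaEquiv.symm z.2)
    rw [loopHomotopyApp_precomp]
    exact congrArg _ (SSet.yonedaEquiv_symm_naturality_left (X := Δ[1]) a.unop z.2).symm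

lemma loopHomotopyApp_const (h : forget.obj X ⊗ Δ[1] ⟶ forget.obj Y) {T : SSet.{w}}
    (γ : T ⊗ Δ[1] ⟶ SSet.exInf.obj (forget.obj X)) (v : (Δ[1] : SSet.{w}) _⦋0⦌) :
    loopHomotopyApp h γ (SSet.const v) =
      γ ≫ SSet.exInf.map (lift (𝟙 _) (SSet.const v) ≫ h) := by
  rw [loopHomotopyApp, Functor.map_comp]
  refine (congrArg (· ≫ SSet.exInf.map h) (eq_liftProd SSet.exInf ?_ ?_)).trans
    (Category.assoc _ _ _)
  · rw [Category.assoc, ← Functor.map_comp, lift_fst, CategoryTheory.Functor.map_id,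
      Category.comp_id]
  · rw [Category.assoc, ← Functor.map_comp, lift_snd]
    exact comp_map_toUnit SSet.toExInf γ (SSet.const v)

lemma Homotopy.ι₀_loopHomotopy {f g : X ⟶ Y} (H : Homotopy f g) :
    SSet.ι₀ ≫ H.loopHomotopy = loopSpace.map f := by
  ext m γ
  exact Subtype.ext ((loopHomotopyApp_const H.h γ.1 (SSet.stdSimplex.obj₀Equiv.symm 0)).trans
    (congrArg (γ.1 ≫ SSet.exInf.map ·) H.h₀))

lemma Homotopy.ι₁_loopHomotopy {f g : X ⟶ Y} (H : Homotopy f g) :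
    SSet.ι₁ ≫ H.loopHomotopy = loopSpace.map g := by
  ext m γ
  exact Subtype.ext ((loopHomotopyApp_const H.h γ.1 (SSet.stdSimplex.obj₀Equiv.symm 1)).trans
    (congrArg (γ.1 ≫ SSet.exInf.map ·) H.h₁))

end PSSet

namespace FlfCor

open CartesianMonoidalCategory

/-- A map out of `X ⊗ Δ[1]` as a homotopy. -/
def homotopyOfMap {X Y : SSet.{w}} {f g : X ⟶ Y} (h : X ⊗ Δ[1] ⟶ Y) (h₀ : SSet.ι₀ ≫ h = f)
    (h₁ : SSet.ι₁ ≫ h = g) : SSet.Homotopy f g where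
  h := h
  h₀ := h₀
  h₁ := h₁
  rel := by
    ext n x
    exact x.1.2.elim

/-- The minimum on `Δ[1]`. -/
def minMap : Δ[1] ⊗ Δ[1] ⟶ (Δ[1] : SSet.{w}) where
  app _ := ↾fun x => SSet.stdSimplex.objEquiv.symm (SimplexCategory.mkHom
    { toFun i := min (SSet.stdSimplex.objEquiv x.1 i) (SSet.stdSimplex.objEquiv x.2 i)
      monotone' _ _ h := min_le_min ((SSet.stdSimplex.objEquiv x.1).toOrderHom.monotone h)
        ((SSet.stdSimplex.objEquiv x.2).toOrderHom.monotone h) })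
  naturality _ _ _ := rfl

/-- The contraction of `X ⊗ Δ[1]` to `X ⊗ {0}`. -/
def contractCylinder (X : SSet.{w}) : SSet.Homotopy (fst X Δ[1] ≫ SSet.ι₀) (𝟙 (X ⊗ Δ[1])) :=
  homotopyOfMap ((α_ _ _ _).hom ≫ X ◁ minMap)
    (by
      ext n x
      · rfl
      · apply SSet.stdSimplex.objEquiv.injective
        ext i : 3
        exact min_eq_right (Fin.zero_le (SSet.stdSimplex.objEquiv (n := ⦋1⦌) x.2 i)))
    (by
      ext n x
      · rfl
      · apply SSet.stdSimplex.objEquiv.injective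
        ext i : 3
        exact min_eq_left (Fin.le_last (n := 1) (SSet.stdSimplex.objEquiv (n := ⦋1⦌) x.2 i)))

lemma weakEq_fst (X : SSet.{w}) : SSet.weakEq (fst X Δ[1]) := by
  refine fun K _ => ⟨fun g => ⟨SSet.ι₀ ≫ g, ⟨homotopyOfMap ((contractCylinder X).h ≫ g) ?_ ?_⟩⟩,
    fun h h' ⟨H⟩ => ⟨homotopyOfMap (SSet.ι₀ ▷ Δ[1] ≫ H.h) ?_ ?_⟩⟩
  · rw [(contractCylinder X).h₀_assoc, Category.assoc]
  · rw [(contractCylinder X).h₁_assoc, Category.id_comp]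
  · rw [SSet.ι₀_comp_assoc, H.h₀, SSet.ι₀_fst_assoc]
  · rw [SSet.ι₁_comp_assoc, H.h₁, SSet.ι₀_fst_assoc]

variable {k : Type u} [Field k]

lemma map_eq_map_of_homotopy {F G : (Sm k)ᵒᵖ ⥤ SSet.{u + 1}} {f g : F ⟶ G}
    (H : F ⋙ tensorRight Δ[1] ⟶ G) (h₀ : ∀ Y, SSet.ι₀ ≫ H.app Y = f.app Y)
    (h₁ : ∀ Y, SSet.ι₁ ≫ H.app Y = g.app Y) :
    (HoPSh.of k).map f = (HoPSh.of k).map g := by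
  let i₀ : F ⟶ F ⋙ tensorRight Δ[1] :=
    { app _ := SSet.ι₀, naturality _ _ a := (SSet.ι₀_comp (F.map a)).symm }
  let i₁ : F ⟶ F ⋙ tensorRight Δ[1] :=
    { app _ := SSet.ι₁, naturality _ _ a := (SSet.ι₁_comp (F.map a)).symm }
  let pr : F ⋙ tensorRight Δ[1] ⟶ F :=
    { app _ := fst _ _, naturality _ _ a := whiskerRight_fst (F.map a) Δ[1] }
  have : IsIso ((HoPSh.of k).map pr) :=
    Localization.inverts _ (presheafWeakEq k) pr fun _ => weakEq_fst _
  have hi : (HoPSh.of k).map i₀ = (HoPSh.of k).map i₁ := by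
    have h : i₀ ≫ pr = i₁ ≫ pr := NatTrans.ext (funext fun Y =>
      (SSet.ι₀_fst _).trans (SSet.ι₁_fst (F.obj Y)).symm)
    rw [← cancel_mono ((HoPSh.of k).map pr), ← Functor.map_comp, ← Functor.map_comp, h]
  have hf : i₀ ≫ H = f := NatTrans.ext (funext h₀)
  have hg : i₁ ≫ H = g := NatTrans.ext (funext h₁)
  rw [← hf, ← hg, Functor.map_comp, Functor.map_comp, hi]

/-- A homotopy between maps of presheaves of pointed simplicial sets. -/
structure PointedHomotopy {B B' : (Sm k)ᵒᵖ ⥤ PSSet.{u + 1}} (f g : B ⟶ B') where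
  app (Y : (Sm k)ᵒᵖ) : PSSet.Homotopy (f.app Y) (g.app Y)
  naturality {Y Y' : (Sm k)ᵒᵖ} (a : Y ⟶ Y') :
    PSSet.forget.map (B.map a) ▷ Δ[1] ≫ (app Y').h = (app Y).h ≫ PSSet.forget.map (B'.map a)

lemma PointedHomotopy.map_loopSpace_eq {B B' : (Sm k)ᵒᵖ ⥤ PSSet.{u + 1}} {f g : B ⟶ B'}
    (H : PointedHomotopy f g) :
    (HoPSh.of k).map (Functor.whiskerRight f PSSet.loopSpace) =
      (HoPSh.of k).map (Functor.whiskerRight g PSSet.loopSpace) :=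
  map_eq_map_of_homotopy
    { app Y := (H.app Y).loopHomotopy
      naturality Y Y' a := by
        ext m z
        exact Subtype.ext (PSSet.loopHomotopyApp_naturality _ _ (H.naturality a) z.1.1 _) }
    (fun Y => (H.app Y).ι₀_loopHomotopy) fun Y => (H.app Y).ι₁_loopHomotopy

end FlfCor

/-! ### Deformations over neighbourhoods of `Y × {0, 1}` -/

namespace FlfCor

variable {k : Type u} [Field k]

namespace Sm.Nbhd

/-- The intersection of two neighbourhoods. -/
def inter {Y : Sm k} (U V : Nbhd Y) : Nbhd Y where
  U := U.U ⊓ V.U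
  zero_mem y := ⟨U.zero_mem y, V.zero_mem y⟩
  one_mem y := ⟨U.one_mem y, V.one_mem y⟩

/-- The neighbourhood `Y × 𝔸¹`. -/
def top (Y : Sm k) : Nbhd Y where
  U := ⊤
  zero_mem _ := trivial
  one_mem _ := trivial

instance (Y : Sm k) : SemilatticeInf (Nbhd Y) where
  inf := inter
  inf_le_left _ _ _ h := h.1
  inf_le_right _ _ _ h := h.2
  le_inf _ _ _ hV hW _ h := ⟨hV h, hW h⟩

instance (Y : Sm k) : OrderTop (Nbhd Y) where
  top := top Y
  le_top _ _ _ := trivial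

end Sm.Nbhd

open Sm

section C1

variable (F : (Sm k)ᵒᵖ ⥤ SSet.{u + 1}) {Y' Y : Sm k} (g : Y' ⟶ Y) (U : Nbhd Y)

/-- The structure map `F(U) ⟶ (Ĉ₁ F)(Y)`: this is `C1ι`, with target a value of `C1 F`. -/
def toC1 : F.obj (op U.toSm) ⟶ (C1 F).obj (op Y) := C1ι F U

lemma incl_toC1 {U V : Nbhd Y} (h : V ≤ U) : F.map (Nbhd.incl h).op ≫ toC1 F V = toC1 F U := by
  have := map_C1ι F h (𝟙 _) (Nbhd.incl h) (Category.comp_id _)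
  rw [op_id, CategoryTheory.Functor.map_id, Category.id_comp] at this
  exact this.symm

lemma toC1_map : toC1 F U ≫ (C1 F).map g.op =
    F.map (Nbhd.preimageHom g U).op ≫ toC1 F (U.preimage g) :=
  C1ι_desc F _ _ U

lemma toC1_evalZero : toC1 F U ≫ (evalZero F).app (op Y) = F.map U.zeroLift.op :=
  C1ι_desc F _ _ U

lemma toC1_evalOne : toC1 F U ≫ (evalOne F).app (op Y) = F.map U.oneLift.op :=
  C1ι_desc F _ _ U

end C1

/-- A partially defined deformation, along the coordinate of `𝔸¹`, of a presheaf `B` from the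
identity to a self-map `r`: over a neighbourhood `U` of `Y × {0, 1}` it is a map `T Y U ⟶ B(U)`
defined on an approximation `i : T Y U ⟶ B(Y)` of `B(Y)`. -/
structure RationalDeformation {C : Type*} [Category* C] (B : (Sm k)ᵒᵖ ⥤ C) (r : B ⟶ B) where
  T (Y : Sm k) : (Nbhd Y)ᵒᵖ ⥤ C
  i {Y : Sm k} (U : Nbhd Y) : (T Y).obj (op U) ⟶ B.obj (op Y)
  map_i {Y : Sm k} {V U : Nbhd Y} (h : V ≤ U) : (T Y).map (homOfLE h).op ≫ i V = i U
  s {Y : Sm k} (U : Nbhd Y) : (T Y).obj (op U) ⟶ B.obj (op U.toSm)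
  map_s {Y : Sm k} {V U : Nbhd Y} (h : V ≤ U) :
    (T Y).map (homOfLE h).op ≫ s V = s U ≫ B.map (Nbhd.incl h).op
  base {Y' Y : Sm k} (g : Y' ⟶ Y) (U : Nbhd Y) :
    (T Y).obj (op U) ⟶ (T Y').obj (op (U.preimage g))
  base_i {Y' Y : Sm k} (g : Y' ⟶ Y) (U : Nbhd Y) : base g U ≫ i (U.preimage g) = i U ≫ B.map g.op
  base_s {Y' Y : Sm k} (g : Y' ⟶ Y) (U : Nbhd Y) :
    base g U ≫ s (U.preimage g) = s U ≫ B.map (Nbhd.preimageHom g U).op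
  s_zero {Y : Sm k} (U : Nbhd Y) : s U ≫ B.map U.zeroLift.op = i U
  s_one {Y : Sm k} (U : Nbhd Y) : s U ≫ B.map U.oneLift.op = i U ≫ r.app (op Y)

namespace RationalDeformation

section Map

variable {C C' : Type*} [Category* C] [Category* C'] {B : (Sm k)ᵒᵖ ⥤ C} {r : B ⟶ B}
  (D : RationalDeformation B r)

/-- The cocone formed by the approximations of `B(Y)`. -/
def cocone (Y : Sm k) : Cocone (D.T Y) where
  pt := B.obj (op Y)
  ι.app U := D.i U.unop
  ι.naturality _ _ f := (D.map_i (leOfHom f.unop)).trans (Category.comp_id _).symm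

/-- The image of a deformation under a functor. -/
def map (G : C ⥤ C') : RationalDeformation (B ⋙ G) (Functor.whiskerRight r G) where
  T Y := D.T Y ⋙ G
  i U := G.map (D.i U)
  map_i h := (G.map_comp _ _).symm.trans (congrArg G.map (D.map_i h))
  s U := G.map (D.s U)
  map_s h := (G.map_comp _ _).symm.trans ((congrArg G.map (D.map_s h)).trans (G.map_comp _ _))
  base g U := G.map (D.base g U)
  base_i g U := (G.map_comp _ _).symm.trans ((congrArg G.map (D.base_i g U)).trans (G.map_comp _ _))
  base_s g U := (G.map_comp _ _).symm.trans ((congrArg G.map (D.base_s g U)).trans (G.map_comp _ _))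
  s_zero U := (G.map_comp _ _).symm.trans (congrArg G.map (D.s_zero U))
  s_one U := (G.map_comp _ _).symm.trans ((congrArg G.map (D.s_one U)).trans (G.map_comp _ _))

end Map

variable {F : (Sm k)ᵒᵖ ⥤ SSet.{u + 1}} {r : F ⟶ F} (D : RationalDeformation F r)

/-- The deformations over all neighbourhoods, as a cocone with values in `Ĉ₁ F`. -/
def coconeC1 (Y : Sm k) : Cocone (D.T Y) where
  pt := (C1 F).obj (op Y)
  ι.app U := D.s U.unop ≫ toC1 F U.unop
  ι.naturality U V f := by
    have h := incl_toC1 F (leOfHom f.unop)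
    change (D.T Y).map (homOfLE (leOfHom f.unop)).op ≫ D.s V.unop ≫ toC1 F V.unop = _ ≫ 𝟙 _
    rw [reassoc_of% D.map_s (leOfHom f.unop), h, Category.comp_id]

variable (hD : ∀ Y, IsColimit (D.cocone Y))

/-- The map to `Ĉ₁ F` glued from the deformations over all neighbourhoods. -/
def sectionApp (Y : Sm k) : F.obj (op Y) ⟶ (C1 F).obj (op Y) := (hD Y).desc (D.coconeC1 Y)

lemma i_sectionApp {Y : Sm k} (U : Nbhd Y) : D.i U ≫ D.sectionApp hD Y = D.s U ≫ toC1 F U :=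
  (hD Y).fac (D.coconeC1 Y) (op U)

/-- The section of `Ĉ₁ F` given by a deformation whose approximations exhaust `F`. -/
def sectionMap : F ⟶ C1 F where
  app Y := D.sectionApp hD Y.unop
  naturality Y Y' g := (hD Y.unop).hom_ext fun ⟨U⟩ => by
    change D.i U ≫ F.map g.unop.op ≫ D.sectionApp hD Y'.unop =
      D.i U ≫ D.sectionApp hD Y.unop ≫ (C1 F).map g.unop.op
    rw [← reassoc_of% D.base_i g.unop U, i_sectionApp, reassoc_of% D.base_s g.unop U,
      reassoc_of% D.i_sectionApp hD U, toC1_map]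

lemma sectionMap_evalZero : D.sectionMap hD ≫ evalZero F = 𝟙 F := by
  refine NatTrans.ext (funext fun Y => (hD Y.unop).hom_ext fun ⟨U⟩ => ?_)
  change D.i U ≫ D.sectionApp hD Y.unop ≫ (evalZero F).app (op Y.unop) = _
  rw [reassoc_of% D.i_sectionApp hD U, toC1_evalZero]
  exact (D.s_zero U).trans (Category.comp_id _).symm

lemma sectionMap_evalOne : D.sectionMap hD ≫ evalOne F = r := by
  refine NatTrans.ext (funext fun Y => (hD Y.unop).hom_ext fun ⟨U⟩ => ?_)
  change D.i U ≫ D.sectionApp hD Y.unop ≫ (evalOne F).app (op Y.unop) = _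
  rw [reassoc_of% D.i_sectionApp hD U, toC1_evalOne]
  exact D.s_one U

include hD in
lemma rationallyContractible (a : F ⟶ ⊤_ _) (b : ⊤_ _ ⟶ F)
    (hr : (HoPSh.of k).map r = (HoPSh.of k).map (a ≫ b)) : RationallyContractible F := by
  refine ⟨(HoPSh.of k).map (D.sectionMap hD), ?_, (HoPSh.of k).map a, (HoPSh.of k).map b, ?_⟩
  · rw [← Functor.map_comp, D.sectionMap_evalZero hD, CategoryTheory.Functor.map_id]
  · rw [← Functor.map_comp, D.sectionMap_evalOne hD, hr, Functor.map_comp]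

end RationalDeformation

/-- The self-map of a presheaf of pointed spaces that is constant at the base point. -/
def constBasept (B : (Sm k)ᵒᵖ ⥤ PSSet.{u + 1}) : B ⟶ B where
  app Y := { app m := ⟨fun _ => ((B.obj Y).obj m).point, rfl⟩
             naturality _ _ f := Pointed.Hom.ext (funext fun _ =>
               ((B.obj Y).map f).map_point.symm) }
  naturality _ _ g := NatTrans.ext (funext fun m =>
    Pointed.Hom.ext (funext fun _ => ((B.map g).app m).map_point.symm))

/-- The constant loop, as a map from the terminal presheaf. -/
def constLoop (B : (Sm k)ᵒᵖ ⥤ PSSet.{u + 1}) : ⊤_ _ ⟶ B ⋙ PSSet.loopSpace where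
  app Y := { app _ := ↾fun _ => ⟨PSSet.exBasept (B.obj Y) _, rfl, rfl⟩
             naturality _ _ _ := rfl }
  naturality Y Y' g := by
    ext m x
    exact Subtype.ext (PSSet.exBasept_comp (B.map g) _).symm

lemma loopSpace_constBasept (B : (Sm k)ᵒᵖ ⥤ PSSet.{u + 1}) :
    Functor.whiskerRight (constBasept B) PSSet.loopSpace = terminal.from _ ≫ constLoop B := by
  ext Y m γ
  exact Subtype.ext (comp_map_toUnit SSet.toExInf γ.1 (PSSet.basept (B.obj Y) (𝟙_ _)))

lemma RationalDeformation.rationallyContractible_loopSpace {B : (Sm k)ᵒᵖ ⥤ PSSet.{u + 1}}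
    {r : B ⟶ B} (D : RationalDeformation B r)
    (hD : ∀ Y, IsColimit (PSSet.forget.mapCocone (D.cocone Y)))
    (hr : (HoPSh.of k).map (Functor.whiskerRight r PSSet.loopSpace) =
      (HoPSh.of k).map (Functor.whiskerRight (constBasept B) PSSet.loopSpace)) :
    RationallyContractible (B ⋙ PSSet.loopSpace) :=
  (D.map PSSet.loopSpace).rationallyContractible
    (fun Y => isColimitLoopSpace (hD Y)) (terminal.from _) (constLoop B)
    (hr.trans (congrArg _ (loopSpace_constBasept B)))

end FlfCor

/-! ### The deformation of the whiskered multiplicative group -/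

namespace FlfCor

variable {k : Type u} [Field k]

section Gm

open LaurentPolynomial

lemma laurent_hom_ext {R S : Type*} [CommSemiring R] [CommSemiring S] {f g : R[T;T⁻¹] →+* S}
    (h : ∀ r, f (C r) = g (C r)) (hT : f (T 1) = g (T 1)) : f = g := by
  apply IsLocalization.ringHom_ext (Submonoid.powers (Polynomial.X : Polynomial R))
  ext r
  · simpa using h r
  · simpa using hT

/-- The ring homomorphism to the global sections given by a map to an affine scheme. -/
def specSections {W : Scheme.{u}} {R : CommRingCat.{u}} (f : W ⟶ Spec R) : R ⟶ Γ(W, ⊤) :=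
  (Scheme.ΓSpecIso R).inv ≫ f.appTop

lemma specSections_comp_map {W : Scheme.{u}} {R S : CommRingCat.{u}} (f : W ⟶ Spec R) (φ : S ⟶ R) :
    specSections (f ≫ Spec.map φ) = φ ≫ specSections f := by
  rw [specSections, specSections, Scheme.Hom.comp_appTop, Scheme.ΓSpecIso_inv_naturality_assoc]

lemma comp_specSections {W W' : Scheme.{u}} {R : CommRingCat.{u}} (g : W' ⟶ W) (f : W ⟶ Spec R) :
    specSections (g ≫ f) = specSections f ≫ g.appTop := by
  rw [specSections, specSections, Scheme.Hom.comp_appTop, Category.assoc]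

lemma specSections_injective {W : Scheme.{u}} {R : CommRingCat.{u}} :
    Function.Injective (specSections : (W ⟶ Spec R) → _) := fun _ _ h =>
  ext_of_isAffine ((cancel_epi _).1 h)

lemma specSections_toSpecΓ_map {W : Scheme.{u}} {R : CommRingCat.{u}} (φ : R ⟶ Γ(W, ⊤)) :
    specSections (W.toSpecΓ ≫ Spec.map φ) = φ := by
  simp [specSections]

/-- The unit on `W` given by a map `W ⟶ 𝔾_m`. -/
def gmCoord {W : Over (SpecK k)} (f : W ⟶ Gm k) : Γ(W.left, ⊤) :=
  specSections (R := .of k[T;T⁻¹]) f.left (T 1)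

lemma isUnit_gmCoord {W : Over (SpecK k)} (f : W ⟶ Gm k) : IsUnit (gmCoord f) :=
  (isUnit_T 1).map (specSections (R := .of k[T;T⁻¹]) f.left).hom

lemma gmCoord_comp {W W' : Over (SpecK k)} (g : W' ⟶ W) (f : W ⟶ Gm k) :
    gmCoord (g ≫ f) = g.left.appTop (gmCoord f) :=
  ConcreteCategory.congr_hom (comp_specSections (R := .of k[T;T⁻¹]) g.left f.left) (T 1)

/-- The map `W ⟶ 𝔾_m` given by a unit on `W`. -/
def gmOfUnit {W : Over (SpecK k)} (v : Γ(W.left, ⊤)ˣ) : W ⟶ Gm k :=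
  Over.homMk (W.left.toSpecΓ ≫ Spec.map (CommRingCat.ofHom (eval₂
    (specSections (R := .of k) W.hom).hom v))) (by
    apply specSections_injective
    refine (specSections_comp_map _ _).trans ?_
    refine (congrArg (_ ≫ ·) (specSections_toSpecΓ_map _)).trans ?_
    ext r
    exact eval₂_C _ _ r)

lemma gmCoord_gmOfUnit {W : Over (SpecK k)} (v : Γ(W.left, ⊤)ˣ) : gmCoord (gmOfUnit v) = v := by
  have h : specSections (R := .of k[T;T⁻¹]) (gmOfUnit v).left =
      CommRingCat.ofHom (eval₂ (specSections (R := .of k) W.hom).hom v) :=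
    specSections_toSpecΓ_map _
  calc gmCoord (gmOfUnit v) = eval₂ (specSections (R := .of k) W.hom).hom v (T 1) :=
        ConcreteCategory.congr_hom h (T 1)
    _ = v := by rw [eval₂_T, zpow_one]

lemma gm_hom_ext {W : Over (SpecK k)} {f g : W ⟶ Gm k} (h : gmCoord f = gmCoord g) : f = g := by
  ext1
  apply specSections_injective
  ext1
  refine laurent_hom_ext (fun r => ?_) h
  have hw (f : W ⟶ Gm k) := ConcreteCategory.congr_hom ((specSections_comp_map (R := .of k[T;T⁻¹])
    (S := .of k) f.left _).symm.trans (congrArg specSections (Over.w f))) r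
  exact (hw f).trans (hw g).symm

lemma gmCoord_one {W : Over (SpecK k)} (a : W ⟶ Over.mk (𝟙 (SpecK k))) :
    gmCoord (a ≫ Gm.one k) = 1 :=
  calc gmCoord (a ≫ Gm.one k)
      = specSections (R := .of k) a.left (eval₂ (RingHom.id k) 1 (T 1)) :=
        ConcreteCategory.congr_hom (specSections_comp_map (R := .of k) (S := .of k[T;T⁻¹]) a.left
          (CommRingCat.ofHom (eval₂ (RingHom.id k) 1))) (T 1)
    _ = 1 := by rw [eval₂_T, one_zpow, Units.val_one, map_one]

instance : Mono (Gm.one k).left := by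
  have h : (Gm.one k).left ≫ (Gm k).hom = 𝟙 _ := Over.w (Gm.one k)
  have : Mono ((Gm.one k).left ≫ (Gm k).hom) := by rw [h]; infer_instance
  exact mono_of_mono _ (Gm k).hom

end Gm

section Opens

variable {W Z : Over (SpecK k)}

/-- An open subscheme of a `k`-scheme, as a `k`-scheme. -/
abbrev overOpen (V : W.left.Opens) : Over (SpecK k) := Over.mk (V.ι ≫ W.hom)

/-- The inclusion of an open subscheme, as a map of `k`-schemes. -/
abbrev overOpenι (V : W.left.Opens) : overOpen V ⟶ W := Over.homMk V.ι rfl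

lemma overOpen_hom_ext {I : Type*} {V : I → W.left.Opens} (hV : TopologicalSpace.IsOpenCover V)
    {f g : W ⟶ Z} (h : ∀ i, overOpenι (V i) ≫ f = overOpenι (V i) ≫ g) : f = g := by
  ext1
  refine Scheme.hom_ext_of_forall _ _ fun z => ?_
  obtain ⟨i, hi⟩ := hV.exists_mem z
  exact ⟨V i, hi, congrArg Over.Hom.left (h i)⟩

lemma exists_overOpen_glue {I : Type} {V : I → W.left.Opens} (hV : TopologicalSpace.IsOpenCover V)
    (f : ∀ i, overOpen (V i) ⟶ Z)
    (hf : ∀ (i j : I) {P : Over (SpecK k)} (a : P ⟶ overOpen (V i)) (b : P ⟶ overOpen (V j)),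
      a ≫ overOpenι (V i) = b ≫ overOpenι (V j) → a ≫ f i = b ≫ f j) :
    ∃ h : W ⟶ Z, ∀ i, overOpenι (V i) ≫ h = f i := by
  let 𝒰 := W.left.openCoverOfIsOpenCover V hV
  have hglue (i j : I) : pullback.fst (V i).ι (V j).ι ≫ (f i).left =
      pullback.snd (V i).ι (V j).ι ≫ (f j).left := by
    let a : Over.mk (pullback.fst (V i).ι (V j).ι ≫ (V i).ι ≫ W.hom) ⟶ overOpen (V i) :=
      Over.homMk (pullback.fst _ _) rfl
    let b : Over.mk (pullback.fst (V i).ι (V j).ι ≫ (V i).ι ≫ W.hom) ⟶ overOpen (V j) :=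
      Over.homMk (pullback.snd _ _) (pullback.condition_assoc _).symm
    exact congrArg Over.Hom.left (hf i j a b (by ext1; exact pullback.condition))
  have hι (i : I) : (V i).ι ≫ 𝒰.glueMorphisms (fun i => (f i).left) hglue = (f i).left :=
    𝒰.ι_glueMorphisms _ hglue i
  refine ⟨Over.homMk (𝒰.glueMorphisms (fun i => (f i).left) hglue) ?_, fun i => by ext1; exact hι i⟩
  refine 𝒰.hom_ext _ _ fun i => ?_
  exact ((reassoc_of% (hι i)) Z.hom).trans (Over.w (f i))

end Opens

section Coproducts

variable {I : Type} {X : I → Over (SpecK k)}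

/-- The index of the summand of a coproduct of schemes that contains a given point. -/
def sigmaIndex (x : (sigmaOver X).left) : I :=
  ((sigmaOpenCover fun i => (X i).left).exists_eq x).choose

lemma sigmaIndex_ι (i : I) (y : (X i).left) : sigmaIndex ((sigmaOverι X i).left y) = i := by
  obtain ⟨z, hz⟩ := ((sigmaOpenCover fun i => (X i).left).exists_eq
    ((sigmaOverι X i).left y)).choose_spec
  exact congrArg Sigma.fst ((sigmaι_eq_iff (fun i => (X i).left) _ _ _ _).1 hz)

lemma mem_opensRange_sigmaOverι {x : (sigmaOver X).left} {i : I} :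
    x ∈ (sigmaOverι X i).left.opensRange ↔ sigmaIndex x = i := by
  constructor
  · rintro ⟨y, rfl⟩
    exact sigmaIndex_ι i y
  · rintro rfl
    exact ((sigmaOpenCover fun i => (X i).left).exists_eq x).choose_spec

lemma sigmaIndex_comp_ι {W : Over (SpecK k)} {i : I} (f : W ⟶ X i) (z : W.left) :
    sigmaIndex ((f ≫ sigmaOverι X i).left z) = i := by
  rw [Over.comp_left, Scheme.Hom.comp_apply, sigmaIndex_ι]

lemma exists_comp_sigmaOverι_eq {W : Over (SpecK k)} (f : W ⟶ sigmaOver X) {i : I}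
    (hf : ∀ z, sigmaIndex (f.left z) = i) : ∃ g : W ⟶ X i, g ≫ sigmaOverι X i = f := by
  have hr : Set.range f.left ⊆ Set.range (sigmaOverι X i).left := by
    rintro _ ⟨z, rfl⟩
    exact mem_opensRange_sigmaOverι.2 (hf z)
  have hg := IsOpenImmersion.lift_fac (sigmaOverι X i).left f.left hr
  refine ⟨Over.homMk (IsOpenImmersion.lift _ _ hr) ?_, by ext1; exact hg⟩
  rw [← Over.w (sigmaOverι X i), ← Category.assoc, hg, Over.w]

/-- The preimage of a summand under a map to a coproduct. -/
def sigmaPreimage {W : Over (SpecK k)} (f : W ⟶ sigmaOver X) (i : I) : W.left.Opens :=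
  f.left ⁻¹ᵁ (sigmaOverι X i).left.opensRange

lemma isOpenCover_sigmaPreimage {W : Over (SpecK k)} (f : W ⟶ sigmaOver X) :
    TopologicalSpace.IsOpenCover (sigmaPreimage f) := by
  rw [TopologicalSpace.IsOpenCover, eq_top_iff]
  exact fun z _ => TopologicalSpace.Opens.mem_iSup.2
    ⟨sigmaIndex (f.left z), mem_opensRange_sigmaOverι.2 rfl⟩

lemma sigmaIndex_overOpenι_comp {W : Over (SpecK k)} (f : W ⟶ sigmaOver X) (i : I)
    (y : (overOpen (sigmaPreimage f i)).left) :
    sigmaIndex ((overOpenι (sigmaPreimage f i) ≫ f).left y) = i :=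
  mem_opensRange_sigmaOverι.1 y.2

/-- Two maps to a coproduct take values in the same summands. -/
def SameSummand {W : Over (SpecK k)} (f g : W ⟶ sigmaOver X) : Prop :=
  ∀ z, sigmaIndex (f.left z) = sigmaIndex (g.left z)

namespace SameSummand

variable {W Z : Over (SpecK k)} {f g h : W ⟶ sigmaOver X}

lemma symm (hfg : SameSummand f g) : SameSummand g f := fun z => (hfg z).symm

lemma trans (hfg : SameSummand f g) (hgh : SameSummand g h) : SameSummand f h := fun z =>
  (hfg z).trans (hgh z)

lemma precomp (hfg : SameSummand f g) {W' : Over (SpecK k)} (a : W' ⟶ W) :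
    SameSummand (a ≫ f) (a ≫ g) := fun z => by
  simpa using hfg (a.left z)

lemma of_comp_ι (i : I) (a b : W ⟶ X i) : SameSummand (a ≫ sigmaOverι X i) (b ≫ sigmaOverι X i) :=
  fun z => (sigmaIndex_comp_ι a z).trans (sigmaIndex_comp_ι b z).symm

lemma of_ι_comp {J : Type} {Y : J → Over (SpecK k)} {f g : sigmaOver Y ⟶ sigmaOver X}
    (h : ∀ j, SameSummand (sigmaOverι Y j ≫ f) (sigmaOverι Y j ≫ g)) :
    SameSummand f g := fun z => by
  obtain ⟨y, hy⟩ := mem_opensRange_sigmaOverι.2 (rfl : sigmaIndex z = _)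
  rw [← hy, ← Scheme.Hom.comp_apply, ← Scheme.Hom.comp_apply]
  exact h _ y

lemma comp {J : Type} {Y : J → Over (SpecK k)} (hfg : SameSummand f g)
    (r : sigmaOver X ⟶ sigmaOver Y)
    (hr : ∀ i, ∃ j, ∃ a : X i ⟶ Y j, sigmaOverι X i ≫ r = a ≫ sigmaOverι Y j) :
    SameSummand (f ≫ r) (g ≫ r) := fun z => by
  choose j a ha using hr
  have hr (x : (sigmaOver X).left) : sigmaIndex (r.left x) = j (sigmaIndex x) := by
    obtain ⟨y, hy⟩ := mem_opensRange_sigmaOverι.2 (rfl : sigmaIndex x = _)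
    rw [← sigmaIndex_comp_ι (a _) y, ← ha, Over.comp_left, Scheme.Hom.comp_apply, hy]
  rw [Over.comp_left, Over.comp_left, Scheme.Hom.comp_apply, Scheme.Hom.comp_apply, hr, hr, hfg z]

lemma hom_ext (hfg : SameSummand f g) (r : sigmaOver X ⟶ Z)
    [∀ i, Mono (sigmaOverι X i ≫ r).left] (h : f ≫ r = g ≫ r) : f = g := by
  refine overOpen_hom_ext (isOpenCover_sigmaPreimage f) fun i => ?_
  have hV := sigmaIndex_overOpenι_comp f i
  obtain ⟨f', hf'⟩ := exists_comp_sigmaOverι_eq _ hV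
  obtain ⟨g', hg'⟩ := exists_comp_sigmaOverι_eq _ fun y => (hfg.precomp _ y).symm.trans (hV y)
  have hfg' : f' = g' := by
    ext1
    rw [← cancel_mono (sigmaOverι X i ≫ r).left, ← Over.comp_left, ← Over.comp_left,
      reassoc_of% hf', reassoc_of% hg', h]
  rw [← hf', ← hg', hfg']

end SameSummand

lemma exists_sameSummand_lift {W Z : Over (SpecK k)} (q : W ⟶ sigmaOver X) (r : sigmaOver X ⟶ Z)
    [∀ i, Mono (sigmaOverι X i ≫ r).left] (v : W ⟶ Z)
    (hv : ∀ (i : I) {W' : Over (SpecK k)} (a : W' ⟶ W) (b : W' ⟶ X i), b ≫ sigmaOverι X i = a ≫ q →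
      ∃ c : W' ⟶ X i, c ≫ sigmaOverι X i ≫ r = a ≫ v) :
    ∃ q' : W ⟶ sigmaOver X, SameSummand q q' ∧ q' ≫ r = v := by
  have hc (i : I) : ∃ c : overOpen (sigmaPreimage q i) ⟶ X i,
      c ≫ sigmaOverι X i ≫ r = overOpenι _ ≫ v := by
    obtain ⟨b, hb⟩ := exists_comp_sigmaOverι_eq _ (sigmaIndex_overOpenι_comp q i)
    exact hv i _ b hb
  choose c hc using hc
  obtain ⟨q', hq'⟩ := exists_overOpen_glue (isOpenCover_sigmaPreimage q)
    (fun i => c i ≫ sigmaOverι X i) fun i j P a b hab => by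
      have hs : SameSummand (a ≫ c i ≫ sigmaOverι X i) (b ≫ c j ≫ sigmaOverι X j) := fun z => by
        rw [← Category.assoc, ← Category.assoc, sigmaIndex_comp_ι, sigmaIndex_comp_ι,
          ← sigmaIndex_overOpenι_comp q i (a.left z), ← sigmaIndex_overOpenι_comp q j (b.left z)]
        exact congrArg (fun f : P ⟶ W => sigmaIndex (q.left (f.left z))) hab
      refine hs.hom_ext r ?_
      rw [Category.assoc, Category.assoc, Category.assoc, Category.assoc, hc, hc,
        reassoc_of% hab]
  refine ⟨q', fun z => ?_, overOpen_hom_ext (isOpenCover_sigmaPreimage q) fun i => ?_⟩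
  · let z' : sigmaPreimage q (sigmaIndex (q.left z)) := ⟨z, mem_opensRange_sigmaOverι.2 rfl⟩
    rw [← sigmaIndex_comp_ι (c _) z', ← hq']
    rfl
  · rw [reassoc_of% hq', hc]

end Coproducts

section Whisker

variable (k) in
/-- The scheme of `m`-simplices of the whiskered multiplicative group. -/
abbrev whiskerSch (m : SimplexCategory) : Over (SpecK k) := sigmaOver (whiskerSummand k m)

variable (k) in
/-- The inclusion of a summand of the whiskered multiplicative group. -/
abbrev whiskerι (m : SimplexCategory) (i : WhiskerIndex m) :
    whiskerSummand k m i ⟶ whiskerSch k m := sigmaOverι (whiskerSummand k m) i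

variable (k) in
/-- The map to `𝔾_m` that contracts the whisker. -/
def whiskerFold (m : SimplexCategory) : whiskerSch k m ⟶ Gm k :=
  sigmaOverDesc fun i => match i with
    | none => 𝟙 _
    | some _ => Gm.one k

variable {m m' : SimplexCategory} {W W' : Over (SpecK k)}

lemma whiskerι_none_fold (m : SimplexCategory) : whiskerι k m none ≫ whiskerFold k m = 𝟙 _ :=
  sigmaOverι_desc _ _ _

lemma whiskerι_some_fold (m : SimplexCategory)
    (σ : { σ : m ⟶ ⦋1⦌ // σ ≠ SimplexCategory.const m ⦋1⦌ 0 }) :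
    whiskerι k m (some σ) ≫ whiskerFold k m = Gm.one k :=
  sigmaOverι_desc _ _ _

lemma whiskerCell_zero (m : SimplexCategory) :
    whiskerCell k m (SimplexCategory.const m ⦋1⦌ 0) = Gm.one k ≫ whiskerι k m none :=
  dif_pos rfl

lemma whiskerCell_fold (σ : m ⟶ ⦋1⦌) : whiskerCell k m σ ≫ whiskerFold k m = Gm.one k := by
  by_cases h : σ = SimplexCategory.const m ⦋1⦌ 0
  · rw [h, whiskerCell_zero, Category.assoc, whiskerι_none_fold]
    exact Category.comp_id _
  · rw [whiskerCell_of_ne k σ h, whiskerι_some_fold]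

lemma whisker_hom_ext {f g : whiskerSch k m ⟶ W} (h : whiskerι k m none ≫ f = whiskerι k m none ≫ g)
    (h' : ∀ σ, whiskerCell k m σ ≫ f = whiskerCell k m σ ≫ g) : f = g := by
  refine sigmaOver_hom_ext fun i => ?_
  obtain _ | σ := i
  · exact h
  · rw [← whiskerCell_of_ne k σ.1 σ.2]
    exact h' σ.1

lemma whiskerMap_fold (φ : m' ⟶ m) : whiskerMap k φ ≫ whiskerFold k m' = whiskerFold k m := by
  refine whisker_hom_ext ?_ fun σ => ?_
  · rw [← Category.assoc, whiskerι_none_map, whiskerι_none_fold, whiskerι_none_fold]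
  · rw [← Category.assoc, whiskerCell_map, whiskerCell_fold, whiskerCell_fold]

instance (m : SimplexCategory) (i : WhiskerIndex m) :
    Mono (whiskerι k m i ≫ whiskerFold k m).left := by
  obtain _ | σ := i
  · rw [whiskerι_none_fold]
    infer_instance
  · rw [whiskerι_some_fold]
    infer_instance

lemma exists_whiskerCell_eq (σ : m ⟶ ⦋1⦌) :
    ∃ i, ∃ a : Over.mk (𝟙 (SpecK k)) ⟶ whiskerSummand k m i,
      whiskerCell k m σ = a ≫ whiskerι k m i := by
  by_cases h : σ = SimplexCategory.const m ⦋1⦌ 0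
  · exact ⟨none, Gm.one k, by rw [h, whiskerCell_zero]⟩
  · exact ⟨some ⟨σ, h⟩, 𝟙 _, (whiskerCell_of_ne k σ h).trans (Category.id_comp _).symm⟩

lemma SameSummand.comp_whiskerMap {f g : W ⟶ whiskerSch k m} (h : SameSummand f g) (φ : m' ⟶ m) :
    SameSummand (f ≫ whiskerMap k φ) (g ≫ whiskerMap k φ) := by
  refine h.comp _ fun i => ?_
  obtain _ | σ := i
  · exact ⟨none, 𝟙 _, (whiskerι_none_map k φ).trans (Category.id_comp _).symm⟩
  · rw [whiskerι_some_map]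
    exact exists_whiskerCell_eq _

section Deformation

/-- The function `(1 - t) x + t`, where `x` is the function given by the map to `𝔾_m`. -/
def deformCoord (q : W ⟶ whiskerSch k m) (t : Γ(W.left, ⊤)) : Γ(W.left, ⊤) :=
  (1 - t) * gmCoord (q ≫ whiskerFold k m) + t

lemma deformCoord_comp (g : W' ⟶ W) (q : W ⟶ whiskerSch k m) (t : Γ(W.left, ⊤)) :
    deformCoord (g ≫ q) (g.left.appTop t) = g.left.appTop (deformCoord q t) := by
  simp [deformCoord, gmCoord_comp]

lemma isUnit_deformCoord_comp (g : W' ⟶ W) {q : W ⟶ whiskerSch k m} {t : Γ(W.left, ⊤)}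
    (ht : IsUnit (deformCoord q t)) : IsUnit (deformCoord (g ≫ q) (g.left.appTop t)) := by
  rw [deformCoord_comp]
  exact ht.map g.left.appTop.hom

lemma deformCoord_zero (q : W ⟶ whiskerSch k m) :
    deformCoord q 0 = gmCoord (q ≫ whiskerFold k m) := by
  simp [deformCoord]

lemma deformCoord_one (q : W ⟶ whiskerSch k m) : deformCoord q 1 = 1 := by
  simp [deformCoord]

lemma deformCoord_whiskerMap (φ : m' ⟶ m) (q : W ⟶ whiskerSch k m) (t : Γ(W.left, ⊤)) :
    deformCoord (q ≫ whiskerMap k φ) t = deformCoord q t := by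
  rw [deformCoord, deformCoord, Category.assoc, whiskerMap_fold]

lemma deformCoord_comp_whiskerι_some {σ : { σ : m ⟶ ⦋1⦌ // σ ≠ SimplexCategory.const m ⦋1⦌ 0 }}
    (b : W ⟶ Over.mk (𝟙 (SpecK k))) (t : Γ(W.left, ⊤)) :
    deformCoord (b ≫ whiskerι k m (some σ)) t = 1 := by
  rw [deformCoord, Category.assoc, whiskerι_some_fold, gmCoord_one]
  ring

lemma exists_deform (q : W ⟶ whiskerSch k m) (t : Γ(W.left, ⊤)) (ht : IsUnit (deformCoord q t)) :
    ∃ q' : W ⟶ whiskerSch k m, SameSummand q q' ∧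
      gmCoord (q' ≫ whiskerFold k m) = deformCoord q t := by
  have hv : gmCoord (gmOfUnit ht.unit) = deformCoord q t := gmCoord_gmOfUnit _
  obtain ⟨q', h, h'⟩ := exists_sameSummand_lift q (whiskerFold k m) (gmOfUnit ht.unit)
    fun i W' a b hb => by
      obtain _ | σ := i
      · refine ⟨a ≫ gmOfUnit ht.unit, ?_⟩
        rw [whiskerι_none_fold]
        exact Category.comp_id _
      · refine ⟨b, gm_hom_ext ?_⟩
        rw [whiskerι_some_fold, gmCoord_one, gmCoord_comp, hv, ← deformCoord_comp, ← hb,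
          deformCoord_comp_whiskerι_some]
  exact ⟨q', h, by rw [h', hv]⟩

/-- The map to the whiskered multiplicative group that is given by `(1 - t) x + t` on the summand
`𝔾_m`. -/
def deformMap (q : W ⟶ whiskerSch k m) (t : Γ(W.left, ⊤)) (ht : IsUnit (deformCoord q t)) :
    W ⟶ whiskerSch k m :=
  (exists_deform q t ht).choose

lemma sameSummand_deformMap (q : W ⟶ whiskerSch k m) (t : Γ(W.left, ⊤))
    (ht : IsUnit (deformCoord q t)) : SameSummand q (deformMap q t ht) :=
  (exists_deform q t ht).choose_spec.1

lemma gmCoord_deformMap (q : W ⟶ whiskerSch k m) (t : Γ(W.left, ⊤))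
    (ht : IsUnit (deformCoord q t)) :
    gmCoord (deformMap q t ht ≫ whiskerFold k m) = deformCoord q t :=
  (exists_deform q t ht).choose_spec.2

lemma deformMap_eq {q q' : W ⟶ whiskerSch k m} {t : Γ(W.left, ⊤)} (ht : IsUnit (deformCoord q t))
    (h : SameSummand q q') (h' : gmCoord (q' ≫ whiskerFold k m) = deformCoord q t) :
    deformMap q t ht = q' :=
  ((sameSummand_deformMap q t ht).symm.trans h).hom_ext (whiskerFold k m)
    (gm_hom_ext ((gmCoord_deformMap q t ht).trans h'.symm))

lemma comp_deformMap (g : W' ⟶ W) (q : W ⟶ whiskerSch k m) (t : Γ(W.left, ⊤))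
    (ht : IsUnit (deformCoord q t)) :
    g ≫ deformMap q t ht =
      deformMap (g ≫ q) (g.left.appTop t) (isUnit_deformCoord_comp g ht) := by
  refine (deformMap_eq _ ((sameSummand_deformMap q t ht).precomp g) ?_).symm
  rw [Category.assoc, gmCoord_comp, gmCoord_deformMap, deformCoord_comp]

lemma deformMap_whiskerMap (φ : m' ⟶ m) (q : W ⟶ whiskerSch k m) (t : Γ(W.left, ⊤))
    (ht : IsUnit (deformCoord q t)) (ht' : IsUnit (deformCoord (q ≫ whiskerMap k φ) t)) :
    deformMap (q ≫ whiskerMap k φ) t ht' = deformMap q t ht ≫ whiskerMap k φ := by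
  refine deformMap_eq ht' ((sameSummand_deformMap q t ht).comp_whiskerMap φ) ?_
  rw [Category.assoc, whiskerMap_fold, gmCoord_deformMap, deformCoord_whiskerMap]

lemma deformMap_zero (q : W ⟶ whiskerSch k m) (ht : IsUnit (deformCoord q 0)) :
    deformMap q 0 ht = q :=
  deformMap_eq ht (fun _ => rfl) (deformCoord_zero q).symm

end Deformation

section Contraction

/-- The maximum of two maps to `⦋1⦌`. -/
def cellSup (σ τ : m ⟶ ⦋1⦌) : m ⟶ ⦋1⦌ :=
  SimplexCategory.mkHom (σ.toOrderHom ⊔ τ.toOrderHom)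

lemma comp_cellSup (φ : m' ⟶ m) (σ τ : m ⟶ ⦋1⦌) :
    φ ≫ cellSup σ τ = cellSup (φ ≫ σ) (φ ≫ τ) := rfl

lemma cellSup_zero (σ : m ⟶ ⦋1⦌) : cellSup σ (SimplexCategory.const m ⦋1⦌ 0) = σ := by
  ext i : 3
  exact max_eq_left (Fin.zero_le (σ.toOrderHom i))

lemma zero_cellSup (τ : m ⟶ ⦋1⦌) : cellSup (SimplexCategory.const m ⦋1⦌ 0) τ = τ := by
  ext i : 3
  exact max_eq_right (Fin.zero_le (τ.toOrderHom i))

lemma cellSup_one (σ : m ⟶ ⦋1⦌) :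
    cellSup σ (SimplexCategory.const m ⦋1⦌ 1) = SimplexCategory.const m ⦋1⦌ 1 := by
  ext i : 3
  exact max_eq_right (Fin.le_last (n := 1) (σ.toOrderHom i))

lemma one_cellSup (τ : m ⟶ ⦋1⦌) :
    cellSup (SimplexCategory.const m ⦋1⦌ 1) τ = SimplexCategory.const m ⦋1⦌ 1 := by
  ext i : 3
  exact max_eq_left (Fin.le_last (n := 1) (τ.toOrderHom i))

/-- The homotopy, parametrized by the simplices of `Δ[1]`, that first collapses `𝔾_m` to its unit
and then slides it along the whisker to the base point. -/
def whiskerContract (τ : m ⟶ ⦋1⦌) : whiskerSch k m ⟶ whiskerSch k m :=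
  sigmaOverDesc fun i => match i with
    | none => Over.mkIdTerminal.from (Gm k) ≫ whiskerCell k m τ
    | some σ => whiskerCell k m (cellSup σ.1 τ)

lemma whiskerι_none_contract (τ : m ⟶ ⦋1⦌) :
    whiskerι k m none ≫ whiskerContract τ = Over.mkIdTerminal.from (Gm k) ≫ whiskerCell k m τ :=
  sigmaOverι_desc _ _ _

lemma whiskerCell_contract (σ τ : m ⟶ ⦋1⦌) :
    whiskerCell k m σ ≫ whiskerContract τ = whiskerCell k m (cellSup σ τ) := by
  by_cases h : σ = SimplexCategory.const m ⦋1⦌ 0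
  · rw [h, whiskerCell_zero, Category.assoc, whiskerι_none_contract, zero_cellSup, ← Category.assoc,
      Over.mkIdTerminal.hom_ext (_ ≫ _) (𝟙 _), Category.id_comp]
  · rw [whiskerCell_of_ne k σ h]
    exact sigmaOverι_desc _ _ _

lemma whiskerContract_map (φ : m' ⟶ m) (τ : m ⟶ ⦋1⦌) :
    whiskerContract τ ≫ whiskerMap k φ = whiskerMap k φ ≫ whiskerContract (φ ≫ τ) := by
  refine whisker_hom_ext ?_ fun σ => ?_ <;> rw [← Category.assoc, ← Category.assoc]
  · rw [whiskerι_none_contract, whiskerι_none_map, whiskerι_none_contract, Category.assoc,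
      whiskerCell_map]
  · rw [whiskerCell_contract, whiskerCell_map, whiskerCell_map, whiskerCell_contract,
      comp_cellSup]

lemma whiskerContract_one (m : SimplexCategory) :
    whiskerContract (SimplexCategory.const m ⦋1⦌ 1) =
      Over.mkIdTerminal.from _ ≫ whiskerCell k m (SimplexCategory.const m ⦋1⦌ 1) := by
  refine whisker_hom_ext ?_ fun σ => ?_ <;> rw [← Category.assoc, IsTerminal.comp_from]
  · rw [whiskerι_none_contract]
  · rw [whiskerCell_contract, cellSup_one, IsTerminal.from_self, Category.id_comp]

lemma whiskerContract_fold (τ : m ⟶ ⦋1⦌) :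
    whiskerContract τ ≫ whiskerFold k m = Over.mkIdTerminal.from _ ≫ Gm.one k := by
  refine whisker_hom_ext ?_ fun σ => ?_ <;>
    rw [← Category.assoc, ← Category.assoc, IsTerminal.comp_from]
  · rw [whiskerι_none_contract, Category.assoc, whiskerCell_fold]
  · rw [whiskerCell_contract, whiskerCell_fold, IsTerminal.from_self, Category.id_comp]

lemma sameSummand_whiskerContract (m : SimplexCategory) :
    SameSummand (𝟙 _) (whiskerContract (k := k) (SimplexCategory.const m ⦋1⦌ 0)) := by
  refine SameSummand.of_ι_comp fun i => ?_
  rw [Category.comp_id]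
  obtain _ | σ := i
  · rw [whiskerι_none_contract, whiskerCell_zero, ← Category.assoc]
    exact SameSummand.of_comp_ι none (𝟙 _) _
  · rw [← whiskerCell_of_ne k σ.1 σ.2, whiskerCell_contract, cellSup_zero]
    exact fun _ => rfl

-- At time `1` the deformation collapses `𝔾_m` to its unit, which is where the contraction of the
-- whisker starts.
lemma deformMap_one (q : W ⟶ whiskerSch k m) (ht : IsUnit (deformCoord q 1)) :
    deformMap q 1 ht = q ≫ whiskerContract (SimplexCategory.const m ⦋1⦌ 0) := by
  refine deformMap_eq ht ?_ ?_
  · simpa only [Category.comp_id] using (sameSummand_whiskerContract m).precomp q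
  · rw [Category.assoc, whiskerContract_fold, ← Category.assoc, gmCoord_one, deformCoord_one]

end Contraction

end Whisker

end FlfCor

/-! ### The deformation of spans -/

namespace FlfCor

variable {k : Type u} [Field k]

namespace FlfSpan

variable {D : Type (u + 1)} [Category.{u} D] {j : D ⥤ Over (SpecK k)} {ι : Type} [Finite ι]
  {P P' P'' : ι → PtdSch k}

/-- Replace the right leg of a span. -/
abbrev withLeg (α : FlfSpan j P) (q' : ∀ i, α.Z ⟶ (Functor.const D).obj (P' i).X) :
    FlfSpan j P' :=
  { α with q := q' }

/-- Right legs for a diagram of spans that are compatible with the morphisms of spans and have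
smaller support. -/
structure IsLeg {C : Type*} [Category* C] (x : C ⥤ FlfSpan j P)
    (q' : ∀ c i, (x.obj c).Z ⟶ (Functor.const D).obj (P' i).X) : Prop where
  support_le (c : C) (T : D) : ((x.obj c).withLeg (q' c)).support T ≤ (x.obj c).support T
  comp {c d : C} (φ : c ⟶ d) (i : ι) :
    (x.map φ).iso.hom ≫ (x.obj d).ιN ≫ q' d i = (x.obj c).ιN ≫ q' c i

namespace IsLeg

variable {C : Type*} [Category* C] {x : C ⥤ FlfSpan j P}
  {q' : ∀ c i, (x.obj c).Z ⟶ (Functor.const D).obj (P' i).X} (h : IsLeg x q')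

/-- The inclusion of the support with respect to the new leg. -/
def incl (c : C) : ((x.obj c).withLeg (q' c)).N ⟶ (x.obj c).N :=
  (x.obj c).liftN ((x.obj c).withLeg (q' c)).ιN fun T z =>
    h.support_le c T (((x.obj c).withLeg (q' c)).ιN_mem T z)

lemma incl_ιN (c : C) : h.incl c ≫ (x.obj c).ιN = ((x.obj c).withLeg (q' c)).ιN :=
  (x.obj c).liftN_ιN _ _

lemma incl_ιN_assoc (c : C) {M : D ⥤ Over (SpecK k)} (a : (x.obj c).Z ⟶ M) :
    h.incl c ≫ (x.obj c).ιN ≫ a = ((x.obj c).withLeg (q' c)).ιN ≫ a :=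
  (x.obj c).liftN_ιN_assoc _ _ _

lemma incl_cancel {c : C} {M : D ⥤ Over (SpecK k)} {a b : M ⟶ ((x.obj c).withLeg (q' c)).N}
    (hab : a ≫ h.incl c = b ≫ h.incl c) : a = b := by
  have : Mono ((x.obj c).withLeg (q' c)).ιN := inferInstance
  rw [← cancel_mono ((x.obj c).withLeg (q' c)).ιN, ← h.incl_ιN, reassoc_of% hab]

/-- The restriction to the new supports of a map of supports that is compatible with the new
legs. -/
def restrict {c d : C} (a : (x.obj c).N ⟶ (x.obj d).N)
    (ha : ∀ i, a ≫ (x.obj d).ιN ≫ q' d i = (x.obj c).ιN ≫ q' c i) :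
    ((x.obj c).withLeg (q' c)).N ⟶ ((x.obj d).withLeg (q' d)).N :=
  ((x.obj d).withLeg (q' d)).liftN (h.incl c ≫ a ≫ (x.obj d).ιN)
    (mem_support _ fun i => by
      change (h.incl c ≫ a ≫ (x.obj d).ιN) ≫ q' d i = ((x.obj c).withLeg (q' c)).ιN ≫ q' c i
      rw [Category.assoc, Category.assoc, ha, incl_ιN_assoc])

lemma restrict_ιN {c d : C} (a : (x.obj c).N ⟶ (x.obj d).N)
    (ha : ∀ i, a ≫ (x.obj d).ιN ≫ q' d i = (x.obj c).ιN ≫ q' c i) :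
    h.restrict a ha ≫ ((x.obj d).withLeg (q' d)).ιN = h.incl c ≫ a ≫ (x.obj d).ιN :=
  ((x.obj d).withLeg (q' d)).liftN_ιN _ _

lemma restrict_incl {c d : C} (a : (x.obj c).N ⟶ (x.obj d).N)
    (ha : ∀ i, a ≫ (x.obj d).ιN ≫ q' d i = (x.obj c).ιN ≫ q' c i) :
    h.restrict a ha ≫ h.incl d = h.incl c ≫ a := by
  rw [← cancel_mono (x.obj d).ιN, Category.assoc, Category.assoc, incl_ιN]
  exact h.restrict_ιN a ha

/-- The isomorphism of the new supports given by a morphism of the diagram. -/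
def mapIso {c d : C} (φ : c ⟶ d) :
    ((x.obj c).withLeg (q' c)).N ≅ ((x.obj d).withLeg (q' d)).N where
  hom := h.restrict (x.map φ).iso.hom (h.comp φ)
  inv := h.restrict (x.map φ).iso.inv fun i => by rw [← h.comp φ i, Iso.inv_hom_id_assoc]
  hom_inv_id := h.incl_cancel (by
    rw [Category.assoc, restrict_incl, ← Category.assoc, restrict_incl, Category.assoc,
      Iso.hom_inv_id, Category.comp_id, Category.id_comp])
  inv_hom_id := h.incl_cancel (by
    rw [Category.assoc, restrict_incl, ← Category.assoc, restrict_incl, Category.assoc,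
      Iso.inv_hom_id, Category.comp_id, Category.id_comp])

lemma mapIso_hom_ιN {c d : C} (φ : c ⟶ d) :
    (h.mapIso φ).hom ≫ ((x.obj d).withLeg (q' d)).ιN =
      h.incl c ≫ (x.map φ).iso.hom ≫ (x.obj d).ιN :=
  h.restrict_ιN _ (h.comp φ)

/-- The diagram of spans with the new right legs. -/
def functor : C ⥤ FlfSpan j P' where
  obj c := (x.obj c).withLeg (q' c)
  map {c d} φ :=
    { iso := h.mapIso φ
      w_p := by
        have hp := (x.map φ).w_p
        have hι := h.mapIso_hom_ιN φ
        change (h.mapIso φ).hom ≫ ((x.obj d).withLeg (q' d)).ιN ≫ (x.obj d).p =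
          ((x.obj c).withLeg (q' c)).ιN ≫ (x.obj c).p
        rw [reassoc_of% hι, hp, incl_ιN_assoc]
      w_q i := by
        have hq := h.comp φ i
        have hι := h.mapIso_hom_ιN φ
        change (h.mapIso φ).hom ≫ ((x.obj d).withLeg (q' d)).ιN ≫ q' d i =
          ((x.obj c).withLeg (q' c)).ιN ≫ q' c i
        rw [reassoc_of% hι, hq, incl_ιN_assoc] }
  map_id c := hom_ext (by
    refine (h.mapIso_hom_ιN (𝟙 c)).trans ?_
    rw [x.map_id, id_iso, Iso.refl_hom, Category.id_comp, incl_ιN]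
    exact (Category.id_comp _).symm)
  map_comp {c d e} φ ψ := Hom.ext (Iso.ext (h.incl_cancel (by
    have hφ : (h.mapIso φ).hom ≫ h.incl d = h.incl c ≫ (x.map φ).iso.hom :=
      h.restrict_incl _ (h.comp φ)
    have hψ : (h.mapIso ψ).hom ≫ h.incl e = h.incl d ≫ (x.map ψ).iso.hom :=
      h.restrict_incl _ (h.comp ψ)
    refine (h.restrict_incl _ (h.comp (φ ≫ ψ))).trans ?_
    change _ = ((h.mapIso φ).hom ≫ (h.mapIso ψ).hom) ≫ h.incl e
    rw [Category.assoc, hψ, reassoc_of% hφ, x.map_comp, comp_iso, Iso.trans_hom])))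

lemma functor_congr {q'' : ∀ c i, (x.obj c).Z ⟶ (Functor.const D).obj (P' i).X}
    (h' : IsLeg x q'') (e : q' = q'') : h.functor = h'.functor := by
  subst e
  rfl

lemma functor_functor {q'' : ∀ c i, (x.obj c).Z ⟶ (Functor.const D).obj (P'' i).X}
    (h' : IsLeg h.functor q'') (h'' : IsLeg x q'') : h'.functor = h''.functor := by
  refine CategoryTheory.Functor.hext (fun c => rfl) fun c d φ => heq_of_eq (hom_ext ?_)
  have hincl : h'.incl c ≫ h.incl c = h''.incl c :=
    (cancel_mono (x.obj c).ιN).1 <| (Category.assoc _ _ _).trans <|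
      (congrArg (h'.incl c ≫ ·) (h.incl_ιN c)).trans <|
        (h'.incl_ιN c).trans (h''.incl_ιN c).symm
  let ι' := (x.map φ).iso.hom ≫ (x.obj d).ιN
  have hφ : (h'.mapIso φ).hom ≫ ((x.obj d).withLeg (q'' d)).ιN = h'.incl c ≫ h.incl c ≫ ι' :=
    (h'.mapIso_hom_ιN φ).trans (congrArg (h'.incl c ≫ ·) (h.mapIso_hom_ιN φ))
  have hφ' : h'.incl c ≫ h.incl c ≫ ι' = h''.incl c ≫ ι' :=
    (Category.assoc _ _ _).symm.trans (congrArg (· ≫ ι') hincl)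
  exact hφ.trans (hφ'.trans (h''.mapIso_hom_ιN φ).symm)

lemma comp_push (h : IsLeg x q') (f : P' ⟶ P'') :
    IsLeg x fun c i => q' c i ≫ (Functor.const D).map (f i).hom where
  support_le c T := (support_pushObj_le f ((x.obj c).withLeg (q' c)) T).trans (h.support_le c T)
  comp φ i := by
    have := h.comp φ i
    rw [reassoc_of% this]

variable {D' : Type (u + 1)} [Category.{u} D']

lemma preAux (h : IsLeg x q') (H : D' ⥤ D) :
    IsLeg (x ⋙ FlfSpan.preAux H) fun c i => H.whiskerLeft (q' c i) where
  support_le c T := h.support_le c (H.obj T)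
  comp φ i := congrArg H.whiskerLeft (h.comp φ i)

lemma functor_preAux (H : D' ⥤ D) : (h.preAux H).functor = h.functor ⋙ FlfSpan.preAux H :=
  CategoryTheory.Functor.hext (fun _ => rfl) fun _ _ _ => heq_of_eq (Hom.ext (Iso.ext rfl))

end IsLeg

variable {C : Type*} [Category* C]

lemma isLeg_push (x : C ⥤ FlfSpan j P) (f : P ⟶ P') :
    IsLeg x fun c i => (x.obj c).q i ≫ (Functor.const D).map (f i).hom where
  support_le c T := support_pushObj_le f (x.obj c) T
  comp φ i := by
    have := (x.map φ).w_q i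
    rw [reassoc_of% this]

lemma isLeg_push_functor (x : C ⥤ FlfSpan j P) (f : P ⟶ P') :
    (isLeg_push x f).functor = x ⋙ push f :=
  CategoryTheory.Functor.hext (fun _ => rfl) fun _ _ _ => heq_of_eq (Hom.ext (Iso.ext rfl))

lemma isLeg_self (x : C ⥤ FlfSpan j P) : IsLeg x fun c i => (x.obj c).q i where
  support_le _ _ := le_rfl
  comp φ i := (x.map φ).w_q i

lemma isLeg_self_functor (x : C ⥤ FlfSpan j P) : (isLeg_self x).functor = x := by
  have := isLeg_push_functor x (𝟙 P)
  rw [push_id] at this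
  refine Eq.trans ?_ this
  refine IsLeg.functor_congr _ _ (funext fun c => funext fun i => ?_)
  exact ((congrArg ((x.obj c).q i ≫ ·) ((Functor.const D).map_id _)).trans
    (Category.comp_id _)).symm

end FlfSpan

lemma deformMap_congr {m : SimplexCategory} {W : Over (SpecK k)} {q q' : W ⟶ whiskerSch k m}
    {t t' : Γ(W.left, ⊤)} (hq : q = q') (h : t = t') (ht : IsUnit (deformCoord q t)) :
    deformMap q t ht = deformMap q' t' (by rw [← hq, ← h]; exact ht) := by
  subst hq h
  rfl

variable (k) in
/-- The pointed schemes in the smash product `A ∧ 𝔾_m^{∧ n}` in simplicial degree `m`. -/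
abbrev smashObj (n : ℕ) (A : Pointed.{0}) (m : SimplexCategory) : Option (Fin n) → PtdSch k :=
  ((smashWith (GmSmash k n)).obj A).obj (op m)

lemma whiskeredGm_pt (m : SimplexCategory) : ((whiskeredGm k).obj (op m)).pt =
    whiskerι k m (some ⟨SimplexCategory.const m ⦋1⦌ 1, const_one_ne _⟩) :=
  Category.id_comp _

lemma mem_whiskeredGm_away (m : SimplexCategory) (x : (whiskerSch k m).left) :
    x ∈ ((whiskeredGm k).obj (op m)).away ↔
      sigmaIndex x ≠ some ⟨SimplexCategory.const m ⦋1⦌ 1, const_one_ne _⟩ := by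
  change ¬ (∃ y, ((whiskeredGm k).obj (op m)).pt.left y = x) ↔ _
  rw [whiskeredGm_pt]
  exact Iff.not (mem_opensRange_sigmaOverι (X := whiskerSummand k m)
    (i := some ⟨SimplexCategory.const m ⦋1⦌ 1, const_one_ne _⟩))

lemma SameSummand.mem_away {m : SimplexCategory} {W : Over (SpecK k)}
    {f g : W ⟶ whiskerSch k m} (h : SameSummand f g) {z : W.left}
    (hz : f.left z ∈ ((whiskeredGm k).obj (op m)).away) :
    g.left z ∈ ((whiskeredGm k).obj (op m)).away := by
  rw [mem_whiskeredGm_away, ← h z]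
  exact (mem_whiskeredGm_away m _).1 hz

lemma appTop_comp_eq {X Y Y' Z : Over (SpecK k)} {a : X ⟶ Y} {b : Y ⟶ Z} {c : X ⟶ Y'}
    {d : Y' ⟶ Z} (h : a ≫ b = c ≫ d) (s : Γ(Z.left, ⊤)) :
    a.left.appTop (b.left.appTop s) = c.left.appTop (d.left.appTop s) := by
  have hleft : a.left ≫ b.left = c.left ≫ d.left := congrArg Over.Hom.left h
  have := ConcreteCategory.congr_hom (congrArg Scheme.Hom.appTop hleft) s
  rwa [Scheme.Hom.comp_appTop, Scheme.Hom.comp_appTop] at this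

/-- A compatible family of functions on a diagram of schemes. -/
@[ext]
structure DiagramFunction {D : Type (u + 1)} [Category.{u} D] (j : D ⥤ Over (SpecK k)) where
  val (T : D) : Γ((j.obj T).left, ⊤)
  map_val {T T' : D} (f : T ⟶ T') : (j.map f).left.appTop (val T') = val T

namespace DiagramFunction

variable {D D' : Type (u + 1)} [Category.{u} D] [Category.{u} D'] {j : D ⥤ Over (SpecK k)}

/-- The pullback of functions along a map of diagrams. -/
def comap {Z : D ⥤ Over (SpecK k)} (p : Z ⟶ j) (t : DiagramFunction j) : DiagramFunction Z where
  val T := (p.app T).left.appTop (t.val T)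
  map_val {T T'} f := by
    rw [← t.map_val f]
    exact appTop_comp_eq (p.naturality f) (t.val T')

/-- The restriction of functions along a functor. -/
def restrict (t : DiagramFunction j) (H : D' ⥤ D) : DiagramFunction (H ⋙ j) where
  val T := t.val (H.obj T)
  map_val f := t.map_val (H.map f)

instance : Zero (DiagramFunction j) := ⟨⟨fun _ => 0, fun _ => map_zero _⟩⟩

instance : One (DiagramFunction j) := ⟨⟨fun _ => 1, fun _ => map_one _⟩⟩

/-- The function on the diagram `j'` is the restriction of the function on `j`. -/
def IsRestriction (t : DiagramFunction j)
    {j' : D' ⥤ Over (SpecK k)} (t' : DiagramFunction j') (H : D' ⥤ D) (hj : H ⋙ j = j') : Prop :=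
  ∀ T, t'.val T = (eqToHom (congrArg (fun F : D' ⥤ Over (SpecK k) => F.obj T) hj).symm).left.appTop
    (t.val (H.obj T))

lemma IsRestriction.eq_restrict {t : DiagramFunction j}
    {H : D' ⥤ D} {t' : DiagramFunction (H ⋙ j)} (ht : t.IsRestriction t' H rfl) :
    t' = t.restrict H :=
  DiagramFunction.ext (funext fun T => (ht T).trans (by simp [DiagramFunction.restrict]))

end DiagramFunction

namespace FlfSpan

variable {D D' : Type (u + 1)} [Category.{u} D] [Category.{u} D'] {j : D ⥤ Over (SpecK k)}
  {n : ℕ} {A A' : Pointed.{0}} {m m' : SimplexCategory}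

/-- The map to a whiskered multiplicative group in the right leg of a span. -/
abbrev legGm (α : FlfSpan j (smashObj k n A m)) (i : Fin n) (T : D) :
    α.Z.obj T ⟶ whiskerSch k m := (α.q (some i)).app T

lemma map_legGm (α : FlfSpan j (smashObj k n A m)) (i : Fin n) {T T' : D} (f : T ⟶ T') :
    α.Z.map f ≫ α.legGm i T' = α.legGm i T :=
  ((α.q (some i)).naturality f).trans (Category.comp_id _)

/-- The deformation is defined on a span. -/
def IsDeformable (t : DiagramFunction j) (α : FlfSpan j (smashObj k n A m)) : Prop :=
  ∀ i T, IsUnit (deformCoord (α.legGm i T) ((t.comap α.p).val T))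

/-- The right leg of the deformed span. -/
def deformLeg (t : DiagramFunction j) (α : FlfSpan j (smashObj k n A m))
    (h : α.IsDeformable t) (i : Option (Fin n)) :
    α.Z ⟶ (Functor.const D).obj (smashObj k n A m i).X :=
  match i with
  | none => α.q none
  | some i =>
    { app T := deformMap (α.legGm i T) ((t.comap α.p).val T) (h i T)
      naturality T T' f := by
        refine Eq.trans ?_ (Category.comp_id _).symm
        refine (comp_deformMap _ _ _ _).trans ?_
        exact deformMap_congr (α.map_legGm i f) ((t.comap α.p).map_val f) _ }

variable {C : Type*} [Category* C]

lemma isLeg_deformLeg (t : DiagramFunction j) (x : C ⥤ FlfSpan j (smashObj k n A m))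
    (h : ∀ c, (x.obj c).IsDeformable t) :
    IsLeg x fun c => (x.obj c).deformLeg t (h c) where
  support_le c T z hz i := by
    match i with
    | none => exact hz none
    | some i => exact (sameSummand_deformMap _ _ (h c i T)).symm.mem_away (hz (some i))
  comp {c d} φ i := by
    match i with
    | none => exact (x.map φ).w_q none
    | some i =>
      have hq := (x.map φ).w_q (some i)
      have hp := (x.map φ).w_p
      apply NatTrans.ext
      funext T
      change (x.map φ).iso.hom.app T ≫ (x.obj d).ιN.app T ≫ deformMap _ _ (h d i T) =
        (x.obj c).ιN.app T ≫ deformMap _ _ (h c i T)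
      rw [← Category.assoc, comp_deformMap, comp_deformMap]
      refine deformMap_congr ?_ ?_ _
      · exact (Category.assoc _ _ _).trans (congr_app hq T)
      · exact appTop_comp_eq ((Category.assoc _ _ _).trans (congr_app hp T)) (t.val T)

/-- The deformation of a diagram of spans. -/
def deform (t : DiagramFunction j) (x : C ⥤ FlfSpan j (smashObj k n A m))
    (h : ∀ c, (x.obj c).IsDeformable t) : C ⥤ FlfSpan j (smashObj k n A m) :=
  (isLeg_deformLeg t x h).functor

lemma deform_congr {t : DiagramFunction j} {x y : C ⥤ FlfSpan j (smashObj k n A m)} (e : x = y)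
    (h : ∀ c, (x.obj c).IsDeformable t) (h' : ∀ c, (y.obj c).IsDeformable t) :
    deform t x h = deform t y h' := by
  subst e
  rfl

lemma comp_deform {C' : Type*} [Category* C'] (y : C' ⥤ C) (t : DiagramFunction j)
    (x : C ⥤ FlfSpan j (smashObj k n A m)) (h : ∀ c, (x.obj c).IsDeformable t) :
    y ⋙ deform t x h = deform t (y ⋙ x) fun c => h (y.obj c) :=
  CategoryTheory.Functor.hext (fun _ => rfl) fun _ _ _ => heq_of_eq (Hom.ext (Iso.ext rfl))

lemma deform_zero (x : C ⥤ FlfSpan j (smashObj k n A m))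
    (h : ∀ c, (x.obj c).IsDeformable 0) : deform 0 x h = x := by
  refine Eq.trans ?_ (isLeg_self_functor x)
  refine IsLeg.functor_congr _ _ (funext fun c => funext fun i => ?_)
  match i with
  | none => rfl
  | some i =>
    apply NatTrans.ext
    funext T
    refine (deformMap_congr rfl (map_zero _) (h c i T)).trans ?_
    exact deformMap_zero _ _

/-- The contracting homotopy of the whiskers, as a pointed map. -/
def contractHom (n : ℕ) (A : Pointed.{0}) {m : SimplexCategory} (τ : m ⟶ ⦋1⦌) :
    smashObj k n A m ⟶ smashObj k n A m := fun i =>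
  match i with
  | none => 𝟙 _
  | some i =>
    { hom := whiskerContract τ
      w := by
        have hpt := (whiskeredGm_pt (k := k) m).trans
          (whiskerCell_of_ne k _ (const_one_ne _)).symm
        change ((whiskeredGm k).obj (op m)).pt ≫ whiskerContract τ =
          ((whiskeredGm k).obj (op m)).pt
        rw [hpt]
        refine (whiskerCell_contract _ τ).trans ?_
        rw [one_cellSup] }

lemma deform_one (x : C ⥤ FlfSpan j (smashObj k n A m))
    (h : ∀ c, (x.obj c).IsDeformable 1) :
    deform 1 x h = x ⋙ push (contractHom n A (SimplexCategory.const m ⦋1⦌ 0)) := by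
  refine Eq.trans ?_ (isLeg_push_functor x _)
  refine IsLeg.functor_congr _ _ (funext fun c => funext fun i => ?_)
  match i with
  | none => exact (Category.comp_id _).symm
  | some i =>
    apply NatTrans.ext
    funext T
    refine (deformMap_congr rfl (map_one _) (h c i T)).trans ?_
    exact deformMap_one _ _

/-- A pointed map of the smash products that is given by a simplicial structure map on the
whiskered multiplicative groups. -/
def IsStructureMap (f : smashObj k n A m ⟶ smashObj k n A' m') (φ : m' ⟶ m) : Prop :=
  ∀ i, (f (some i)).hom = whiskerMap k φ

lemma IsDeformable.push {t : DiagramFunction j} {α : FlfSpan j (smashObj k n A m)}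
    (h : α.IsDeformable t) {f : smashObj k n A m ⟶ smashObj k n A' m'} {φ : m' ⟶ m}
    (hf : IsStructureMap f φ) : (pushObj f α).IsDeformable t := fun i T => by
  have e : (pushObj f α).legGm i T = α.legGm i T ≫ whiskerMap k φ :=
    congrArg (α.legGm i T ≫ ·) (hf i)
  rw [e, deformCoord_whiskerMap]
  exact h i T

lemma deformLeg_push (t : DiagramFunction j) (α : FlfSpan j (smashObj k n A m))
    (h : α.IsDeformable t) {f : smashObj k n A m ⟶ smashObj k n A' m'} {φ : m' ⟶ m}
    (hf : IsStructureMap f φ) (h' : (pushObj f α).IsDeformable t) :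
    (pushObj f α).deformLeg t h' =
      fun i => α.deformLeg t h i ≫ (Functor.const D).map (f i).hom := by
  funext i
  match i with
  | none => rfl
  | some i =>
    apply NatTrans.ext
    funext T
    have hleg : (pushObj f α).legGm i T = α.legGm i T ≫ whiskerMap k φ :=
      congrArg (α.legGm i T ≫ ·) (hf i)
    refine (deformMap_congr hleg rfl (h' i T)).trans ?_
    refine (deformMap_whiskerMap φ _ _ (h i T) _).trans ?_
    exact congrArg (deformMap _ _ (h i T) ≫ ·) (hf i).symm

lemma deform_push (t : DiagramFunction j) (x : C ⥤ FlfSpan j (smashObj k n A m))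
    (h : ∀ c, (x.obj c).IsDeformable t) {f : smashObj k n A m ⟶ smashObj k n A' m'}
    {φ : m' ⟶ m} (hf : IsStructureMap f φ) (h' : ∀ c, ((x ⋙ push f).obj c).IsDeformable t) :
    deform t (x ⋙ push f) h' = deform t x h ⋙ push f := by
  have hpush (c) : ((isLeg_push x f).functor.obj c).IsDeformable t := h' c
  have hlegs : (fun c => ((isLeg_push x f).functor.obj c).deformLeg t (hpush c)) =
      fun c i => (x.obj c).deformLeg t (h c) i ≫ (Functor.const D).map (f i).hom :=
    funext fun c => deformLeg_push t (x.obj c) (h c) hf (hpush c)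
  have hcomp := (isLeg_deformLeg t x h).comp_push f
  calc deform t (x ⋙ push f) h'
      = deform t (isLeg_push x f).functor hpush :=
        deform_congr (isLeg_push_functor x f).symm h' hpush
    _ = hcomp.functor :=
        ((isLeg_push x f).functor_functor (isLeg_deformLeg t _ hpush) (hlegs ▸ hcomp)).trans
          (IsLeg.functor_congr _ _ hlegs)
    _ = (isLeg_push (deform t x h) f).functor :=
        ((isLeg_deformLeg t x h).functor_functor (isLeg_push (deform t x h) f) hcomp).symm
    _ = deform t x h ⋙ push f := isLeg_push_functor _ f

lemma IsDeformable.preAux {t : DiagramFunction j} {α : FlfSpan j (smashObj k n A m)}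
    (h : α.IsDeformable t) (H : D' ⥤ D) : (preObj H α).IsDeformable (t.restrict H) :=
  fun i T => h i (H.obj T)

lemma deform_preAux (t : DiagramFunction j) (x : C ⥤ FlfSpan j (smashObj k n A m))
    (h : ∀ c, (x.obj c).IsDeformable t) (H : D' ⥤ D)
    (h' : ∀ c, ((x ⋙ preAux H).obj c).IsDeformable (t.restrict H)) :
    deform (t.restrict H) (x ⋙ preAux H) h' = deform t x h ⋙ preAux H := by
  refine Eq.trans ?_ ((isLeg_deformLeg t x h).functor_preAux H)
  refine IsLeg.functor_congr _ _ (funext fun c => funext fun i => ?_)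
  match i with
  | none => rfl
  | some i => rfl

lemma IsDeformable.pre {t : DiagramFunction j} {α : FlfSpan j (smashObj k n A m)}
    (h : α.IsDeformable t) (H : D' ⥤ D) {j' : D' ⥤ Over (SpecK k)} (hj : H ⋙ j = j')
    {t' : DiagramFunction j'} (ht : t.IsRestriction t' H hj) :
    ((FlfSpan.pre H hj).obj α).IsDeformable t' := by
  subst hj
  rw [ht.eq_restrict]
  exact h.preAux H

lemma deform_pre (t : DiagramFunction j) (x : C ⥤ FlfSpan j (smashObj k n A m))
    (h : ∀ c, (x.obj c).IsDeformable t) (H : D' ⥤ D) {j' : D' ⥤ Over (SpecK k)}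
    (hj : H ⋙ j = j') {t' : DiagramFunction j'} (ht : t.IsRestriction t' H hj)
    (h' : ∀ c, ((x ⋙ pre H hj).obj c).IsDeformable t') :
    deform t' (x ⋙ pre H hj) h' = deform t x h ⋙ pre H hj := by
  subst hj
  obtain rfl := ht.eq_restrict
  exact deform_preAux t x h H h'

/-- A span with empty support. -/
def IsNull {ι : Type} [Finite ι] {P : ι → PtdSch k} (α : FlfSpan j P) : Prop :=
  ∀ T, IsEmpty (α.N.obj T).left

section Null

variable {ι : Type} [Finite ι] {P P' : ι → PtdSch k}

lemma IsNull.hom_ext {α : FlfSpan j P} (hα : α.IsNull) {F : D ⥤ Over (SpecK k)}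
    (f g : α.N ⟶ F) : f = g := by
  apply NatTrans.ext
  funext T
  have := hα T
  exact over_hom_ext_of_isEmpty _ _

/-- The unique map out of a diagram of empty schemes. -/
def IsNull.desc {α : FlfSpan j P} (hα : α.IsNull) (F : D ⥤ Over (SpecK k)) : α.N ⟶ F where
  app T :=
    have := hα T
    Over.homMk (isInitialOfIsEmpty.to _) (isInitialOfIsEmpty.hom_ext _ _)
  naturality T _ _ :=
    have := hα T
    over_hom_ext_of_isEmpty _ _

/-- The unique morphism between spans with empty support. -/
def IsNull.hom {α β : FlfSpan j P} (hα : α.IsNull) (hβ : β.IsNull) : α ⟶ β where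
  iso := ⟨hα.desc _, hβ.desc _, hα.hom_ext _ _, hβ.hom_ext _ _⟩
  w_p := hα.hom_ext _ _
  w_q _ := hα.hom_ext _ _

lemma IsNull.eq {α β : FlfSpan j P} (hα : α.IsNull) (f g : α ⟶ β) : f = g :=
  FlfSpan.hom_ext (hα.hom_ext _ _)

/-- The diagram given by spans with empty support and their unique morphisms. -/
def ofNull (o : C → FlfSpan j P) (h : ∀ c, (o c).IsNull) : C ⥤ FlfSpan j P where
  obj := o
  map _ := (h _).hom (h _)
  map_id c := (h c).eq _ _
  map_comp _ _ := (h _).eq _ _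

lemma functor_ext_of_null {x y : C ⥤ FlfSpan j P} (h : ∀ c, (x.obj c).IsNull)
    (e : ∀ c, x.obj c = y.obj c) : x = y :=
  CategoryTheory.Functor.ext e fun _ _ _ => (h _).eq _ _

lemma isNull_iff {α : FlfSpan j P} :
    α.IsNull ↔ ∀ T (z : (α.Z.obj T).left), z ∉ α.support T :=
  ⟨fun h T z hz => (h T).elim ⟨z, hz⟩, fun h T => ⟨fun z => h T z.1 z.2⟩⟩

lemma isNull_zero : (zero j P).IsNull :=
  isNull_iff.2 fun _ z => (inferInstance : IsEmpty (emptyOver k).left).elim z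

lemma IsNull.push {α : FlfSpan j P} (h : α.IsNull) (f : P ⟶ P') : (pushObj f α).IsNull :=
  isNull_iff.2 fun T z hz => isNull_iff.1 h T z (support_pushObj_le f α T hz)

lemma IsNull.pre {α : FlfSpan j P} (h : α.IsNull) (H : D' ⥤ D) {j' : D' ⥤ Over (SpecK k)}
    (hj : H ⋙ j = j') : ((pre H hj).obj α).IsNull := by
  subst hj
  exact fun T => h (H.obj T)

end Null

lemma isDeformable_zero (t : DiagramFunction j) :
    (zero j (smashObj k n A m)).IsDeformable t := fun i T => by
  have : IsEmpty ((zero j (smashObj k n A m)).Z.obj T).left :=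
    inferInstanceAs (IsEmpty (emptyOver k).left)
  have : Subsingleton Γ(((zero j (smashObj k n A m)).Z.obj T).left, ⊤) := inferInstance
  exact isUnit_of_subsingleton _

lemma deform_const_zero (t : DiagramFunction j)
    (h : ∀ c : C, (((Functor.const C).obj (zero j (smashObj k n A m))).obj c).IsDeformable t) :
    deform t ((Functor.const C).obj (zero j (smashObj k n A m))) h =
      (Functor.const C).obj (zero j (smashObj k n A m)) := by
  symm
  refine functor_ext_of_null (fun _ => isNull_zero) fun _ => ?_
  exact mk_congr rfl (funext fun i => const_empty_hom_ext _ _)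

lemma isNull_push_contract (hn : 0 < n) (α : FlfSpan j (smashObj k n A m)) :
    (pushObj (contractHom n A (SimplexCategory.const m ⦋1⦌ 1)) α).IsNull := by
  refine isNull_iff.2 fun T z hz => ?_
  refine (mem_whiskeredGm_away m _).1 (hz (some ⟨0, hn⟩)) ?_
  change sigmaIndex ((α.legGm ⟨0, hn⟩ T ≫
    whiskerContract (SimplexCategory.const m ⦋1⦌ 1)).left z) = _
  rw [whiskerContract_one, whiskerCell_of_ne k _ (const_one_ne m), ← Category.assoc]
  exact sigmaIndex_comp_ι _ z

end FlfSpan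

end FlfCor

namespace FlfCor

variable {k : Type u} [Field k]

lemma isUnit_iff_mem_basicOpen {X : Scheme.{u}} {f : Γ(X, ⊤)} :
    IsUnit f ↔ ∀ x, x ∈ X.basicOpen f := by
  refine ⟨fun h x => ?_, fun h => ?_⟩
  · rw [Scheme.basicOpen_of_isUnit X h]
    trivial
  · exact X.toRingedSpace.isUnit_of_isUnit_germ ⊤ f fun x _ =>
      (Scheme.mem_basicOpen_top X f x).1 (h x)

lemma mem_basicOpen_appTop {X Y : Scheme.{u}} (f : X ⟶ Y) (s : Γ(Y, ⊤)) (x : X) :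
    x ∈ X.basicOpen (f.appTop s) ↔ f x ∈ Y.basicOpen s := by
  rw [← Scheme.preimage_basicOpen_top]
  rfl

namespace Sm

namespace Nbhd

/-- The projection of a neighbourhood to `Y`. -/
def proj {Y : Sm k} (U : Nbhd Y) : U.toSm ⟶ Y :=
  ObjectProperty.homMk (Over.homMk (U.ι ≫ A1.proj Y) (by rfl))

lemma comp_proj {Y T : Sm k} {U : Nbhd Y} (a : T ⟶ U.toSm) :
    (a ≫ U.proj).hom.left = (a.hom.left ≫ U.ι) ≫ A1.proj Y :=
  (Category.assoc _ _ _).symm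

lemma incl_proj {Y : Sm k} {U V : Nbhd Y} (h : V ≤ U) : incl h ≫ U.proj = V.proj := by
  ext : 2
  rw [comp_proj, incl_ι]
  rfl

lemma preimageHom_proj {Y' Y : Sm k} (g : Y' ⟶ Y) (U : Nbhd Y) :
    preimageHom g U ≫ U.proj = (U.preimage g).proj ≫ g := by
  ext : 2
  rw [comp_proj, preimageHom_ι, Category.assoc, A1map_proj]
  exact (Category.assoc _ _ _).symm

lemma zeroLift_proj {Y : Sm k} (U : Nbhd Y) : U.zeroLift ≫ U.proj = 𝟙 Y := by
  ext : 2
  rw [comp_proj, zeroLift_ι]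
  exact AffineSpace.homOfVector_over _ _

lemma oneLift_proj {Y : Sm k} (U : Nbhd Y) : U.oneLift ≫ U.proj = 𝟙 Y := by
  ext : 2
  rw [comp_proj, oneLift_ι]
  exact AffineSpace.homOfVector_over _ _

/-- The coordinate function of `Y × 𝔸¹` on a neighbourhood. -/
def time {Y : Sm k} (U : Nbhd Y) : Γ(U.toSm.obj.left, ⊤) :=
  U.ι.appTop (AffineSpace.coord _ PUnit.unit)

lemma appTop_time {Y T : Sm k} {U : Nbhd Y} (a : T ⟶ U.toSm) :
    a.hom.left.appTop U.time =
      (a.hom.left ≫ U.ι).appTop (AffineSpace.coord _ PUnit.unit) := by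
  rw [Scheme.Hom.comp_appTop]
  rfl

lemma incl_time {Y : Sm k} {U V : Nbhd Y} (h : V ≤ U) :
    (incl h).hom.left.appTop U.time = V.time := by
  rw [appTop_time, incl_ι]
  rfl

lemma preimageHom_time {Y' Y : Sm k} (g : Y' ⟶ Y) (U : Nbhd Y) :
    (preimageHom g U).hom.left.appTop U.time = (U.preimage g).time := by
  rw [appTop_time, preimageHom_ι, Scheme.Hom.comp_appTop, CommRingCat.comp_apply]
  exact congrArg (U.preimage g).ι.appTop (AffineSpace.map_appTop_coord _ _)

lemma zeroLift_time {Y : Sm k} (U : Nbhd Y) : U.zeroLift.hom.left.appTop U.time = 0 := by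
  rw [appTop_time, zeroLift_ι]
  exact AffineSpace.homOfVector_appTop_coord _ _ _

lemma oneLift_time {Y : Sm k} (U : Nbhd Y) : U.oneLift.hom.left.appTop U.time = 1 := by
  rw [appTop_time, oneLift_ι]
  exact AffineSpace.homOfVector_appTop_coord _ _ _

end Nbhd

end Sm

open Sm

namespace DiagramFunction

/-- The pullbacks of a function on `Y` to the schemes over `Y`. -/
def ofSection {Y : Sm k} (s : Γ(Y.obj.left, ⊤)) : DiagramFunction (FlfSpan.base Y) where
  val T := T.hom.hom.left.appTop s
  map_val {T T'} f := by
    have hf : f.left.hom.left ≫ T'.hom.hom.left = T.hom.hom.left :=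
      congrArg (fun r => r.hom.left) (Over.w f)
    change f.left.hom.left.appTop (T'.hom.hom.left.appTop s) = _
    rw [← hf, Scheme.Hom.comp_appTop, CommRingCat.comp_apply]

lemma isRestriction_ofSection {Y' Y : Sm k} (g : Y' ⟶ Y) {s : Γ(Y.obj.left, ⊤)}
    {s' : Γ(Y'.obj.left, ⊤)} (h : g.hom.left.appTop s = s') :
    (ofSection s).IsRestriction (ofSection s') (Over.map g) (FlfSpan.map_base g) := fun T => by
  subst h
  change T.hom.hom.left.appTop (g.hom.left.appTop s) =
    (𝟙 T.left.obj : T.left.obj ⟶ _).left.appTop ((T.hom.hom ≫ g.hom).left.appTop s)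
  rw [Over.comp_left, Scheme.Hom.comp_appTop]
  simp

lemma ofSection_zero {Y : Sm k} : ofSection (0 : Γ(Y.obj.left, ⊤)) = 0 :=
  DiagramFunction.ext (funext fun _ => map_zero _)

lemma ofSection_one {Y : Sm k} : ofSection (1 : Γ(Y.obj.left, ⊤)) = 1 :=
  DiagramFunction.ext (funext fun _ => map_one _)

end DiagramFunction

namespace FlfSpan

open DiagramFunction

section Locus

variable {D : Type (u + 1)} [Category.{u} D] {j : D ⥤ Over (SpecK k)} {ι : Type}
  {P : ι → PtdSch k} (α : FlfSpan j P)

/-- The image in the base of the zero locus of a function on the apex of a span. -/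
def zeroImage (W : D) (s : Γ((α.Z.obj W).left, ⊤)) : Set (j.obj W).left :=
  (α.p.app W).left '' ((α.Z.obj W).left.basicOpen s : Set (α.Z.obj W).left)ᶜ

lemma isClosed_zeroImage (W : D) (s : Γ((α.Z.obj W).left, ⊤)) : IsClosed (α.zeroImage W s) := by
  have := α.isFinite W
  exact (α.p.app W).left.isClosedMap _ ((α.Z.obj W).left.basicOpen s).isOpen.isClosed_compl

lemma isUnit_appTop_iff {T W : D} (g : T ⟶ W) (s : Γ((α.Z.obj W).left, ⊤)) :
    IsUnit ((α.Z.map g).left.appTop s) ↔ ∀ x, (j.map g).left x ∉ α.zeroImage W s := by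
  have hpb : IsPullback (α.Z.map g).left (α.p.app T).left (α.p.app W).left (j.map g).left :=
    (α.equifibered g).map (Over.forget (SpecK k))
  rw [isUnit_iff_mem_basicOpen]
  constructor
  · rintro h x ⟨z, hz, hx⟩
    obtain ⟨y, hy, -⟩ := Scheme.Pullback.exists_preimage_pullback (f := (α.p.app W).left)
      (g := (j.map g).left) z x hx
    have hyz : (α.Z.map g).left (hpb.isoPullback.inv y) = z := by
      rw [← Scheme.Hom.comp_apply, hpb.isoPullback_inv_fst, hy]
    exact hz (hyz ▸ (mem_basicOpen_appTop _ _ _).1 (h _))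
  · intro h z
    by_contra hz
    refine h ((α.p.app T).left z) ⟨_, fun hz' => hz ((mem_basicOpen_appTop _ _ _).2 hz'), ?_⟩
    rw [← Scheme.Hom.comp_apply, hpb.w, Scheme.Hom.comp_apply]

end Locus

variable {n : ℕ} {A : Pointed.{0}} {m : SimplexCategory} {Y : Sm k}

/-- The deformation along the coordinate of `U` is defined on a span. -/
def IsDeformableOn (U : Nbhd Y) (α : FlfSpan (base Y) (smashObj k n A m)) : Prop :=
  ((pre (Over.map U.proj) (map_base U.proj)).obj α).IsDeformable (ofSection U.time)

lemma isDeformableOn_iff {U : Nbhd Y} {α : FlfSpan (base Y) (smashObj k n A m)} :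
    α.IsDeformableOn U ↔ ∀ i (T : Over U.toSm),
      IsUnit (deformCoord (α.legGm i ((Over.map U.proj).obj T))
        ((α.p.app ((Over.map U.proj).obj T)).left.appTop (T.hom.hom.left.appTop U.time))) :=
  Iff.rfl

lemma IsDeformableOn.anti {U V : Nbhd Y} (hV : V ≤ U)
    {α : FlfSpan (base Y) (smashObj k n A m)} (h : α.IsDeformableOn U) : α.IsDeformableOn V := by
  have hpre := pre_comp (P := smashObj k n A m) (Over.map U.proj) (Over.map (Nbhd.incl hV))
    (Over.map V.proj) (by rw [← Nbhd.incl_proj hV]; exact Over.mapComp_eq _ _)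
    (map_base _) (map_base _) (map_base _)
  rw [IsDeformableOn, hpre]
  exact h.pre (Over.map (Nbhd.incl hV)) (map_base _)
    (isRestriction_ofSection (Nbhd.incl hV) (Nbhd.incl_time hV))

variable (Y) in
/-- The affine line `Y × 𝔸¹`, as a scheme over `Y`. -/
abbrev line : Over Y := Over.mk (⊤ : Nbhd Y).proj

variable (α : FlfSpan (base Y) (smashObj k n A m))

/-- The points of `Y × 𝔸¹` over which the deformation of a span takes the value `0`. -/
def nondeformableLocus : Set Y.A1 :=
  ⋃ i, (⊤ : Nbhd Y).ι '' α.zeroImage (line Y)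
    (deformCoord (α.legGm i (line Y)) ((α.p.app (line Y)).left.appTop (⊤ : Nbhd Y).time))

lemma isClosed_nondeformableLocus : IsClosed α.nondeformableLocus := by
  have hrange : Set.range (⊤ : Nbhd Y).ι = Set.univ :=
    Set.eq_univ_of_forall fun x => ⟨⟨x, trivial⟩, rfl⟩
  have hι : Topology.IsClosedEmbedding (⊤ : Nbhd Y).ι :=
    ⟨(⊤ : Nbhd Y).ι.isOpenEmbedding.isEmbedding, hrange ▸ isClosed_univ⟩
  exact isClosed_iUnion_of_finite fun i => hι.isClosedMap _ (α.isClosed_zeroImage _ _)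

lemma forall_isUnit_deformCoord_iff {T : Over Y} (g : T ⟶ line Y) :
    (∀ i, IsUnit (deformCoord (α.legGm i T)
      ((α.p.app T).left.appTop (g.left.hom.left.appTop (⊤ : Nbhd Y).time)))) ↔
      ∀ x, (g.left.hom.left ≫ (⊤ : Nbhd Y).ι) x ∉ α.nondeformableLocus := by
  have hcoord (i) : (α.Z.map g).left.appTop (deformCoord (α.legGm i (line Y))
      ((α.p.app (line Y)).left.appTop (⊤ : Nbhd Y).time)) = deformCoord (α.legGm i T)
        ((α.p.app T).left.appTop (g.left.hom.left.appTop (⊤ : Nbhd Y).time)) := by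
    rw [← deformCoord_comp, map_legGm]
    exact congrArg _ (appTop_comp_eq (α.p.naturality g) _)
  have hmem (x) : (g.left.hom.left ≫ (⊤ : Nbhd Y).ι) x ∈ α.nondeformableLocus ↔
      ∃ i, g.left.hom.left x ∈ α.zeroImage (line Y) (deformCoord (α.legGm i (line Y))
        ((α.p.app (line Y)).left.appTop (⊤ : Nbhd Y).time)) := by
    rw [Scheme.Hom.comp_apply, nondeformableLocus, Set.mem_iUnion]
    exact exists_congr fun i =>
      (⊤ : Nbhd Y).ι.isOpenEmbedding.injective.mem_set_image
  simp only [← hcoord, isUnit_appTop_iff, hmem, not_exists]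
  exact forall_comm

lemma section_notMem_nondeformableLocus {t : Y ⟶ (⊤ : Nbhd Y).toSm}
    (ht : t ≫ (⊤ : Nbhd Y).proj = 𝟙 Y) {f : Y.obj.left ⟶ Y.A1}
    (hf : t.hom.left ≫ (⊤ : Nbhd Y).ι = f)
    {s : Γ((α.Z.obj (Over.mk (𝟙 Y))).left, ⊤)}
    (hs : (α.p.app (Over.mk (𝟙 Y))).left.appTop (t.hom.left.appTop (⊤ : Nbhd Y).time) = s)
    (h : ∀ i, IsUnit (deformCoord (α.legGm i (Over.mk (𝟙 Y))) s)) (y) :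
    f y ∉ α.nondeformableLocus := by
  subst hf hs
  exact (α.forall_isUnit_deformCoord_iff (Over.homMk t ht : Over.mk (𝟙 Y) ⟶ line Y)).1 h y

/-- The points of `Y × 𝔸¹` over which the deformation of a span is invertible. -/
def deformableNbhd : Nbhd Y where
  U := ⟨α.nondeformableLocusᶜ, α.isClosed_nondeformableLocus.isOpen_compl⟩
  zero_mem := α.section_notMem_nondeformableLocus (Nbhd.zeroLift_proj _) (Nbhd.zeroLift_ι _)
    ((congrArg _ (Nbhd.zeroLift_time _)).trans (map_zero _)) fun _ => by
      rw [deformCoord_zero]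
      exact isUnit_gmCoord _
  one_mem := α.section_notMem_nondeformableLocus (Nbhd.oneLift_proj _) (Nbhd.oneLift_ι _)
    ((congrArg _ (Nbhd.oneLift_time _)).trans (map_one _)) fun _ => by
      rw [deformCoord_one]
      exact isUnit_one

lemma isDeformableOn_deformableNbhd : α.IsDeformableOn α.deformableNbhd :=
  isDeformableOn_iff.2 fun i T => by
    let U := α.deformableNbhd
    have hU : U ≤ ⊤ := le_top
    let g : (Over.map U.proj).obj T ⟶ line Y := Over.homMk (T.hom ≫ Nbhd.incl hU) (by
      change (T.hom ≫ Nbhd.incl hU) ≫ (⊤ : Nbhd Y).proj = T.hom ≫ U.proj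
      rw [Category.assoc, Nbhd.incl_proj])
    have hg : g.left.hom.left ≫ (⊤ : Nbhd Y).ι = T.hom.hom.left ≫ U.ι :=
      Nbhd.comp_ι _ _ _ (Nbhd.incl_ι hU)
    have htime : g.left.hom.left.appTop (⊤ : Nbhd Y).time = T.hom.hom.left.appTop U.time := by
      rw [Nbhd.appTop_time, Nbhd.appTop_time, hg]
    rw [← htime]
    refine (α.forall_isUnit_deformCoord_iff g).2 (fun x => ?_) i
    rw [hg]
    exact U.ι_mem (T.hom.hom.left x)

lemma exists_isDeformableOn {C : Type*} [Finite C] (x : C → FlfSpan (base Y) (smashObj k n A m)) :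
    ∃ U : Nbhd Y, ∀ c, (x c).IsDeformableOn U := by
  have := Fintype.ofFinite C
  have hle (c : C) : Finset.univ.inf (fun c => (x c).deformableNbhd) ≤ (x c).deformableNbhd :=
    Finset.inf_le (Finset.mem_univ c)
  exact ⟨_, fun c => (x c).isDeformableOn_deformableNbhd.anti (hle c)⟩

end FlfSpan

end FlfCor

/-! ### The deformation of the bar construction -/

namespace FlfCor

open Sm FlfSpan

variable {k : Type u} [Field k]

variable (k) in
/-- The presheaf of pointed spaces `B h^flf(𝔾_m^{∧ n})`. -/
def bar (n : ℕ) : (Sm k)ᵒᵖ ⥤ PSSet.{u + 1} := diagPresheaf.obj (circle ⋙ hflf (GmSmash k n))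

variable (k) in
/-- The pointed schemes in the smash product `S¹ ∧ 𝔾_m^{∧ n}` in simplicial degree `m`. -/
abbrev barTarget (n : ℕ) (m : SimplexCategory) : Option (Fin n) → PtdSch k :=
  smashObj k n (circle.obj (op m)) m

/-- The `m`-simplices of `B h^flf(𝔾_m^{∧ n})(Y)`. -/
abbrev Chain (n : ℕ) (Y : Sm k) (m : SimplexCategory) :=
  Fin (m.len + 1) ⥤ FlfSpan (base Y) (barTarget k n m)

lemma const_comp {C E E' : Type*} [Category* C] [Category* E] [Category* E'] (e : E)
    (F : E ⥤ E') : (Functor.const C).obj e ⋙ F = (Functor.const C).obj (F.obj e) :=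
  CategoryTheory.Functor.hext (fun _ => rfl) fun _ _ _ => heq_of_eq (F.map_id e)

namespace Chain

variable {n : ℕ} {Y Y' : Sm k} {m m' : SimplexCategory}

/-- The simplicial structure maps of `S¹ ∧ 𝔾_m^{∧ n}`. -/
def structureHom (φ : m' ⟶ m) : barTarget k n m ⟶ barTarget k n m' :=
  ((smashWith (GmSmash k n)).map (circle.map φ.op)).app (op m) ≫
    ((smashWith (GmSmash k n)).obj (circle.obj (op m'))).map φ.op

lemma isStructureMap_structureHom (φ : m' ⟶ m) :
    IsStructureMap (k := k) (n := n) (structureHom φ) φ := fun _ =>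
  (congrArg (· ≫ whiskerMap k φ) (whiskerMap_id k m)).trans (Category.id_comp _)

lemma contractHom_structureHom (φ : m' ⟶ m) (τ : m ⟶ ⦋1⦌) :
    contractHom n _ τ ≫ structureHom (k := k) φ = structureHom φ ≫ contractHom n _ (φ ≫ τ) := by
  funext i
  match i with
  | none =>
    exact (Category.id_comp (structureHom (k := k) φ none)).trans
      (Category.comp_id (structureHom (k := k) φ none)).symm
  | some i =>
    apply PtdSch.hom_ext
    change whiskerContract τ ≫ (structureHom (k := k) φ (some i)).hom =
      (structureHom (k := k) φ (some i)).hom ≫ whiskerContract (φ ≫ τ)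
    rw [isStructureMap_structureHom φ i]
    exact whiskerContract_map φ τ

/-- The simplicial structure maps of `B h^flf(𝔾_m^{∧ n})(Y)`. -/
def face (φ : m' ⟶ m) (x : Chain n Y m) : Chain n Y m' :=
  ((SimplexCategory.toCat.map φ).toFunctor ⋙ x) ⋙ push (structureHom φ)

/-- The base change of simplices. -/
def pullback (g : Y' ⟶ Y) (x : Chain n Y m) : Chain n Y' m := x ⋙ pre (Over.map g) (map_base g)

/-- The base point. -/
def basept (n : ℕ) (Y : Sm k) (m : SimplexCategory) : Chain n Y m :=
  (Functor.const _).obj (FlfSpan.zero _ _)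

lemma bar_map (φ : m' ⟶ m) (x : Chain n Y m) :
    (((bar k n).obj (op Y)).map φ.op).toFun x = x.face φ := by
  refine Eq.trans ?_ (congrArg (((SimplexCategory.toCat.map φ).toFunctor ⋙ x) ⋙ ·)
    (push_comp _ _).symm)
  rfl

lemma pullback_face (φ : m' ⟶ m) (g : Y' ⟶ Y) (x : Chain n Y m) :
    (x.pullback g).face φ = (x.face φ).pullback g :=
  congrArg (((SimplexCategory.toCat.map φ).toFunctor ⋙ x) ⋙ ·)
    (pre_push (Over.map g) (map_base g) (structureHom φ))

lemma pullback_id (x : Chain n Y m) : x.pullback (𝟙 Y) = x :=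
  congrArg (x ⋙ ·) (pre_id (j := base Y) (Over.map (𝟙 Y)) (Over.mapId_eq Y) (map_base (𝟙 Y)))

lemma pullback_comp {Y'' : Sm k} (g : Y' ⟶ Y) (g' : Y'' ⟶ Y') (x : Chain n Y m) :
    x.pullback (g' ≫ g) = (x.pullback g).pullback g' :=
  congrArg (x ⋙ ·) (pre_comp (Over.map g) (Over.map g') (Over.map (g' ≫ g)) (Over.mapComp_eq _ _)
    (map_base g) (map_base g') (map_base (g' ≫ g)))

lemma pullback_basept (g : Y' ⟶ Y) : (basept n Y m).pullback g = basept n Y' m :=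
  (const_comp _ _).trans (congrArg (Functor.const _).obj (pre_zero _ _))

/-- The contraction of the whiskers. -/
def contract (τ : m ⟶ ⦋1⦌) (x : Chain n Y m) : Chain n Y m := x ⋙ push (contractHom n _ τ)

lemma contract_face (φ : m' ⟶ m) (τ : m ⟶ ⦋1⦌) (x : Chain n Y m) :
    (x.contract τ).face φ = (x.face φ).contract (φ ≫ τ) := by
  have h := congrArg (push (j := base Y)) (contractHom_structureHom (k := k) (n := n) φ τ)
  rw [push_comp, push_comp] at h
  exact congrArg (((SimplexCategory.toCat.map φ).toFunctor ⋙ x) ⋙ ·) h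

lemma contract_pullback (g : Y' ⟶ Y) (τ : m ⟶ ⦋1⦌) (x : Chain n Y m) :
    (x.contract τ).pullback g = (x.pullback g).contract τ :=
  congrArg (x ⋙ ·) (pre_push (Over.map g) (map_base g) _).symm

lemma contract_basept (τ : m ⟶ ⦋1⦌) : (basept n Y m).contract τ = basept n Y m :=
  (const_comp _ _).trans (congrArg (Functor.const _).obj (push_zero _))

/-- A simplex whose vertices are spans with empty support. -/
def IsNull (x : Chain n Y m) : Prop := ∀ c, (x.obj c).IsNull

/-- The homotopy that replaces empty spans by the base point. -/
def collapse (τ : m ⟶ ⦋1⦌) (x : Chain n Y m) (hx : x.IsNull) : Chain n Y m :=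
  ofNull (fun c => if τ.toOrderHom c = 0 then x.obj c else FlfSpan.zero _ _) fun c => by
    dsimp only
    split
    · exact hx c
    · exact isNull_zero

lemma IsNull.face {x : Chain n Y m} (hx : x.IsNull) (φ : m' ⟶ m) : (x.face φ).IsNull :=
  fun _ => (hx _).push _

lemma IsNull.pullback {x : Chain n Y m} (hx : x.IsNull) (g : Y' ⟶ Y) : (x.pullback g).IsNull :=
  fun c => FlfSpan.IsNull.pre (hx c) (Over.map g) (map_base g)

lemma collapse_isNull (τ : m ⟶ ⦋1⦌) (x : Chain n Y m) (hx : x.IsNull) : (x.collapse τ hx).IsNull :=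
  fun c => by
    change (ite _ _ _ : FlfSpan _ _).IsNull
    split
    · exact hx c
    · exact isNull_zero

lemma collapse_obj_of_eq {τ : m ⟶ ⦋1⦌} (x : Chain n Y m) (hx : x.IsNull) {c : Fin (m.len + 1)}
    (h : τ.toOrderHom c = 0) : (x.collapse τ hx).obj c = x.obj c := if_pos h

lemma collapse_obj_of_ne {τ : m ⟶ ⦋1⦌} (x : Chain n Y m) (hx : x.IsNull) {c : Fin (m.len + 1)}
    (h : τ.toOrderHom c ≠ 0) : (x.collapse τ hx).obj c = FlfSpan.zero _ _ := if_neg h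

lemma collapse_congr {τ : m ⟶ ⦋1⦌} {x y : Chain n Y m} (e : x = y) (hx : x.IsNull)
    (hy : y.IsNull) : x.collapse τ hx = y.collapse τ hy := by
  subst e
  rfl

lemma collapse_face (φ : m' ⟶ m) (τ : m ⟶ ⦋1⦌) (x : Chain n Y m) (hx : x.IsNull) :
    (x.collapse τ hx).face φ = (x.face φ).collapse (φ ≫ τ) (hx.face φ) := by
  refine functor_ext_of_null ((collapse_isNull τ x hx).face φ) fun c => ?_
  by_cases h : τ.toOrderHom (φ.toOrderHom c) = 0
  · exact (congrArg (push (structureHom φ)).obj (collapse_obj_of_eq x hx h)).trans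
      (collapse_obj_of_eq (τ := φ ≫ τ) (x.face φ) (hx.face φ) h).symm
  · exact (congrArg (push (structureHom φ)).obj (collapse_obj_of_ne x hx h)).trans
      ((push_zero _).trans (collapse_obj_of_ne (τ := φ ≫ τ) (x.face φ) (hx.face φ) h).symm)

lemma collapse_pullback (g : Y' ⟶ Y) (τ : m ⟶ ⦋1⦌) (x : Chain n Y m) (hx : x.IsNull) :
    (x.collapse τ hx).pullback g = (x.pullback g).collapse τ (hx.pullback g) := by
  refine functor_ext_of_null ((collapse_isNull τ x hx).pullback g) fun c => ?_
  by_cases h : τ.toOrderHom c = 0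
  · exact (congrArg (pre (Over.map g) (map_base g)).obj (collapse_obj_of_eq x hx h)).trans
      (collapse_obj_of_eq (x.pullback g) (hx.pullback g) h).symm
  · exact (congrArg (pre (Over.map g) (map_base g)).obj (collapse_obj_of_ne x hx h)).trans
      ((pre_zero _ _).trans (collapse_obj_of_ne (x.pullback g) (hx.pullback g) h).symm)

lemma collapse_zero (x : Chain n Y m) (hx : x.IsNull) :
    x.collapse (SimplexCategory.const m ⦋1⦌ 0) hx = x :=
  functor_ext_of_null (collapse_isNull _ x hx) fun _ => collapse_obj_of_eq x hx rfl

lemma collapse_one (x : Chain n Y m) (hx : x.IsNull) :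
    x.collapse (SimplexCategory.const m ⦋1⦌ 1) hx = basept n Y m :=
  functor_ext_of_null (collapse_isNull _ x hx) fun _ =>
    collapse_obj_of_ne x hx (one_ne_zero (α := Fin 2))

lemma collapse_basept (τ : m ⟶ ⦋1⦌) (h : (basept n Y m).IsNull) :
    (basept n Y m).collapse τ h = basept n Y m :=
  functor_ext_of_null (collapse_isNull _ _ h) fun _ => ite_self _

lemma isNull_contract (hn : 0 < n) (x : Chain n Y m) :
    (x.contract (SimplexCategory.const m ⦋1⦌ 1)).IsNull :=
  fun c => isNull_push_contract hn (x.obj c)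

end Chain

/-- A homotopy of self-maps of `B h^flf(𝔾_m^{∧ n})`, given by natural operations on the simplices
`(x, τ)` of `B h^flf(𝔾_m^{∧ n})(Y) × Δ[1]`. -/
structure ChainHomotopy (k : Type u) [Field k] (n : ℕ) where
  toFun {Y : Sm k} {m : SimplexCategory} (τ : m ⟶ ⦋1⦌) (x : Chain n Y m) : Chain n Y m
  toFun_face {Y : Sm k} {m m' : SimplexCategory} (φ : m' ⟶ m) (τ : m ⟶ ⦋1⦌) (x : Chain n Y m) :
    (toFun τ x).face φ = toFun (φ ≫ τ) (x.face φ)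
  toFun_pullback {Y Y' : Sm k} (g : Y' ⟶ Y) {m : SimplexCategory} (τ : m ⟶ ⦋1⦌) (x : Chain n Y m) :
    (toFun τ x).pullback g = toFun τ (x.pullback g)
  toFun_basept {Y : Sm k} {m : SimplexCategory} (τ : m ⟶ ⦋1⦌) :
    toFun τ (Chain.basept n Y m) = Chain.basept n Y m

namespace ChainHomotopy

variable {n : ℕ} (H : ChainHomotopy k n)

/-- The end of a homotopy at the vertex `a` of `Δ[1]`. -/
def atVertex (a : Fin 2) : bar k n ⟶ bar k n where
  app _ :=
    { app m := ⟨H.toFun (SimplexCategory.const m.unop ⦋1⦌ a), H.toFun_basept _⟩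
      naturality m m' φ := Pointed.Hom.ext (funext fun x =>
        (congrArg (H.toFun (SimplexCategory.const m'.unop ⦋1⦌ a)) (Chain.bar_map φ.unop x)).trans
          ((H.toFun_face φ.unop (SimplexCategory.const m.unop ⦋1⦌ a) x).symm.trans
            (Chain.bar_map φ.unop _).symm)) }
  naturality _ _ g := NatTrans.ext (funext fun _ => Pointed.Hom.ext (funext fun x =>
    (H.toFun_pullback g.unop _ x).symm))

/-- The homotopy of maps of presheaves given by natural operations on simplices. -/
def pointedHomotopy : PointedHomotopy (H.atVertex 0) (H.atVertex 1) where
  app Y :=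
    { h :=
        { app m := ↾fun z => H.toFun (SSet.stdSimplex.objEquiv z.2) z.1
          naturality m m' φ := by
            ext z
            exact (congrArg (H.toFun (φ.unop ≫ SSet.stdSimplex.objEquiv z.2))
              (Chain.bar_map φ.unop z.1)).trans
                ((H.toFun_face φ.unop _ z.1).symm.trans (Chain.bar_map φ.unop _).symm) }
      h₀ := rfl
      h₁ := rfl
      basept_comp := by
        ext m τ
        exact H.toFun_basept _ }
  naturality g := by
    ext m z
    exact (H.toFun_pullback g.unop _ z.1).symm

/-- The contraction of the whiskers. -/
def contract (k : Type u) [Field k] (n : ℕ) : ChainHomotopy k n where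
  toFun := Chain.contract
  toFun_face := Chain.contract_face
  toFun_pullback g _ := Chain.contract_pullback g
  toFun_basept := Chain.contract_basept

/-- The homotopy from the contracted spans, which have empty support, to the base point. -/
def collapse (k : Type u) [Field k] {n : ℕ} (hn : 0 < n) : ChainHomotopy k n where
  toFun {_ m} τ x := (x.contract (SimplexCategory.const m ⦋1⦌ 1)).collapse τ (x.isNull_contract hn)
  toFun_face φ τ x := (Chain.collapse_face φ τ _ _).trans
    (Chain.collapse_congr (Chain.contract_face φ _ x) _ _)
  toFun_pullback g _ τ x := (Chain.collapse_pullback g τ _ _).trans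
    (Chain.collapse_congr (Chain.contract_pullback g _ x) _ _)
  toFun_basept τ := (Chain.collapse_congr (Chain.contract_basept _) _ fun _ => isNull_zero).trans
    (Chain.collapse_basept τ _)

lemma collapse_atVertex_zero (hn : 0 < n) :
    (collapse k hn).atVertex 0 = (contract k n).atVertex 1 :=
  NatTrans.ext (funext fun _ => NatTrans.ext (funext fun _ => Pointed.Hom.ext (funext fun x =>
    Chain.collapse_zero _ (Chain.isNull_contract hn x))))

lemma collapse_atVertex_one (hn : 0 < n) :
    (collapse k hn).atVertex 1 = constBasept (bar k n) :=
  NatTrans.ext (funext fun _ => NatTrans.ext (funext fun _ => Pointed.Hom.ext (funext fun x =>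
    Chain.collapse_one _ (Chain.isNull_contract hn x))))

lemma map_loopSpace_contract_eq_constBasept (hn : 0 < n) :
    (HoPSh.of k).map (Functor.whiskerRight ((contract k n).atVertex 0) PSSet.loopSpace) =
      (HoPSh.of k).map (Functor.whiskerRight (constBasept (bar k n)) PSSet.loopSpace) := by
  rw [(contract k n).pointedHomotopy.map_loopSpace_eq, ← collapse_atVertex_zero hn,
    (collapse k hn).pointedHomotopy.map_loopSpace_eq, collapse_atVertex_one]

end ChainHomotopy

end FlfCor

namespace FlfCor

open Sm FlfSpan DiagramFunction

variable {k : Type u} [Field k]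

namespace Chain

variable {n : ℕ} {Y Y' : Sm k} {m m' : SimplexCategory} {U : Nbhd Y} {x : Chain n Y m}

/-- The deformation along the coordinate of `U` is defined on a simplex. -/
def IsDeformableOn (U : Nbhd Y) (x : Chain n Y m) : Prop := ∀ c, (x.obj c).IsDeformableOn U

/-- The deformation of a simplex, over a neighbourhood `U`. -/
def deform (U : Nbhd Y) (x : Chain n Y m) (h : x.IsDeformableOn U) : Chain n U.toSm m :=
  FlfSpan.deform (ofSection U.time) (x.pullback U.proj) h

lemma IsDeformableOn.isDeformable (h : x.IsDeformableOn U) {g : Y' ⟶ U.toSm}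
    {t : DiagramFunction (base Y')}
    (ht : (ofSection U.time).IsRestriction t (Over.map g) (map_base g)) {y : Chain n Y' m}
    (hy : x.pullback (g ≫ U.proj) = y) (c : Fin (m.len + 1)) : (y.obj c).IsDeformable t := by
  subst hy
  rw [pullback_comp]
  exact (h c).pre (Over.map g) (map_base g) ht

lemma deform_pullback (h : x.IsDeformableOn U) {g : Y' ⟶ U.toSm} {t : DiagramFunction (base Y')}
    (ht : (ofSection U.time).IsRestriction t (Over.map g) (map_base g)) {y : Chain n Y' m}
    (hy : x.pullback (g ≫ U.proj) = y) :
    (x.deform U h).pullback g = FlfSpan.deform t y (h.isDeformable ht hy) := by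
  subst hy
  exact (deform_pre (ofSection U.time) (x.pullback U.proj) h (Over.map g) (map_base g) ht
    fun c => (h c).pre (Over.map g) (map_base g) ht).symm.trans
      (FlfSpan.deform_congr (pullback_comp U.proj g x).symm _ _)

lemma IsDeformableOn.anti (h : x.IsDeformableOn U) {V : Nbhd Y} (hV : V ≤ U) :
    x.IsDeformableOn V := fun c => (h c).anti hV

lemma pullback_preimageHom_proj (g : Y' ⟶ Y) (U : Nbhd Y) (x : Chain n Y m) :
    x.pullback (U.preimageHom g ≫ U.proj) = (x.pullback g).pullback (U.preimage g).proj := by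
  rw [Nbhd.preimageHom_proj, pullback_comp]

lemma IsDeformableOn.pullback (h : x.IsDeformableOn U) (g : Y' ⟶ Y) :
    (x.pullback g).IsDeformableOn (U.preimage g) :=
  fun c => h.isDeformable (y := (x.pullback g).pullback (U.preimage g).proj)
    (isRestriction_ofSection _ (Nbhd.preimageHom_time g U)) (pullback_preimageHom_proj g U x) c

lemma IsDeformableOn.face (h : x.IsDeformableOn U) (φ : m' ⟶ m) :
    (x.face φ).IsDeformableOn U := fun c =>
  (congrArg (fun y : Chain n U.toSm m' => (y.obj c).IsDeformable (ofSection U.time))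
    (pullback_face φ U.proj x)).mp
      ((h (φ.toOrderHom c)).push (isStructureMap_structureHom (k := k) (n := n) φ))

lemma deform_face (h : x.IsDeformableOn U) (φ : m' ⟶ m) :
    (x.deform U h).face φ = (x.face φ).deform U (h.face φ) := by
  have hφ := isStructureMap_structureHom (k := k) (n := n) φ
  let y : Fin (m'.len + 1) ⥤ FlfSpan (base U.toSm) (barTarget k n m) :=
    (SimplexCategory.toCat.map φ).toFunctor ⋙ x.pullback U.proj
  have hy (c) : (y.obj c).IsDeformable (ofSection U.time) := h (φ.toOrderHom c)
  calc (x.deform U h).face φ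
      = FlfSpan.deform (ofSection U.time) y hy ⋙ push (structureHom φ) :=
        congrArg (· ⋙ push (structureHom φ)) (comp_deform _ _ (x.pullback U.proj) h)
    _ = FlfSpan.deform (ofSection U.time) (y ⋙ push (structureHom φ))
          fun c => (hy c).push hφ := (deform_push _ y hy hφ _).symm
    _ = (x.face φ).deform U (h.face φ) := FlfSpan.deform_congr (pullback_face φ U.proj x) _ _

lemma deform_incl (h : x.IsDeformableOn U) {V : Nbhd Y} (hV : V ≤ U) :
    (x.deform U h).pullback (Nbhd.incl hV) = x.deform V (h.anti hV) :=
  deform_pullback h (isRestriction_ofSection _ (Nbhd.incl_time hV))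
    (congrArg x.pullback (Nbhd.incl_proj hV))

lemma deform_preimageHom (h : x.IsDeformableOn U) (g : Y' ⟶ Y) :
    (x.deform U h).pullback (U.preimageHom g) =
      (x.pullback g).deform (U.preimage g) (h.pullback g) :=
  deform_pullback h (isRestriction_ofSection _ (Nbhd.preimageHom_time g U))
    (pullback_preimageHom_proj g U x)

lemma deform_zeroLift (h : x.IsDeformableOn U) : (x.deform U h).pullback U.zeroLift = x := by
  have ht := isRestriction_ofSection U.zeroLift U.zeroLift_time
  rw [ofSection_zero] at ht
  have hx : x.pullback (U.zeroLift ≫ U.proj) = x := by rw [Nbhd.zeroLift_proj, pullback_id]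
  exact (deform_pullback h ht hx).trans (deform_zero _ _)

lemma deform_oneLift (h : x.IsDeformableOn U) :
    (x.deform U h).pullback U.oneLift = x.contract (SimplexCategory.const m ⦋1⦌ 0) := by
  have ht := isRestriction_ofSection U.oneLift U.oneLift_time
  rw [ofSection_one] at ht
  have hx : x.pullback (U.oneLift ≫ U.proj) = x := by rw [Nbhd.oneLift_proj, pullback_id]
  exact (deform_pullback h ht hx).trans (deform_one _ _)

lemma isDeformableOn_basept (U : Nbhd Y) : (basept n Y m).IsDeformableOn U := fun c =>
  (congrArg (fun y : Chain n U.toSm m => (y.obj c).IsDeformable (ofSection U.time))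
    (pullback_basept U.proj)).mpr (isDeformable_zero _)

lemma deform_basept (U : Nbhd Y) :
    (basept n Y m).deform U (isDeformableOn_basept U) = basept n U.toSm m :=
  (FlfSpan.deform_congr (pullback_basept U.proj) _ fun _ => isDeformable_zero _).trans
    (deform_const_zero _ _)

lemma exists_isDeformableOn (x : Chain n Y m) : ∃ U : Nbhd Y, x.IsDeformableOn U :=
  FlfSpan.exists_isDeformableOn x.obj

lemma deform_congr {y : Chain n Y m} (h : x = y) (hx : x.IsDeformableOn U)
    (hy : y.IsDeformableOn U) : x.deform U hx = y.deform U hy := by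
  subst h
  rfl

lemma bar_map_toFun (g : Y' ⟶ Y) (x : Chain n Y m) :
    (((bar k n).map g.op).app (op m)).toFun x = x.pullback g := rfl

end Chain

/-- The subspace of `B h^flf(𝔾_m^{∧ n})(Y)` on which the deformation over `U` is defined. -/
def barDomain (n : ℕ) {Y : Sm k} (U : Nbhd Y) : ((bar k n).obj (op Y)).Subcomplex where
  carrier _ := {x | Chain.IsDeformableOn U x}
  point_mem _ := Chain.isDeformableOn_basept U
  map_mem φ x hx := (congrArg (Chain.IsDeformableOn U) (Chain.bar_map φ.unop x)).mpr
    (Chain.IsDeformableOn.face hx φ.unop)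

/-- The subspaces on which the deformation is defined, as a diagram. -/
def barDomainFunctor (n : ℕ) (Y : Sm k) : (Nbhd Y)ᵒᵖ ⥤ ((bar k n).obj (op Y)).Subcomplex where
  obj U := barDomain n U.unop
  map f := homOfLE fun _ _ hx => Chain.IsDeformableOn.anti hx (leOfHom f.unop)

/-- The deformation of spans along `(1 - t) x + t`, over a neighbourhood `U`. -/
def barDeform (n : ℕ) {Y : Sm k} (U : Nbhd Y) :
    (barDomain n U).toPSSet ⟶ (bar k n).obj (op U.toSm) where
  app _ := ⟨fun x => Chain.deform U x.1 x.2, Chain.deform_basept U⟩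
  naturality _ _ φ := Pointed.Hom.ext (funext fun x =>
    (Chain.deform_congr (Chain.bar_map φ.unop x.1) ((barDomain n U).map_mem φ x.2)
      (Chain.IsDeformableOn.face x.2 φ.unop)).trans
      ((Chain.deform_face x.2 φ.unop).symm.trans (Chain.bar_map φ.unop _).symm))

/-- The base change of the subspaces on which the deformation is defined. -/
def barDomainMap (n : ℕ) {Y Y' : Sm k} (g : Y' ⟶ Y) (U : Nbhd Y) :
    (barDomain n U).toPSSet ⟶ (barDomain n (U.preimage g)).toPSSet :=
  PSSet.Subcomplex.mapOfMapsTo ((bar k n).map g.op) fun _ _ hx =>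
    Chain.IsDeformableOn.pullback hx g

end FlfCor

namespace FlfCor

open Sm

variable {k : Type u} [Field k]

lemma barDeform_map {n : ℕ} {Y Y' : Sm k} (U : Nbhd Y) (g : Y' ⟶ U.toSm) {m : SimplexCategoryᵒᵖ}
    (x : ((barDomain n U).toPSSet.obj m).X) :
    ((barDeform n U ≫ (bar k n).map g.op).app m).toFun x =
      Chain.pullback g (Chain.deform U x.1 x.2) :=
  Chain.bar_map_toFun (m := m.unop) g _

variable (k) in
/-- The deformation of spans along `(1 - t) x + t`. -/
def barDeformation (n : ℕ) :
    RationalDeformation (bar k n) ((ChainHomotopy.contract k n).atVertex 0) where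
  T Y := barDomainFunctor n Y ⋙ PSSet.Subcomplex.functor _
  i U := (barDomain n U).ι
  map_i h := PSSet.Subcomplex.functor_map_ι ((barDomainFunctor n _).map (homOfLE h).op)
  s U := barDeform n U
  map_s h := PSSet.hom_ext fun _ x =>
    ((barDeform_map _ (Nbhd.incl h) x).trans (Chain.deform_incl x.2 h)).symm
  base g U := barDomainMap n g U
  base_i _ _ := rfl
  base_s g U := PSSet.hom_ext fun _ x =>
    ((barDeform_map U (U.preimageHom g) x).trans (Chain.deform_preimageHom x.2 g)).symm
  s_zero U := PSSet.hom_ext fun _ x =>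
    (barDeform_map U U.zeroLift x).trans (Chain.deform_zeroLift x.2)
  s_one U := PSSet.hom_ext fun _ x =>
    (barDeform_map U U.oneLift x).trans (Chain.deform_oneLift x.2)

def isColimitCoconeBarDeformation (n : ℕ) (Y : Sm k) :
    IsColimit (PSSet.forget.mapCocone ((barDeformation k n).cocone Y)) :=
  PSSet.Subcomplex.isColimitCocone (barDomainFunctor n Y) fun m x =>
    (Chain.exists_isDeformableOn (m := m.unop) x).elim fun U hU => ⟨op U, hU⟩

end FlfCor

end

theorem proposition3p9_general (k : Type u) [Field k] (n : ℕ) (hn : 0 < n) :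
    FlfCor.RationallyContractible (FlfCor.gp (FlfCor.hflf (FlfCor.GmSmash k n))) :=
  (FlfCor.barDeformation k n).rationallyContractible_loopSpace
    (FlfCor.isColimitCoconeBarDeformation n)
    (FlfCor.ChainHomotopy.map_loopSpace_contract_eq_constBasept hn)

theorem proposition3p9 (k : Type u) [Field k] [PerfectField k] (n : ℕ) (hn : 0 < n) :
    FlfCor.RationallyContractible (FlfCor.gp (FlfCor.hflf (FlfCor.GmSmash k n))) :=
  proposition3p9_general k n hn
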